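/- Let $\ell$ be a prime. Let $J=\left[\begin{smallmatrix} &&&1\\&&1&\\&-1&&\\-1&&&\end{smallmatrix}\right]$ and, for a commutative ring $R$, let $\mathrm{GSp}_4(R)=\{g\in \mathrm{GL}_4(R) : g^tJg=\mu(g)J \text{ for some } \mu(g)\in R^\times\}$. Put $G=\mathrm{GSp}_4\times\mathrm{GL}_2$ and $H=\mathrm{GL}_2\times_{\mathrm{GL}_1}\mathrm{GL}_2=\{(h_1,h_2) : \det h_1=\det h_2\}$, and embed $H$ in $G$ by $$\iota:\left(\left[\begin{smallmatrix}a_1&b_1\\c_1&d_1\end{smallmatrix}\right],\left[\begin{smallmatrix}a_2&b_2\\c_2&d_2\end{smallmatrix}\right]\right)\mapsto\left(\left[\begin{smallmatrix}a_1&&&b_1\\&a_2&b_2&\\&c_2&d_2&\\c_1&&&d_1\end{smallmatrix}\right],\left[\begin{smallmatrix}a_2&b_2\\c_2&d_2\end{smallmatrix}\right]\right),$$ and in $\mathrm{GSp}_4$ by the first component of $\iota$. For $\Gamma\in\{H,\mathrm{GSp}_4,G\}$ let $\mathcal{H}_\Gamma^\circ$ be the spherical Hecke algebra of $\Gamma(\mathbf{Z}_\ell)$-bi-invariant,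 compactly supported functions $\Gamma(\mathbf{Q}_\ell)\to\mathbf{C}$ under convolution, with respect to the Haar measure giving $\Gamma(\mathbf{Z}_\ell)$ volume $1$; the same Haar measures are used below. Write $\mathrm{ch}(X)$ for the characteristic function of $X$. (1) Let $C_c^\infty(H(\mathbf{Z}_\ell)\backslash\mathrm{GSp}_4(\mathbf{Q}_\ell)/\mathrm{GSp}_4(\mathbf{Z}_\ell))$ be the space of compactly supported functions $\xi:\mathrm{GSp}_4(\mathbf{Q}_\ell)\to\mathbf{C}$ that are left $H(\mathbf{Z}_\ell)$-invariant and right $\mathrm{GSp}_4(\mathbf{Z}_\ell)$-invariant. It is a module over $\mathcal{H}_H^\circ\otimes_{\mathbf{C}}\mathcal{H}_{\mathrm{GSp}_4}^\circ$ through $$((\theta_1\otimes\theta_2)\cdot\xi)(x)=\int_{\mathrm{GSp}_4(\mathbf{Q}_\ell)}\int_{H(\mathbf{Q}_\ell)}\theta_1(h)\theta_2(g)\,\xi(h^{-1}xg)\,dh\,dg .$$ This module is cyclic, generated by $\mathrm{ch}(\mathrm{GSp}_4(\mathbf{Z}_\ell))$. (2) Let $\mathcal{S}(\mathbf{Q}_\ell^2)$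 be the space of locally constant, compactly supported functions $\mathbf{Q}_\ell^2\to\mathbf{C}$ (row vectors), with the action $((h_1,h_2)\cdot\phi)(v)=\phi(vh_1)$ of $H(\mathbf{Q}_\ell)$. Let $C_c^\infty(G(\mathbf{Q}_\ell)/G(\mathbf{Z}_\ell))$ be the space of compactly supported, right $G(\mathbf{Z}_\ell)$-invariant functions $G(\mathbf{Q}_\ell)\to\mathbf{C}$, with the action $(h\cdot\xi)(x)=\xi(\iota(h)^{-1}x)$ of $H(\mathbf{Q}_\ell)$. Let $$\mathcal{I}(G(\mathbf{Q}_\ell)/G(\mathbf{Z}_\ell))=\left[\mathcal{S}(\mathbf{Q}_\ell^2)\otimes C_c^\infty(G(\mathbf{Q}_\ell)/G(\mathbf{Z}_\ell))\right]_{H(\mathbf{Q}_\ell)}$$ be the space of $H(\mathbf{Q}_\ell)$-coinvariants of the tensor product (with the diagonal action), a module over $\mathcal{H}_G^\circ$ through $\theta\cdot[\phi\otimes\xi]=\left[\phi\otimes\int_{G(\mathbf{Q}_\ell)}\theta(g)\,\xi((-)g)\,dg\right]$. This module is cyclic, generated by the class of $\mathrm{ch}(\mathbf{Z}_\ell^2)\otimes\mathrm{ch}(G(\mathbf{Z}_\ell))$.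 -/

import Mathlib

open scoped TensorProduct

set_option linter.unusedSectionVars false
set_option linter.style.haveILetI false

noncomputable section

namespace GSp4Hecke

open MeasureTheory TopologicalSpace

section General

variable {G : Type*} [Group G] [TopologicalSpace G] [IsTopologicalGroup G]

/-- Compact open subgroups. -/
class IsCompactOpen (K : Subgroup G) : Prop where
  isCompact : IsCompact (K : Set G)
  isOpen : IsOpen (K : Set G)

/-- The compact open subgroup `K` as a compact set with nonempty interior. -/
def posCompact (K : Subgroup G) [hK : IsCompactOpen K] : PositiveCompacts G :=
  ⟨⟨K, hK.isCompact⟩, by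
    change (interior (K : Set G)).Nonempty
    rw [hK.isOpen.interior_eq]; exact ⟨1, K.one_mem⟩⟩

/-- The integral `∫ f(x) dx` with respect to the Haar measure (on the Borel sets of `G`) giving the
compact open subgroup `K` volume `1`. -/
def haarInt (K : Subgroup G) [IsCompactOpen K] (f : G → ℂ) : ℂ :=
  letI : MeasurableSpace G := borel G
  haveI : BorelSpace G := ⟨rfl⟩
  ∫ x, f x ∂(Measure.haarMeasure (posCompact K))

theorem haarInt_add (K : Subgroup G) [IsCompactOpen K] {f g : G → ℂ}
    (hf : Continuous f) (hf' : HasCompactSupport f) (hg : Continuous g)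
    (hg' : HasCompactSupport g) :
    haarInt K (fun x => f x + g x) = haarInt K f + haarInt K g := by
  letI : MeasurableSpace G := borel G
  haveI : BorelSpace G := ⟨rfl⟩
  exact integral_add (hf.integrable_of_hasCompactSupport hf')
    (hg.integrable_of_hasCompactSupport hg')

theorem haarInt_const_mul (K : Subgroup G) [IsCompactOpen K] (c : ℂ) (f : G → ℂ) :
    haarInt K (fun x => c * f x) = c * haarInt K f := by
  letI : MeasurableSpace G := borel G
  haveI : BorelSpace G := ⟨rfl⟩
  exact integral_const_mul c f

theorem haarInt_zero (K : Subgroup G) [IsCompactOpen K] : haarInt K (fun _ => 0) = 0 := by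
  simpa using haarInt_const_mul K 0 (fun _ => 0)

theorem haarInt_mul_left (K : Subgroup G) [IsCompactOpen K] (a : G) (f : G → ℂ) :
    haarInt K (fun x => f (a * x)) = haarInt K f := by
  letI : MeasurableSpace G := borel G
  haveI : BorelSpace G := ⟨rfl⟩
  exact integral_mul_left_eq_self f a

theorem haarInt_indicator (K : Subgroup G) [hK : IsCompactOpen K] :
    haarInt K ((K : Set G).indicator 1) = 1 := by
  letI : MeasurableSpace G := borel G
  haveI : BorelSpace G := ⟨rfl⟩
  have h : (Measure.haarMeasure (posCompact K)) (K : Set G) = 1 :=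
    Measure.haarMeasure_self (K₀ := posCompact K)
  have h2 : ∫ x, (K : Set G).indicator (1 : G → ℂ) x ∂(Measure.haarMeasure (posCompact K)) = 1 := by
    rw [integral_indicator hK.isOpen.measurableSet]
    simp [Measure.real, h]
  exact h2

theorem haarInt_swap {G' : Type*} [Group G'] [TopologicalSpace G'] [IsTopologicalGroup G']
    (K : Subgroup G) [IsCompactOpen K] (K' : Subgroup G') [IsCompactOpen K']
    {f : G → G' → ℂ} (hf : Continuous f.uncurry) {S : Set G} {S' : Set G'} (hS : IsCompact S)
    (hS' : IsCompact S') (h : ∀ x y, f x y ≠ 0 → x ∈ S ∧ y ∈ S') :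
    haarInt K (fun x => haarInt K' (fun y => f x y)) =
      haarInt K' (fun y => haarInt K (fun x => f x y)) := by
  letI : MeasurableSpace G := borel G
  haveI : BorelSpace G := ⟨rfl⟩
  letI : MeasurableSpace G' := borel G'
  haveI : BorelSpace G' := ⟨rfl⟩
  exact integral_integral_swap_of_hasCompactSupport hf
    (HasCompactSupport.of_support_subset_isCompact (hS.prod hS') fun p hp => h p.1 p.2 hp)

/-- The space `C_c^∞(L \ G / K)`: locally constant, compactly supported functions `f : G → ℂ` with
`f (l x k) = f x` for `l ∈ L` and `k ∈ K`. -/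
def CcBi (L K : Subgroup G) : Submodule ℂ (G → ℂ) where
  carrier := {f | IsLocallyConstant f ∧ HasCompactSupport f ∧
    (∀ l ∈ L, ∀ x, f (l * x) = f x) ∧ ∀ k ∈ K, ∀ x, f (x * k) = f x}
  add_mem' := by
    rintro f g ⟨hf1, hf2, hf3, hf4⟩ ⟨hg1, hg2, hg3, hg4⟩
    refine ⟨hf1.add hg1, hf2.add hg2, fun l hl x => ?_, fun k hk x => ?_⟩
    · simp [hf3 l hl, hg3 l hl]
    · simp [hf4 k hk, hg4 k hk]
  zero_mem' := ⟨IsLocallyConstant.const 0, HasCompactSupport.zero, by simp, by simp⟩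
  smul_mem' := by
    rintro c f ⟨hf1, hf2, hf3, hf4⟩
    refine ⟨hf1.comp (fun z => c • z), ?_, fun l hl x => ?_, fun k hk x => ?_⟩
    · exact hf2.comp_left (g := fun z : ℂ => c • z) (by simp)
    · simp [hf3 l hl]
    · simp [hf4 k hk]

variable {L K : Subgroup G}

theorem CcBi.continuous (f : CcBi L K) : Continuous (f : G → ℂ) := f.2.1.continuous
theorem CcBi.compact (f : CcBi L K) : HasCompactSupport (f : G → ℂ) := f.2.2.1
theorem CcBi.left (f : CcBi L K) {l : G} (hl : l ∈ L) (x : G) : f.1 (l * x) = f.1 x :=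
  f.2.2.2.1 l hl x
theorem CcBi.right (f : CcBi L K) {k : G} (hk : k ∈ K) (x : G) : f.1 (x * k) = f.1 x :=
  f.2.2.2.2 k hk x
theorem CcBi.mem_tsupport (f : CcBi L K) {x : G} (h : f.1 x ≠ 0) : x ∈ tsupport f.1 :=
  subset_tsupport _ h

theorem isLocallyConstant_of_right {K : Subgroup G} [hK : IsCompactOpen K] {f : G → ℂ}
    (h : ∀ k ∈ K, ∀ x, f (x * k) = f x) : IsLocallyConstant f := by
  rw [IsLocallyConstant.iff_exists_open]
  intro x
  refine ⟨(fun y => x⁻¹ * y) ⁻¹' K, hK.isOpen.preimage (by fun_prop), by simp [K.one_mem], ?_⟩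
  intro y hy
  have := h _ hy x
  simpa using this

/-- The characteristic function of `K`, as an element of `C_c^∞(L \ G / K)` for `L ≤ K`. -/
def ch (L K : Subgroup G) [hK : IsCompactOpen K] (hLK : L ≤ K) : CcBi L K :=
  have hr : ∀ k ∈ K, ∀ x, (K : Set G).indicator (1 : G → ℂ) (x * k) =
      (K : Set G).indicator (1 : G → ℂ) x := by
    intro k hk x
    have := K.mul_mem_cancel_right (x := k) (y := x) hk
    by_cases hx : x ∈ K <;> simp [hx, this]
  ⟨(K : Set G).indicator 1, isLocallyConstant_of_right hr,
    HasCompactSupport.of_support_subset_isCompact hK.isCompact (by simp), by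
      intro l hl x
      have := K.mul_mem_cancel_left (x := l) (y := x) (hLK hl)
      by_cases hx : x ∈ K <;> simp [hx, this], hr⟩

/-- Right translation action: `(θ · ξ)(x) = ∫ θ(g) ξ(x g) dg`, for `θ ∈ C_c^∞(K \ G / K)` and
`ξ ∈ C_c^∞(L \ G / K)`. -/
def rightAct [IsCompactOpen K] (θ : CcBi K K) (ξ : CcBi L K) : CcBi L K :=
  have hr : ∀ k ∈ K, ∀ x, haarInt K (fun g => θ.1 g * ξ.1 (x * k * g)) =
      haarInt K (fun g => θ.1 g * ξ.1 (x * g)) := by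
    intro k hk x
    rw [← haarInt_mul_left K k (fun g => θ.1 g * ξ.1 (x * g))]
    simp only [(CcBi.left θ) hk, mul_assoc]
  ⟨fun x => haarInt K (fun g => θ.1 g * ξ.1 (x * g)), isLocallyConstant_of_right hr, by
    refine HasCompactSupport.of_support_subset_isCompact ((CcBi.compact ξ).isCompact.mul (CcBi.compact θ).isCompact.inv) ?_
    intro x hx
    by_contra hne
    refine hx ?_
    change haarInt K (fun g => θ.1 g * ξ.1 (x * g)) = 0
    rw [← haarInt_zero K]
    congr 1
    funext g
    by_contra h
    rw [mul_eq_zero, not_or] at h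
    exact hne ⟨x * g, (CcBi.mem_tsupport ξ) h.2, g⁻¹, by simpa using (CcBi.mem_tsupport θ) h.1, by simp⟩,
   by
    intro l hl x
    simp only [mul_assoc, (CcBi.left ξ) hl], hr⟩

variable {A : Type*} [Group A] [TopologicalSpace A] [IsTopologicalGroup A]

/-- Left translation action through `ι : A → G`: `(θ · ξ)(x) = ∫ θ(h) ξ(ι(h)⁻¹ x) dh`, for
`θ ∈ C_c^∞(B \ A / B)` and `ξ ∈ C_c^∞(ι(B) \ G / K)`. -/
def leftAct (ι : A →ₜ* G) {B : Subgroup A} [IsCompactOpen B] [IsCompactOpen K]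
    (hL : L = B.map (ι : A →* G)) (θ : CcBi B B) (ξ : CcBi L K) : CcBi L K :=
  have hr : ∀ k ∈ K, ∀ x, haarInt B (fun h => θ.1 h * ξ.1 ((ι h)⁻¹ * (x * k))) =
      haarInt B (fun h => θ.1 h * ξ.1 ((ι h)⁻¹ * x)) := by
    intro k hk x
    simp only [← mul_assoc, (CcBi.right ξ) hk]
  ⟨fun x => haarInt B (fun h => θ.1 h * ξ.1 ((ι h)⁻¹ * x)), isLocallyConstant_of_right hr, by
    refine HasCompactSupport.of_support_subset_isCompact
      (((CcBi.compact θ).isCompact.image ι.continuous_toFun).mul (CcBi.compact ξ).isCompact) ?_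
    intro x hx
    by_contra hne
    refine hx ?_
    change haarInt B (fun h => θ.1 h * ξ.1 ((ι h)⁻¹ * x)) = 0
    rw [← haarInt_zero B]
    congr 1
    funext g
    by_contra h
    rw [mul_eq_zero, not_or] at h
    exact hne ⟨ι g, ⟨g, (CcBi.mem_tsupport θ) h.1, rfl⟩, _, (CcBi.mem_tsupport ξ) h.2, by simp⟩,
   by
    intro l hl x
    subst hL
    obtain ⟨b, hb, rfl⟩ := hl
    change haarInt B (fun h => θ.1 h * ξ.1 ((ι h)⁻¹ * (ι b * x))) =
      haarInt B (fun h => θ.1 h * ξ.1 ((ι h)⁻¹ * x))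
    rw [← haarInt_mul_left B b (fun h => θ.1 h * ξ.1 ((ι h)⁻¹ * (ι b * x)))]
    simp [(CcBi.left θ) hb, mul_assoc], hr⟩

theorem rightAct_apply [IsCompactOpen K] (θ : CcBi K K) (ξ : CcBi L K) (x : G) :
    (rightAct θ ξ).1 x = haarInt K (fun g => θ.1 g * ξ.1 (x * g)) := rfl

theorem leftAct_apply (ι : A →ₜ* G) {B : Subgroup A} [IsCompactOpen B] [IsCompactOpen K]
    (hL : L = B.map (ι : A →* G)) (θ : CcBi B B) (ξ : CcBi L K) (x : G) :
    (leftAct ι hL θ ξ).1 x = haarInt B (fun h => θ.1 h * ξ.1 ((ι h)⁻¹ * x)) := rfl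

theorem rightAct_add [IsCompactOpen K] (θ : CcBi K K) (ξ ξ' : CcBi L K) :
    rightAct θ (ξ + ξ') = rightAct θ ξ + rightAct θ ξ' := by
  ext x
  have h1 (η : CcBi L K) : Continuous (fun g => θ.1 g * η.1 (x * g)) :=
    (CcBi.continuous θ).mul ((CcBi.continuous η).comp (by fun_prop))
  have := haarInt_add K (h1 ξ) (CcBi.compact θ).mul_right (h1 ξ') (CcBi.compact θ).mul_right
  simpa [rightAct_apply, mul_add] using this

theorem add_rightAct [IsCompactOpen K] (θ θ' : CcBi K K) (ξ : CcBi L K) :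
    rightAct (θ + θ') ξ = rightAct θ ξ + rightAct θ' ξ := by
  ext x
  have h1 (η : CcBi K K) : Continuous (fun g => η.1 g * ξ.1 (x * g)) :=
    (CcBi.continuous η).mul ((CcBi.continuous ξ).comp (by fun_prop))
  have := haarInt_add K (h1 θ) (CcBi.compact θ).mul_right (h1 θ') (CcBi.compact θ').mul_right
  simpa [rightAct_apply, add_mul] using this

theorem smul_rightAct [IsCompactOpen K] (c : ℂ) (θ : CcBi K K) (ξ : CcBi L K) :
    rightAct (c • θ) ξ = c • rightAct θ ξ := by
  ext x
  simpa [rightAct_apply, mul_assoc] using haarInt_const_mul K c (fun g => θ.1 g * ξ.1 (x * g))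

theorem rightAct_smul [IsCompactOpen K] (c : ℂ) (θ : CcBi K K) (ξ : CcBi L K) :
    rightAct θ (c • ξ) = c • rightAct θ ξ := by
  ext x
  simpa [rightAct_apply, mul_left_comm] using
    haarInt_const_mul K c (fun g => θ.1 g * ξ.1 (x * g))

theorem zero_rightAct [IsCompactOpen K] (ξ : CcBi L K) : rightAct (0 : CcBi K K) ξ = 0 := by
  simpa using smul_rightAct 0 (0 : CcBi K K) ξ

theorem rightAct_zero [IsCompactOpen K] (θ : CcBi K K) : rightAct θ (0 : CcBi L K) = 0 := by
  simpa using rightAct_smul 0 θ (0 : CcBi L K)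

section Left

variable (ι : A →ₜ* G) {B : Subgroup A} [IsCompactOpen B] [IsCompactOpen K]
    (hL : L = B.map (ι : A →* G))

theorem leftAct_continuous_aux (θ : CcBi B B) (ξ : CcBi L K) (x : G) :
    Continuous (fun h => θ.1 h * ξ.1 ((ι h)⁻¹ * x)) := by
  have := ι.continuous_toFun
  exact (CcBi.continuous θ).mul ((CcBi.continuous ξ).comp (by fun_prop))

theorem leftAct_add (θ : CcBi B B) (ξ ξ' : CcBi L K) :
    leftAct ι hL θ (ξ + ξ') = leftAct ι hL θ ξ + leftAct ι hL θ ξ' := by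
  ext x
  have := haarInt_add B (leftAct_continuous_aux ι θ ξ x) (CcBi.compact θ).mul_right
    (leftAct_continuous_aux ι θ ξ' x) (CcBi.compact θ).mul_right
  simpa [leftAct_apply, mul_add] using this

theorem add_leftAct (θ θ' : CcBi B B) (ξ : CcBi L K) :
    leftAct ι hL (θ + θ') ξ = leftAct ι hL θ ξ + leftAct ι hL θ' ξ := by
  ext x
  have := haarInt_add B (leftAct_continuous_aux ι θ ξ x) (CcBi.compact θ).mul_right
    (leftAct_continuous_aux ι θ' ξ x) (CcBi.compact θ').mul_right
  simpa [leftAct_apply, add_mul] using this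

theorem smul_leftAct (c : ℂ) (θ : CcBi B B) (ξ : CcBi L K) :
    leftAct ι hL (c • θ) ξ = c • leftAct ι hL θ ξ := by
  ext x
  simpa [leftAct_apply, mul_assoc] using
    haarInt_const_mul B c (fun h => θ.1 h * ξ.1 ((ι h)⁻¹ * x))

theorem leftAct_smul (c : ℂ) (θ : CcBi B B) (ξ : CcBi L K) :
    leftAct ι hL θ (c • ξ) = c • leftAct ι hL θ ξ := by
  ext x
  simpa [leftAct_apply, mul_left_comm] using
    haarInt_const_mul B c (fun h => θ.1 h * ξ.1 ((ι h)⁻¹ * x))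

theorem zero_leftAct (ξ : CcBi L K) : leftAct ι hL (0 : CcBi B B) ξ = 0 := by
  simpa using smul_leftAct ι hL 0 (0 : CcBi B B) ξ

theorem leftAct_zero (θ : CcBi B B) : leftAct ι hL θ (0 : CcBi L K) = 0 := by
  simpa using leftAct_smul ι hL 0 θ (0 : CcBi L K)

end Left

theorem eq_map_id (K : Subgroup G) : K = K.map (ContinuousMonoidHom.id G : G →* G) := by
  ext; simp

/-- The usual convolution `(θ₁ * θ₂)(x) = ∫ θ₁(y) θ₂(y⁻¹ x) dy` on `C_c^∞(K \ G / K)`, the Haar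
measure giving `K` volume `1`. -/
def convolution [IsCompactOpen K] (θ₁ θ₂ : CcBi K K) : CcBi K K :=
  leftAct (ContinuousMonoidHom.id G) (eq_map_id K) θ₁ θ₂

theorem convolution_apply [IsCompactOpen K] (θ₁ θ₂ : CcBi K K) (x : G) :
    (convolution θ₁ θ₂).1 x = haarInt K (fun y => θ₁.1 y * θ₂.1 (y⁻¹ * x)) := rfl

theorem convolution_leftAct (ι : A →ₜ* G) {B : Subgroup A} [IsCompactOpen B] [IsCompactOpen K]
    (hL : L = B.map (ι : A →* G)) (θ₁ θ₂ : CcBi B B) (ξ : CcBi L K) :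
    leftAct ι hL (convolution θ₁ θ₂) ξ = leftAct ι hL θ₁ (leftAct ι hL θ₂ ξ) := by
  ext x
  have hι := ι.continuous_toFun
  have hι' : Continuous ι := ι.continuous_toFun
  have key := haarInt_swap B B
    (f := fun y h => θ₁.1 y * θ₂.1 (y⁻¹ * h) * ξ.1 ((ι h)⁻¹ * x))
    (by
      refine (((CcBi.continuous θ₁).comp (by fun_prop)).mul ((CcBi.continuous θ₂).comp (by fun_prop))).mul
        ((CcBi.continuous ξ).comp (by fun_prop)))
    (CcBi.compact θ₁).isCompact ((CcBi.compact θ₁).isCompact.mul (CcBi.compact θ₂).isCompact)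
    (by
      intro y h hne
      have h1 : θ₁.1 y ≠ 0 := fun h0 => hne (by simp [h0])
      have h2 : θ₂.1 (y⁻¹ * h) ≠ 0 := fun h0 => hne (by simp [h0])
      exact ⟨(CcBi.mem_tsupport θ₁) h1, y, (CcBi.mem_tsupport θ₁) h1, _, (CcBi.mem_tsupport θ₂) h2, by simp⟩)
  simp only [leftAct_apply, convolution_apply]
  calc _ = haarInt B (fun h => haarInt B (fun y =>
        θ₁.1 y * θ₂.1 (y⁻¹ * h) * ξ.1 ((ι h)⁻¹ * x))) := by
        congr 1; funext h
        rw [mul_comm, ← haarInt_const_mul]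
        congr 1; funext y; ring
    _ = _ := key.symm
    _ = _ := by
        congr 1; funext y
        rw [← haarInt_const_mul, ← haarInt_mul_left B y]
        congr 1; funext h
        simp [mul_assoc]

theorem convolution_rightAct [IsCompactOpen K] (θ₁ θ₂ : CcBi K K) (ξ : CcBi L K) :
    rightAct (convolution θ₁ θ₂) ξ = rightAct θ₁ (rightAct θ₂ ξ) := by
  ext x
  have key := haarInt_swap K K
    (f := fun y h => θ₁.1 y * θ₂.1 (y⁻¹ * h) * ξ.1 (x * h))
    (by
      refine (((CcBi.continuous θ₁).comp (by fun_prop)).mul ((CcBi.continuous θ₂).comp (by fun_prop))).mul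
        ((CcBi.continuous ξ).comp (by fun_prop)))
    (CcBi.compact θ₁).isCompact ((CcBi.compact θ₁).isCompact.mul (CcBi.compact θ₂).isCompact)
    (by
      intro y h hne
      have h1 : θ₁.1 y ≠ 0 := fun h0 => hne (by simp [h0])
      have h2 : θ₂.1 (y⁻¹ * h) ≠ 0 := fun h0 => hne (by simp [h0])
      exact ⟨(CcBi.mem_tsupport θ₁) h1, y, (CcBi.mem_tsupport θ₁) h1, _, (CcBi.mem_tsupport θ₂) h2, by simp⟩)
  simp only [rightAct_apply, convolution_apply]
  calc _ = haarInt K (fun h => haarInt K (fun y =>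
        θ₁.1 y * θ₂.1 (y⁻¹ * h) * ξ.1 (x * h))) := by
        congr 1; funext h
        rw [mul_comm, ← haarInt_const_mul]
        congr 1; funext y; ring
    _ = _ := key.symm
    _ = _ := by
        congr 1; funext y
        rw [← haarInt_const_mul, ← haarInt_mul_left K y]
        congr 1; funext h
        simp [mul_assoc]

theorem leftAct_rightAct (ι : A →ₜ* G) {B : Subgroup A} [IsCompactOpen B] [IsCompactOpen K]
    (hL : L = B.map (ι : A →* G)) (θ₁ : CcBi B B) (θ₂ : CcBi K K) (ξ : CcBi L K) :
    leftAct ι hL θ₁ (rightAct θ₂ ξ) = rightAct θ₂ (leftAct ι hL θ₁ ξ) := by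
  ext x
  have hι' : Continuous ι := ι.continuous_toFun
  have key := haarInt_swap B K
    (f := fun h g => θ₁.1 h * θ₂.1 g * ξ.1 ((ι h)⁻¹ * x * g))
    (by
      refine (((CcBi.continuous θ₁).comp (by fun_prop)).mul ((CcBi.continuous θ₂).comp (by fun_prop))).mul
        ((CcBi.continuous ξ).comp (by fun_prop)))
    (CcBi.compact θ₁).isCompact (CcBi.compact θ₂).isCompact
    (by
      intro y h hne
      have h1 : θ₁.1 y ≠ 0 := fun h0 => hne (by simp [h0])
      have h2 : θ₂.1 h ≠ 0 := fun h0 => hne (by simp [h0])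
      exact ⟨(CcBi.mem_tsupport θ₁) h1, (CcBi.mem_tsupport θ₂) h2⟩)
  simp only [leftAct_apply, rightAct_apply]
  calc _ = haarInt B (fun h => haarInt K (fun g =>
        θ₁.1 h * θ₂.1 g * ξ.1 ((ι h)⁻¹ * x * g))) := by
        congr 1; funext h
        rw [← haarInt_const_mul]
        congr 1; funext y; ring
    _ = _ := key
    _ = _ := by
        congr 1; funext y
        rw [← haarInt_const_mul]
        congr 1; funext h
        simp only [mul_assoc]; ring

theorem ch_rightAct [IsCompactOpen K] (ξ : CcBi L K) : rightAct (ch K K le_rfl) ξ = ξ := by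
  ext x
  have : ∀ g, (ch K K le_rfl).1 g * ξ.1 (x * g) = ξ.1 x * (K : Set G).indicator 1 g := by
    intro g
    by_cases hg : g ∈ K
    · simp [ch, hg, (CcBi.right ξ) hg]
    · simp [ch, hg]
  rw [rightAct_apply]
  simp only [this]
  rw [haarInt_const_mul, haarInt_indicator, mul_one]

theorem ch_leftAct (ι : A →ₜ* G) {B : Subgroup A} [IsCompactOpen B] [IsCompactOpen K]
    (hL : L = B.map (ι : A →* G)) (ξ : CcBi L K) : leftAct ι hL (ch B B le_rfl) ξ = ξ := by
  ext x
  have : ∀ h, (ch B B le_rfl).1 h * ξ.1 ((ι h)⁻¹ * x) = ξ.1 x * (B : Set A).indicator 1 h := by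
    intro h
    by_cases hg : h ∈ B
    · have : (ι h)⁻¹ ∈ L := by
        rw [hL]; exact ⟨h⁻¹, B.inv_mem hg, by simp⟩
      simp [ch, hg, (CcBi.left ξ) this]
    · simp [ch, hg]
  rw [leftAct_apply]
  simp only [this]
  rw [haarInt_const_mul, haarInt_indicator, mul_one]

theorem convolution_ch [IsCompactOpen K] (θ : CcBi K K) :
    convolution θ (ch K K le_rfl) = θ := by
  ext x
  have : ∀ y, θ.1 (x * y) * (ch K K le_rfl).1 ((x * y)⁻¹ * x) =
      θ.1 x * (K : Set G).indicator 1 y := by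
    intro y
    by_cases hg : y ∈ K
    · simp [ch, hg, (CcBi.right θ) hg]
    · simp [ch, hg]
  rw [convolution_apply, ← haarInt_mul_left K x]
  simp only [this]
  rw [haarInt_const_mul, haarInt_indicator, mul_one]

/-- The spherical Hecke algebra of the pair `(G, K)`: the space `C_c^∞(K \ G / K)` with the
convolution product, with unit the characteristic function of `K`. -/
def HeckeAlg (K : Subgroup G) [IsCompactOpen K] : Type _ := CcBi K K

variable (K) in
/-- A bi-invariant function seen as an element of the Hecke algebra. -/
def HeckeAlg.of [IsCompactOpen K] (f : CcBi K K) : HeckeAlg K := f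

/-- The function underlying an element of the Hecke algebra. -/
def HeckeAlg.fn [IsCompactOpen K] (f : HeckeAlg K) : CcBi K K := f

instance [IsCompactOpen K] : AddCommGroup (HeckeAlg K) := inferInstanceAs (AddCommGroup (CcBi K K))

instance [IsCompactOpen K] : Module ℂ (HeckeAlg K) := inferInstanceAs (Module ℂ (CcBi K K))

instance [IsCompactOpen K] : Ring (HeckeAlg K) :=
  { (inferInstance : AddCommGroup (HeckeAlg K)) with
    mul := fun a b => convolution a.fn b.fn
    one := ch K K le_rfl
    mul_assoc := fun a b c => convolution_leftAct _ (eq_map_id K) a.fn b.fn c.fn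
    one_mul := fun a => ch_leftAct _ (eq_map_id K) a.fn
    mul_one := fun a => convolution_ch a.fn
    left_distrib := fun a b c => leftAct_add _ (eq_map_id K) a.fn b.fn c.fn
    right_distrib := fun a b c => add_leftAct _ (eq_map_id K) a.fn b.fn c.fn
    zero_mul := fun a => zero_leftAct _ (eq_map_id K) a.fn
    mul_zero := fun a => leftAct_zero _ (eq_map_id K) a.fn }

instance [IsCompactOpen K] : Algebra ℂ (HeckeAlg K) :=
  Algebra.ofModule (fun c a b => smul_leftAct _ (eq_map_id K) c a.fn b.fn)
    (fun c a b => leftAct_smul _ (eq_map_id K) c a.fn b.fn)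

/-- The Hecke algebra of `(G, K)` acts on `C_c^∞(L \ G / K)` by
`(θ · ξ)(x) = ∫ θ(g) ξ(x g) dg`. -/
instance [IsCompactOpen K] : Module (HeckeAlg K) (CcBi L K) where
  smul θ ξ := rightAct θ.fn ξ
  one_smul ξ := ch_rightAct ξ
  mul_smul θ₁ θ₂ ξ := convolution_rightAct θ₁.fn θ₂.fn ξ
  smul_add θ ξ ξ' := rightAct_add θ.fn ξ ξ'
  add_smul θ θ' ξ := add_rightAct θ.fn θ'.fn ξ
  smul_zero θ := rightAct_zero θ.fn
  zero_smul ξ := zero_rightAct ξ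

instance [IsCompactOpen K] : IsScalarTower ℂ (HeckeAlg K) (CcBi L K) where
  smul_assoc c θ ξ := smul_rightAct c θ.fn ξ

instance [IsCompactOpen K] : SMulCommClass (HeckeAlg K) ℂ (CcBi L K) where
  smul_comm θ c ξ := rightAct_smul c θ.fn ξ

/-- The space `C_c^∞(ι(B) \ G / K)` for a continuous homomorphism `ι : A → G` and `B ≤ A`. -/
def BiCoset (ι : A →ₜ* G) (B : Subgroup A) (K : Subgroup G) : Type _ :=
  CcBi (B.map (ι : A →* G)) K

section BiCoset

variable (ι : A →ₜ* G) (B : Subgroup A)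

instance : AddCommGroup (BiCoset ι B K) :=
  inferInstanceAs (AddCommGroup (CcBi (B.map (ι : A →* G)) K))

instance : Module ℂ (BiCoset ι B K) :=
  inferInstanceAs (Module ℂ (CcBi (B.map (ι : A →* G)) K))

variable [IsCompactOpen B] [IsCompactOpen K]

/-- The right translation action of the Hecke algebra of `(G, K)` on `C_c^∞(ι(B) \ G / K)`. -/
instance BiCoset.rightModule : Module (HeckeAlg K) (BiCoset ι B K) :=
  inferInstanceAs (Module (HeckeAlg K) (CcBi (B.map (ι : A →* G)) K))

/-- The left translation action of the Hecke algebra of `(A, B)` on `C_c^∞(ι(B) \ G / K)`: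
`(θ · ξ)(x) = ∫ θ(h) ξ(ι(h)⁻¹ x) dh`. -/
instance BiCoset.leftModule : Module (HeckeAlg B) (BiCoset ι B K) where
  smul θ ξ := leftAct ι rfl θ.fn ξ
  one_smul ξ := ch_leftAct ι rfl ξ
  mul_smul θ₁ θ₂ ξ := convolution_leftAct ι rfl θ₁.fn θ₂.fn ξ
  smul_add θ ξ ξ' := leftAct_add ι rfl θ.fn ξ ξ'
  add_smul θ θ' ξ := add_leftAct ι rfl θ.fn θ'.fn ξ
  smul_zero θ := leftAct_zero ι rfl θ.fn
  zero_smul ξ := zero_leftAct ι rfl ξ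

instance : IsScalarTower ℂ (HeckeAlg B) (BiCoset ι B K) where
  smul_assoc c θ ξ := smul_leftAct ι rfl c θ.fn ξ

instance : IsScalarTower ℂ (HeckeAlg K) (BiCoset ι B K) where
  smul_assoc c θ ξ := smul_rightAct c θ.fn ξ

instance : SMulCommClass (HeckeAlg B) (HeckeAlg K) (BiCoset ι B K) where
  smul_comm θ₁ θ₂ ξ := leftAct_rightAct ι rfl θ₁.fn θ₂.fn ξ

/-- The action of the tensor product of the Hecke algebras of `(A, B)` and `(G, K)` on
`C_c^∞(ι(B) \ G / K)`; a pure tensor acts by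
`((θ₁ ⊗ θ₂) · ξ)(x) = ∫∫ θ₁(h) θ₂(g) ξ(ι(h)⁻¹ x g) dh dg`, see `BiCoset.tmul_smul_apply`. -/
instance BiCoset.tensorModule : Module (HeckeAlg B ⊗[ℂ] HeckeAlg K) (BiCoset ι B K) :=
  TensorProduct.Algebra.module

/-- An element of `C_c^∞(ι(B) \ G / K)` as a function on `G`. -/
def BiCoset.fn (ξ : BiCoset ι B K) : G → ℂ := ξ.1

theorem BiCoset.tmul_smul_apply (θ₁ : HeckeAlg B) (θ₂ : HeckeAlg K) (ξ : BiCoset ι B K) (x : G) :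
    BiCoset.fn ι B ((θ₁ ⊗ₜ[ℂ] θ₂) • ξ) x =
      haarInt K (fun g => haarInt B (fun h =>
        θ₁.fn.1 h * θ₂.fn.1 g * BiCoset.fn ι B ξ ((ι h)⁻¹ * x * g))) := by
  have h1 : (θ₁ ⊗ₜ[ℂ] θ₂) • ξ = θ₂ • θ₁ • ξ := by
    rw [TensorProduct.Algebra.smul_def, smul_comm]
  rw [h1]
  change haarInt K (fun g => θ₂.fn.1 g * haarInt B (fun h =>
    θ₁.fn.1 h * ξ.1 ((ι h)⁻¹ * (x * g)))) = _
  congr 1; funext g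
  rw [← haarInt_const_mul]
  congr 1; funext h
  simp only [BiCoset.fn, mul_assoc]; ring

/-- The characteristic function of `K` in `C_c^∞(ι(B) \ G / K)`, when `ι(B) ≤ K`. -/
def BiCoset.ch (hB : B.map (ι : A →* G) ≤ K) : BiCoset ι B K :=
  GSp4Hecke.ch (B.map (ι : A →* G)) K hB

end BiCoset

/-- Left translation of `A` on `C_c^∞(G / U)` through `ι : A → G`:
`(h · ξ)(x) = ξ(ι(h)⁻¹ x)`. -/
def leftTranslation (ι : A →ₜ* G) (U : Subgroup G) : Representation ℂ A (CcBi ⊥ U) where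
  toFun h :=
    { toFun := fun ξ => ⟨fun x => ξ.1 ((ι h)⁻¹ * x),
        ξ.2.1.comp_continuous (continuous_const_mul (ι h)⁻¹),
        (CcBi.compact ξ).comp_homeomorph (Homeomorph.mulLeft (ι h)⁻¹),
        by intro l hl x; simp [Subgroup.mem_bot.1 hl],
        by
          intro k hk x
          simpa only [mul_assoc] using CcBi.right ξ hk ((ι h)⁻¹ * x)⟩
      map_add' := fun _ _ => rfl
      map_smul' := fun _ _ => rfl }
  map_one' := by ext ξ x; simp
  map_mul' h h' := by ext ξ x; simp [mul_assoc]

theorem leftTranslation_smul (ι : A →ₜ* G) (U : Subgroup G) [IsCompactOpen U] (h : A)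
    (θ : HeckeAlg U) (ξ : CcBi ⊥ U) :
    leftTranslation ι U h (θ • ξ) = θ • leftTranslation ι U h ξ := by
  ext x
  change haarInt U (fun g => θ.fn.1 g * ξ.1 ((ι h)⁻¹ * x * g)) =
    haarInt U (fun g => θ.fn.1 g * ξ.1 ((ι h)⁻¹ * (x * g)))
  simp only [mul_assoc]

/-- The coinvariants `[V ⊗ C_c^∞(G / U)]_A` for a representation `V` of `A`. -/
abbrev CoinvModule {V : Type*} [AddCommGroup V] [Module ℂ V] (ρ : Representation ℂ A V)
    (ι : A →ₜ* G) (U : Subgroup G) : Type _ :=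
  Representation.Coinvariants (ρ.tprod (leftTranslation ι U))

section Coinv

variable {V : Type*} [AddCommGroup V] [Module ℂ V] (ρ : Representation ℂ A V)
    (ι : A →ₜ* G) (U : Subgroup G)

/-- The class `[φ ⊗ ξ]` in the coinvariants. -/
def CoinvModule.tmul (φ : V) (ξ : CcBi ⊥ U) : CoinvModule ρ ι U :=
  Representation.Coinvariants.mk (ρ.tprod (leftTranslation ι U)) (φ ⊗ₜ[ℂ] ξ)

variable [IsCompactOpen U]

/-- The endomorphism `[φ ⊗ ξ] ↦ [φ ⊗ θ · ξ]` of the coinvariants. -/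
def CoinvModule.act (θ : HeckeAlg U) : CoinvModule ρ ι U →ₗ[ℂ] CoinvModule ρ ι U :=
  Representation.Coinvariants.lift _
    (Representation.Coinvariants.mk (ρ.tprod (leftTranslation ι U)) ∘ₗ
      LinearMap.lTensor V (Algebra.lsmul ℂ ℂ (CcBi ⊥ U) θ)) (by
    intro h
    ext φ ξ
    simp only [TensorProduct.AlgebraTensorModule.curry_apply, LinearMap.restrictScalars_self,
      TensorProduct.curry_apply, LinearMap.comp_apply, Representation.tprod_apply,
      TensorProduct.map_tmul, LinearMap.lTensor_tmul, Algebra.lsmul_coe]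
    rw [← leftTranslation_smul]
    exact Representation.Coinvariants.mk_self_apply (ρ.tprod (leftTranslation ι U)) h
      (φ ⊗ₜ[ℂ] (θ • ξ)))

theorem CoinvModule.act_tmul (θ : HeckeAlg U) (φ : V) (ξ : CcBi ⊥ U) :
    CoinvModule.act ρ ι U θ (CoinvModule.tmul ρ ι U φ ξ) =
      CoinvModule.tmul ρ ι U φ (θ • ξ) := rfl

theorem CoinvModule.hom_ext {f g : CoinvModule ρ ι U →ₗ[ℂ] CoinvModule ρ ι U}
    (h : ∀ φ ξ, f (CoinvModule.tmul ρ ι U φ ξ) = g (CoinvModule.tmul ρ ι U φ ξ)) : f = g :=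
  Representation.Coinvariants.hom_ext (TensorProduct.ext' fun φ ξ => h φ ξ)

/-- The Hecke algebra of `(G, U)` acts on the coinvariants by `θ · [φ ⊗ ξ] = [φ ⊗ θ · ξ]`, where
`(θ · ξ)(x) = ∫ θ(g) ξ(x g) dg`. -/
instance CoinvModule.heckeModule : Module (HeckeAlg U) (CoinvModule ρ ι U) where
  smul θ x := CoinvModule.act ρ ι U θ x
  one_smul x := by
    have : CoinvModule.act ρ ι U 1 = LinearMap.id :=
      CoinvModule.hom_ext ρ ι U fun φ ξ => by
        rw [CoinvModule.act_tmul, one_smul, LinearMap.id_apply]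
    exact LinearMap.congr_fun this x
  mul_smul θ θ' x := by
    have : CoinvModule.act ρ ι U (θ * θ') = CoinvModule.act ρ ι U θ ∘ₗ CoinvModule.act ρ ι U θ' :=
      CoinvModule.hom_ext ρ ι U fun φ ξ => by
        rw [LinearMap.comp_apply, CoinvModule.act_tmul, CoinvModule.act_tmul,
          CoinvModule.act_tmul, mul_smul]
    exact LinearMap.congr_fun this x
  smul_add θ x y := map_add (CoinvModule.act ρ ι U θ) x y
  smul_zero θ := map_zero (CoinvModule.act ρ ι U θ)
  add_smul θ θ' x := by
    have : CoinvModule.act ρ ι U (θ + θ') = CoinvModule.act ρ ι U θ + CoinvModule.act ρ ι U θ' :=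
      CoinvModule.hom_ext ρ ι U fun φ ξ => by
        rw [LinearMap.add_apply, CoinvModule.act_tmul, CoinvModule.act_tmul,
          CoinvModule.act_tmul, add_smul]
        simp only [CoinvModule.tmul, TensorProduct.tmul_add, map_add]
    exact LinearMap.congr_fun this x
  zero_smul x := by
    have : CoinvModule.act ρ ι U 0 = 0 :=
      CoinvModule.hom_ext ρ ι U fun φ ξ => by
        rw [CoinvModule.act_tmul, zero_smul, LinearMap.zero_apply]
        simp only [CoinvModule.tmul, TensorProduct.tmul_zero, map_zero]
    exact LinearMap.congr_fun this x

theorem CoinvModule.smul_tmul (θ : HeckeAlg U) (φ : V) (ξ : CcBi ⊥ U) :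
    θ • CoinvModule.tmul ρ ι U φ ξ = CoinvModule.tmul ρ ι U φ (θ • ξ) := rfl

end Coinv

end General

section Groups

open Matrix

variable (R : Type*) [CommRing R]

/-- The skew-symmetric matrix defining `GSp₄`. -/
def J : Matrix (Fin 4) (Fin 4) R :=
  !![0, 0, 0, 1; 0, 0, 1, 0; 0, -1, 0, 0; -1, 0, 0, 0]

/-- `GSp₄(R)`: the `g ∈ GL₄(R)` with `gᵗ J g = μ(g) J` for some `μ(g) ∈ Rˣ`. -/
def GSp4 : Subgroup (GL (Fin 4) R) where
  carrier := {g | ∃ ν : Rˣ, (g : Matrix (Fin 4) (Fin 4) R)ᵀ * J R *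
    (g : Matrix (Fin 4) (Fin 4) R) = (ν : R) • J R}
  one_mem' := ⟨1, by simp⟩
  mul_mem' := by
    rintro a b ⟨ν, h⟩ ⟨ν', h'⟩
    refine ⟨ν * ν', ?_⟩
    calc _ = (b : Matrix (Fin 4) (Fin 4) R)ᵀ * ((a : Matrix (Fin 4) (Fin 4) R)ᵀ * J R * a) * b := by
          simp [Matrix.transpose_mul, Matrix.mul_assoc]
      _ = _ := by
          rw [h, Matrix.mul_smul, Matrix.smul_mul, h', smul_smul, Units.val_mul]
  inv_mem' := by
    rintro a ⟨ν, h⟩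
    refine ⟨ν⁻¹, ?_⟩
    have h1 : (a : Matrix (Fin 4) (Fin 4) R) * (a⁻¹ : GL (Fin 4) R) = 1 := by
      rw [← Units.val_mul, mul_inv_cancel, Units.val_one]
    have h2 : ((a⁻¹ : GL (Fin 4) R) : Matrix (Fin 4) (Fin 4) R)ᵀ *
        (a : Matrix (Fin 4) (Fin 4) R)ᵀ = 1 := by
      rw [← Matrix.transpose_mul, h1, Matrix.transpose_one]
    have h3 : J R = (ν : R) • (((a⁻¹ : GL (Fin 4) R) : Matrix (Fin 4) (Fin 4) R)ᵀ * J R *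
        (a⁻¹ : GL (Fin 4) R)) := by
      rw [← Matrix.smul_mul, ← Matrix.mul_smul, ← h]
      calc J R = 1 * J R * 1 := by simp
        _ = (((a⁻¹ : GL (Fin 4) R) : Matrix (Fin 4) (Fin 4) R)ᵀ *
            (a : Matrix (Fin 4) (Fin 4) R)ᵀ) * J R *
            ((a : Matrix (Fin 4) (Fin 4) R) * (a⁻¹ : GL (Fin 4) R)) := by rw [h1, h2]
        _ = _ := by simp only [Matrix.mul_assoc]
    conv_rhs => rw [h3, smul_smul, Units.inv_mul, one_smul]

/-- `H(R) = GL₂(R) ×_{GL₁(R)} GL₂(R)`, the fibre product over the determinant. -/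
def H : Subgroup (GL (Fin 2) R × GL (Fin 2) R) where
  carrier := {h | h.1.det = h.2.det}
  one_mem' := by simp
  mul_mem' := by intro a b ha hb; simp_all
  inv_mem' := by intro a ha; simp_all

/-- The `4 × 4` matrix attached to a pair of `2 × 2` matrices. -/
def blockMat : (Matrix (Fin 2) (Fin 2) R × Matrix (Fin 2) (Fin 2) R) →*
    Matrix (Fin 4) (Fin 4) R where
  toFun p := !![p.1 0 0, 0, 0, p.1 0 1;
                0, p.2 0 0, p.2 0 1, 0;
                0, p.2 1 0, p.2 1 1, 0;
                p.1 1 0, 0, 0, p.1 1 1]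
  map_one' := by
    ext i j; fin_cases i <;> fin_cases j <;> simp
  map_mul' p q := by
    ext i j
    fin_cases i <;> fin_cases j <;> simp [Matrix.mul_apply, Fin.sum_univ_succ]

/-- The matrix of `blockMat` as an invertible matrix. -/
def blockGL : (GL (Fin 2) R × GL (Fin 2) R) →* GL (Fin 4) R :=
  (Units.map (blockMat R)).comp (MulEquiv.prodUnits.symm.toMonoidHom)

theorem blockGL_mem (h : H R) : blockGL R h.1 ∈ GSp4 R := by
  obtain ⟨⟨a, b⟩, hab⟩ := h
  have hd : (a : Matrix (Fin 2) (Fin 2) R).det = (b : Matrix (Fin 2) (Fin 2) R).det :=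
    congrArg Units.val hab
  refine ⟨a.det, ?_⟩
  rw [Matrix.GeneralLinearGroup.val_det_apply]
  have hd2 := hd
  rw [Matrix.det_fin_two, Matrix.det_fin_two] at hd2
  rw [Matrix.det_fin_two]
  have hv : (blockGL R (a, b) : Matrix (Fin 4) (Fin 4) R) = blockMat R (a.1, b.1) := rfl
  simp only [hv]
  ext i j
  fin_cases i <;> fin_cases j <;>
    simp [blockMat, J, Matrix.mul_apply, Fin.sum_univ_succ] <;>
    first | ring1 | linear_combination hd2 | linear_combination -hd2

/-- The embedding of `H` into `GSp₄`. -/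
def embGSp4 : H R →* GSp4 R :=
  ((blockGL R).comp (H R).subtype).codRestrict (GSp4 R) (blockGL_mem R)

end Groups

section Padic

open Matrix

theorem blockMat_continuous {R : Type*} [CommRing R] [TopologicalSpace R] :
    Continuous (blockMat R) := by
  refine continuous_matrix fun i j => ?_
  fin_cases i <;> fin_cases j <;> simp [blockMat] <;> fun_prop

variable (ℓ : ℕ) [Fact ℓ.Prime]

/-- `GL_n(ℤ_ℓ)` as a subgroup of `GL_n(ℚ_ℓ)`. -/
def GLInt (n : ℕ) : Subgroup (GL (Fin n) ℚ_[ℓ]) :=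
  (GeneralLinearGroup.map (n := Fin n) (algebraMap ℤ_[ℓ] ℚ_[ℓ])).range

/-- `GSp₄(ℤ_ℓ) = GSp₄(ℚ_ℓ) ∩ GL₄(ℤ_ℓ)` as a subgroup of `GSp₄(ℚ_ℓ)`. -/
def GSp4Int : Subgroup (GSp4 ℚ_[ℓ]) := (GLInt ℓ 4).subgroupOf (GSp4 ℚ_[ℓ])

/-- `H(ℤ_ℓ) = H(ℚ_ℓ) ∩ (GL₂(ℤ_ℓ) × GL₂(ℤ_ℓ))` as a subgroup of `H(ℚ_ℓ)`. -/
def HInt : Subgroup (H ℚ_[ℓ]) := ((GLInt ℓ 2).prod (GLInt ℓ 2)).subgroupOf (H ℚ_[ℓ])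

/-- `G(ℤ_ℓ)` as a subgroup of `G(ℚ_ℓ) = GSp₄(ℚ_ℓ) × GL₂(ℚ_ℓ)`. -/
def GInt : Subgroup (GSp4 ℚ_[ℓ] × GL (Fin 2) ℚ_[ℓ]) := (GSp4Int ℓ).prod (GLInt ℓ 2)

theorem mem_GLInt {n : ℕ} (g : GL (Fin n) ℚ_[ℓ]) : g ∈ GLInt ℓ n ↔
    (∀ i j, ‖g.1 i j‖ ≤ 1) ∧ ∀ i j, ‖(g⁻¹ : GL (Fin n) ℚ_[ℓ]).1 i j‖ ≤ 1 := by
  constructor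
  · rintro ⟨g, rfl⟩
    exact ⟨fun i j => (g.1 i j).2, fun i j => by
      rw [← map_inv]; exact ((g⁻¹ : GL (Fin n) ℤ_[ℓ]).1 i j).2⟩
  · rintro ⟨h1, h2⟩
    let a : Matrix (Fin n) (Fin n) ℤ_[ℓ] := fun i j => ⟨_, h1 i j⟩
    let b : Matrix (Fin n) (Fin n) ℤ_[ℓ] := fun i j => ⟨_, h2 i j⟩
    have hinj : Function.Injective
        (fun m : Matrix (Fin n) (Fin n) ℤ_[ℓ] => m.map (algebraMap ℤ_[ℓ] ℚ_[ℓ])) :=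
      Matrix.map_injective Subtype.val_injective
    have ha : a.map (algebraMap ℤ_[ℓ] ℚ_[ℓ]) = g.1 := by ext i j; rfl
    have hb : b.map (algebraMap ℤ_[ℓ] ℚ_[ℓ]) = (g⁻¹ : GL (Fin n) ℚ_[ℓ]).1 := by ext i j; rfl
    refine ⟨⟨a, b, hinj ?_, hinj ?_⟩, ?_⟩
    · simp only [Matrix.map_mul, ha, hb, ← Units.val_mul, mul_inv_cancel]
      exact (Matrix.map_one _ (map_zero _) (map_one _)).symm
    · simp only [Matrix.map_mul, ha, hb, ← Units.val_mul, inv_mul_cancel]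
      exact (Matrix.map_one _ (map_zero _) (map_one _)).symm
    · ext i j; rfl

instance (n : ℕ) : IsCompactOpen (GLInt ℓ n) where
  isCompact := by
    have hc : Continuous (GeneralLinearGroup.map (n := Fin n) (algebraMap ℤ_[ℓ] ℚ_[ℓ])) := by
      refine Continuous.units_map _ ?_
      exact continuous_id.matrix_map continuous_subtype_val
    have : CompactSpace (Matrix (Fin n) (Fin n) ℤ_[ℓ]) :=
      inferInstanceAs (CompactSpace (Fin n → Fin n → ℤ_[ℓ]))
    have : CompactSpace (GL (Fin n) ℤ_[ℓ]) :=
      inferInstanceAs (CompactSpace (Matrix (Fin n) (Fin n) ℤ_[ℓ])ˣ)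
    have := isCompact_range hc
    simpa [GLInt] using this
  isOpen := by
    have : ((GLInt ℓ n : Subgroup _) : Set (GL (Fin n) ℚ_[ℓ])) =
        (⋂ i, ⋂ j, (fun g : GL (Fin n) ℚ_[ℓ] => g.1 i j) ⁻¹' Metric.closedBall 0 1) ∩
        (⋂ i, ⋂ j, (fun g : GL (Fin n) ℚ_[ℓ] => (g⁻¹ : GL (Fin n) ℚ_[ℓ]).1 i j) ⁻¹'
          Metric.closedBall 0 1) := by
      ext g
      simp [mem_GLInt]
    rw [this]
    have ho : IsOpen (Metric.closedBall (0 : ℚ_[ℓ]) 1) :=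
      IsUltrametricDist.isOpen_closedBall _ one_ne_zero
    refine IsOpen.inter ?_ ?_
    · exact isOpen_iInter_of_finite fun i => isOpen_iInter_of_finite fun j =>
        ho.preimage (Units.continuous_val.matrix_elem i j)
    · exact isOpen_iInter_of_finite fun i => isOpen_iInter_of_finite fun j =>
        ho.preimage ((Units.continuous_val.comp continuous_inv).matrix_elem i j)

theorem isClosed_GSp4 : IsClosed ((GSp4 ℚ_[ℓ] : Subgroup _) : Set (GL (Fin 4) ℚ_[ℓ])) := by
  have : ((GSp4 ℚ_[ℓ] : Subgroup _) : Set (GL (Fin 4) ℚ_[ℓ])) =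
      {g | g.1ᵀ * J ℚ_[ℓ] * g.1 = (g.1ᵀ * J ℚ_[ℓ] * g.1) 0 3 • J ℚ_[ℓ]} := by
    ext g
    constructor
    · rintro ⟨ν, h⟩
      have h' : g.1ᵀ * J ℚ_[ℓ] * g.1 = (ν : ℚ_[ℓ]) • J ℚ_[ℓ] := h
      change g.1ᵀ * J ℚ_[ℓ] * g.1 = (g.1ᵀ * J ℚ_[ℓ] * g.1) 0 3 • J ℚ_[ℓ]
      rw [h']
      congr 1
      simp [J]
    · intro h
      have h' : g.1ᵀ * J ℚ_[ℓ] * g.1 = (g.1ᵀ * J ℚ_[ℓ] * g.1) 0 3 • J ℚ_[ℓ] := h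
      have hne : (g.1ᵀ * J ℚ_[ℓ] * g.1) 0 3 ≠ 0 := by
        intro h0
        rw [h0, zero_smul] at h'
        have h1 : (g : Matrix (Fin 4) (Fin 4) ℚ_[ℓ]) * (g⁻¹ : GL (Fin 4) ℚ_[ℓ]) = 1 := by
          rw [← Units.val_mul, mul_inv_cancel, Units.val_one]
        have h2 : ((g⁻¹ : GL (Fin 4) ℚ_[ℓ]) : Matrix (Fin 4) (Fin 4) ℚ_[ℓ])ᵀ *
            (g : Matrix (Fin 4) (Fin 4) ℚ_[ℓ])ᵀ = 1 := by
          rw [← Matrix.transpose_mul, h1, Matrix.transpose_one]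
        have h3 : J ℚ_[ℓ] = 0 := by
          calc J ℚ_[ℓ] = 1 * J ℚ_[ℓ] * 1 := by simp
            _ = (((g⁻¹ : GL (Fin 4) ℚ_[ℓ]) : Matrix (Fin 4) (Fin 4) ℚ_[ℓ])ᵀ * g.1ᵀ) * J ℚ_[ℓ] *
                (g.1 * (g⁻¹ : GL (Fin 4) ℚ_[ℓ])) := by rw [h1, h2]
            _ = ((g⁻¹ : GL (Fin 4) ℚ_[ℓ]) : Matrix (Fin 4) (Fin 4) ℚ_[ℓ])ᵀ *
                (g.1ᵀ * J ℚ_[ℓ] * g.1) * (g⁻¹ : GL (Fin 4) ℚ_[ℓ]) := by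
              simp only [Matrix.mul_assoc]
            _ = 0 := by rw [h']; simp
        have := congrFun (congrFun h3 0) 3
        simp [J] at this
      exact ⟨Units.mk0 _ hne, h'⟩
  rw [this]
  have hc : Continuous (fun g : GL (Fin 4) ℚ_[ℓ] => g.1ᵀ * J ℚ_[ℓ] * g.1) :=
    (Units.continuous_val.matrix_transpose.matrix_mul continuous_const).matrix_mul
      Units.continuous_val
  exact isClosed_eq hc ((hc.matrix_elem 0 3).smul continuous_const)

theorem isClosed_H :
    IsClosed ((H ℚ_[ℓ] : Subgroup _) : Set (GL (Fin 2) ℚ_[ℓ] × GL (Fin 2) ℚ_[ℓ])) := by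
  have : ((H ℚ_[ℓ] : Subgroup _) : Set (GL (Fin 2) ℚ_[ℓ] × GL (Fin 2) ℚ_[ℓ])) =
      {h | h.1.1.det = h.2.1.det} := by
    ext h
    exact Units.ext_iff
  rw [this]
  exact isClosed_eq (Units.continuous_val.comp continuous_fst).matrix_det
    (Units.continuous_val.comp continuous_snd).matrix_det

theorem isCompactOpen_subgroupOf {G : Type*} [Group G] [TopologicalSpace G]
    [IsTopologicalGroup G] (K M : Subgroup G) [hK : IsCompactOpen K]
    (hM : IsClosed (M : Set G)) : IsCompactOpen (K.subgroupOf M) where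
  isCompact := hM.isClosedEmbedding_subtypeVal.isCompact_preimage hK.isCompact
  isOpen := hK.isOpen.preimage continuous_subtype_val

instance isCompactOpen_prod {G G' : Type*} [Group G] [TopologicalSpace G] [IsTopologicalGroup G]
    [Group G'] [TopologicalSpace G'] [IsTopologicalGroup G'] (K : Subgroup G) (K' : Subgroup G')
    [hK : IsCompactOpen K] [hK' : IsCompactOpen K'] : IsCompactOpen (K.prod K') where
  isCompact := hK.isCompact.prod hK'.isCompact
  isOpen := hK.isOpen.prod hK'.isOpen

instance : IsCompactOpen (GSp4Int ℓ) := isCompactOpen_subgroupOf _ _ (isClosed_GSp4 ℓ)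

instance : IsCompactOpen (HInt ℓ) := isCompactOpen_subgroupOf _ _ (isClosed_H ℓ)

instance : IsCompactOpen (GInt ℓ) := isCompactOpen_prod _ _

/-- The embedding `H(ℚ_ℓ) → GSp₄(ℚ_ℓ)`. -/
def iotaGSp4 : H ℚ_[ℓ] →ₜ* GSp4 ℚ_[ℓ] where
  toMonoidHom := embGSp4 ℚ_[ℓ]
  continuous_toFun := by
    refine Continuous.subtype_mk ?_ _
    refine Units.continuous_iff.2 ⟨?_, ?_⟩
    · have : Continuous (fun h : H ℚ_[ℓ] => blockMat ℚ_[ℓ] (h.1.1.1, h.1.2.1)) :=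
        blockMat_continuous.comp ((Units.continuous_val.comp (continuous_fst.comp
          continuous_subtype_val)).prodMk (Units.continuous_val.comp (continuous_snd.comp
          continuous_subtype_val)))
      exact this
    · have : Continuous (fun h : H ℚ_[ℓ] => blockMat ℚ_[ℓ]
          ((h.1.1⁻¹ : GL (Fin 2) ℚ_[ℓ]).1, (h.1.2⁻¹ : GL (Fin 2) ℚ_[ℓ]).1)) :=
        blockMat_continuous.comp ((Units.continuous_val.comp (continuous_fst.comp
          continuous_subtype_val).inv).prodMk (Units.continuous_val.comp (continuous_snd.comp
          continuous_subtype_val).inv))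
      exact this

/-- The embedding `ι : H(ℚ_ℓ) → G(ℚ_ℓ)`, `(h₁, h₂) ↦ (iotaGSp4 (h₁, h₂), h₂)`. -/
def iota : H ℚ_[ℓ] →ₜ* GSp4 ℚ_[ℓ] × GL (Fin 2) ℚ_[ℓ] where
  toMonoidHom := (embGSp4 ℚ_[ℓ]).prod ((MonoidHom.snd _ _).comp (H ℚ_[ℓ]).subtype)
  continuous_toFun := (iotaGSp4 ℓ).continuous_toFun.prodMk
    (continuous_snd.comp continuous_subtype_val)

theorem map_HInt_le : (HInt ℓ).map (iotaGSp4 ℓ : H ℚ_[ℓ] →* GSp4 ℚ_[ℓ]) ≤ GSp4Int ℓ := by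
  rintro _ ⟨h, hh, rfl⟩
  obtain ⟨⟨a, ha⟩, ⟨b, hb⟩⟩ := hh
  refine ⟨blockGL ℤ_[ℓ] (a, b), ?_⟩
  have ha' : h.1.1 = GeneralLinearGroup.map (algebraMap ℤ_[ℓ] ℚ_[ℓ]) a := ha.symm
  have hb' : h.1.2 = GeneralLinearGroup.map (algebraMap ℤ_[ℓ] ℚ_[ℓ]) b := hb.symm
  have : (((iotaGSp4 ℓ : H ℚ_[ℓ] →* GSp4 ℚ_[ℓ]) h : GSp4 ℚ_[ℓ]) : GL (Fin 4) ℚ_[ℓ]) =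
    blockGL ℚ_[ℓ] (h.1.1, h.1.2) := rfl
  ext i j
  change _ = (((iotaGSp4 ℓ : H ℚ_[ℓ] →* GSp4 ℚ_[ℓ]) h : GSp4 ℚ_[ℓ]) : GL (Fin 4) ℚ_[ℓ]).1 i j
  rw [this, ha', hb']
  fin_cases i <;> fin_cases j <;> rfl

/-- The space `𝒮(ℚ_ℓ²)` of Schwartz functions: locally constant, compactly supported functions
`ℚ_ℓ² → ℂ`. -/
def Schwartz : Submodule ℂ ((Fin 2 → ℚ_[ℓ]) → ℂ) where
  carrier := {φ | IsLocallyConstant φ ∧ HasCompactSupport φ}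
  add_mem' := fun hf hg => ⟨hf.1.add hg.1, hf.2.add hg.2⟩
  zero_mem' := ⟨IsLocallyConstant.const 0, HasCompactSupport.zero⟩
  smul_mem' := fun c _ hf => ⟨hf.1.comp (fun z => c • z),
    hf.2.comp_left (g := fun z : ℂ => c • z) (by simp)⟩

/-- Right multiplication of row vectors by `g ∈ GL₂(ℚ_ℓ)`. -/
def rowMul (g : GL (Fin 2) ℚ_[ℓ]) : (Fin 2 → ℚ_[ℓ]) ≃ₜ (Fin 2 → ℚ_[ℓ]) where
  toFun v := v ᵥ* g.1
  invFun v := v ᵥ* (g⁻¹ : GL (Fin 2) ℚ_[ℓ]).1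
  left_inv v := by simp [Matrix.vecMul_vecMul]
  right_inv v := by simp [Matrix.vecMul_vecMul]
  continuous_toFun := continuous_id.matrix_vecMul continuous_const
  continuous_invFun := continuous_id.matrix_vecMul continuous_const

/-- The action of `H(ℚ_ℓ)` on `𝒮(ℚ_ℓ²)` through the first projection:
`((h₁, h₂) · φ)(v) = φ(v h₁)`. -/
def schwartzRep : Representation ℂ (H ℚ_[ℓ]) (Schwartz ℓ) where
  toFun h :=
    { toFun := fun φ => ⟨fun v => φ.1 (v ᵥ* h.1.1.1),
        φ.2.1.comp_continuous (rowMul ℓ h.1.1).continuous,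
        φ.2.2.comp_homeomorph (rowMul ℓ h.1.1)⟩
      map_add' := fun _ _ => rfl
      map_smul' := fun _ _ => rfl }
  map_one' := by ext φ v; simp
  map_mul' h h' := by ext φ v; simp [Matrix.vecMul_vecMul]

/-- The characteristic function of `ℤ_ℓ²`. -/
def chLattice : Schwartz ℓ :=
  ⟨(Set.univ.pi fun _ : Fin 2 => Metric.closedBall (0 : ℚ_[ℓ]) 1).indicator 1, by
    have ho : IsClopen (Metric.closedBall (0 : ℚ_[ℓ]) 1) :=
      IsUltrametricDist.isClopen_closedBall _ one_ne_zero
    have hc : IsClopen (Set.univ.pi fun _ : Fin 2 => Metric.closedBall (0 : ℚ_[ℓ]) 1) :=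
      ⟨isClosed_set_pi fun _ _ => ho.1, isOpen_set_pi Set.finite_univ fun _ _ => ho.2⟩
    classical
    refine (IsLocallyConstant.iff_exists_open _).2 fun x => ?_
    by_cases hx : x ∈ Set.univ.pi fun _ : Fin 2 => Metric.closedBall (0 : ℚ_[ℓ]) 1
    · exact ⟨_, hc.2, hx, fun y hy => by
        rw [Set.indicator_of_mem hy, Set.indicator_of_mem hx]; rfl⟩
    · exact ⟨_, hc.compl.2, hx, fun y hy => by
        rw [Set.indicator_of_notMem hy, Set.indicator_of_notMem hx]⟩, by
    refine HasCompactSupport.of_support_subset_isCompact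
      (isCompact_univ_pi fun _ : Fin 2 => isCompact_closedBall (0 : ℚ_[ℓ]) 1) ?_
    simp⟩

/-- The module `C_c^∞(H(ℤ_ℓ) \ GSp₄(ℚ_ℓ) / GSp₄(ℤ_ℓ))`, with its action of the tensor product of
the spherical Hecke algebras of `H(ℚ_ℓ)` and `GSp₄(ℚ_ℓ)`. -/
abbrev ShintaniModule : Type := BiCoset (iotaGSp4 ℓ) (HInt ℓ) (GSp4Int ℓ)

/-- The characteristic function of `GSp₄(ℤ_ℓ)` in `ShintaniModule`. -/
def chGSp4 : ShintaniModule ℓ := BiCoset.ch _ _ (map_HInt_le ℓ)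

/-- The module `𝓘(G(ℚ_ℓ) / G(ℤ_ℓ))` of `H(ℚ_ℓ)`-coinvariants of
`𝒮(ℚ_ℓ²) ⊗ C_c^∞(G(ℚ_ℓ) / G(ℤ_ℓ))`, with its action of the spherical Hecke algebra of
`G(ℚ_ℓ)`. -/
abbrev IModule : Type := CoinvModule (schwartzRep ℓ) (iota ℓ) (GInt ℓ)

/-- The class of `ch(ℤ_ℓ²) ⊗ ch(G(ℤ_ℓ))`. -/
def chI : IModule ℓ := CoinvModule.tmul _ _ _ (chLattice ℓ) (ch ⊥ (GInt ℓ) bot_le)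

end Padic

end GSp4Hecke
end

/-! Both halves are proved by duality: a subspace is everything once each linear functional killing
it is zero. A functional `μ` killing the Hecke orbit of the proposed generator is encoded as a
function Φ(a, b, g) on GL₂/GL₂(ℤ_ℓ) × GL₂/GL₂(ℤ_ℓ) × GSp₄/GSp₄(ℤ_ℓ) that is invariant under the
simultaneous left action of H(ℚ_ℓ) and satisfies ∫ Φ(a, b, kg) dk = 0 over k ∈ GSp₄(ℤ_ℓ). Such
functions are called `Admissible`, and `Admissible.eq_zero` says that they vanish; both halves rest
on it.

Why admissible functions vanish. The cosets H(ℚ_ℓ) \ GSp₄(ℚ_ℓ) / GSp₄(ℤ_ℓ) are represented by `eta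
m` (`exists_eta`). Up to GSp₄(ℤ_ℓ), the pairs (h, whw) with h ∈ GL₂(ℤ_ℓ) and the lower unipotents of
depth ℓ^m fix `eta m`. With the Cartan decomposition this brings every triple to `rep x y a b m (ℓ ^
i)` with i ≤ min(a, b, m) (`exists_rel_rep`). Two mechanisms then propagate vanishing, both through
`eq_zero_of_mean_eq_zero`: if an average is zero and every value in it is 0 or c, with c attained,
then c = 0.

Hecke operators of GL₂ in the first two variables preserve admissibility. Vanishing of all
admissible functions at one standard triple therefore kills an average over its neighbours in the
tree of GL₂, which gives vanishing at the next triple once the other neighbours are known. For fixed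
m this reduces all triples to those with a = b = i (`vanish_of_diag`). A triple with a = b = i is
moved to (1, 1, `baseElt m i`), and the GSp₄(ℤ_ℓ)-average of Φ through it is zero by hypothesis.
Sizes of entries and of 2 × 2 minors, together with similitudes, show that every other triple on
this orbit reduces to diagonal ones that are strictly smaller for the lexicographic order on (m + i,
m) (`constraints_of_rel`, `vanish_diag`).

For (1), Φ(a, b, g) is `μ` of the H(ℤ_ℓ)-averaged characteristic function of η⁻¹g GSp₄(ℤ_ℓ) when (a,
b) lies in the coset of some η ∈ H(ℚ_ℓ), and 0 otherwise. Averaging over k factors the vector as a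
left Hecke operator applied to a right one (`vmean_orbitMean`).

For (2), Φ(a, b, g) = `μ`[a · ch(ℤ_ℓ²) ⊗ ch((g, b)G(ℤ_ℓ))]. The averages vanish because they can be
enlarged to averages over GL₂(ℤ_ℓ) and G(ℤ_ℓ). A GL₂(ℤ_ℓ)-invariant Schwartz function is a
combination of the ch(ℓ^n ℤ_ℓ²), and central elements of H move the scaling onto the other tensor
factor. Finally, Φ = 0 only controls lattices in 𝒮(ℚ_ℓ²); `eq_zero_of_lattices` extends this to all
of it, using invariance under unit scalars. -/

noncomputable section

namespace GSp4Hecke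

section

open Matrix

variable {ℓ : ℕ} [Fact ℓ.Prime]

/-! ### Integrality criteria in GL₂ and GSp₄, and the similitude factor. -/

section Basic

/-- The invertible matrix with rows `(p, q)` and `(r, t)`. -/
def gl2 (p q r t : ℚ_[ℓ]) (h : p * t - q * r ≠ 0) : GL (Fin 2) ℚ_[ℓ] :=
  GeneralLinearGroup.mkOfDetNeZero !![p, q; r, t] (by rwa [det_fin_two_of])

@[simp] theorem gl2_val (p q r t : ℚ_[ℓ]) (h : p * t - q * r ≠ 0) :
    (gl2 p q r t h).1 = !![p, q; r, t] := rfl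

theorem gl2_ext {a b : GL (Fin 2) ℚ_[ℓ]} (h00 : a.1 0 0 = b.1 0 0) (h01 : a.1 0 1 = b.1 0 1)
    (h10 : a.1 1 0 = b.1 1 0) (h11 : a.1 1 1 = b.1 1 1) : a = b := by
  ext i j
  fin_cases i <;> fin_cases j <;> assumption

theorem padic_norm_eq_one_inv {x : ℚ_[ℓ]} (h : ‖x‖ = 1) : ‖x⁻¹‖ = 1 := by
  rw [norm_inv, h, inv_one]

theorem gl2_inv_val (g : GL (Fin 2) ℚ_[ℓ]) : (g⁻¹ : GL (Fin 2) ℚ_[ℓ]).1 =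
    g.1.det⁻¹ • !![g.1 1 1, -g.1 0 1; -g.1 1 0, g.1 0 0] := by
  rw [Matrix.coe_units_inv, Matrix.inv_def, Matrix.adjugate_fin_two, Ring.inverse_eq_inv']

theorem norm_det_of_mem_GLInt {g : GL (Fin 2) ℚ_[ℓ]} (hg : g ∈ GLInt ℓ 2) : ‖g.1.det‖ = 1 := by
  obtain ⟨u, rfl⟩ := hg
  have h1 : (GeneralLinearGroup.map (algebraMap ℤ_[ℓ] ℚ_[ℓ]) u).1.det =
      ((u.1.det : ℤ_[ℓ]) : ℚ_[ℓ]) := ((algebraMap ℤ_[ℓ] ℚ_[ℓ]).map_det u.1).symm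
  rw [h1, ← PadicInt.norm_def]
  exact PadicInt.isUnit_iff.1 ((Matrix.isUnit_iff_isUnit_det _).1 u.isUnit)

theorem mem_GLInt_two {g : GL (Fin 2) ℚ_[ℓ]} :
    g ∈ GLInt ℓ 2 ↔ (∀ i j, ‖g.1 i j‖ ≤ 1) ∧ ‖g.1.det‖ = 1 := by
  refine ⟨fun h => ⟨((mem_GLInt ℓ g).1 h).1, norm_det_of_mem_GLInt h⟩, fun ⟨h, hd⟩ => ?_⟩
  refine (mem_GLInt ℓ g).2 ⟨h, fun i j => ?_⟩
  rw [gl2_inv_val, Matrix.smul_apply, smul_eq_mul, norm_mul, padic_norm_eq_one_inv hd, one_mul]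
  fin_cases i <;> fin_cases j <;> simp [h]

theorem gl2_mem_GLInt {p q r t : ℚ_[ℓ]} {h : p * t - q * r ≠ 0} (hp : ‖p‖ ≤ 1) (hq : ‖q‖ ≤ 1)
    (hr : ‖r‖ ≤ 1) (ht : ‖t‖ ≤ 1) (hd : ‖p * t - q * r‖ = 1) : gl2 p q r t h ∈ GLInt ℓ 2 := by
  refine mem_GLInt_two.2 ⟨fun i j => ?_, by rwa [gl2_val, det_fin_two_of]⟩
  fin_cases i <;> fin_cases j <;> simpa

theorem norm_sub_le_one {x y : ℚ_[ℓ]} (hx : ‖x‖ ≤ 1) (hy : ‖y‖ ≤ 1) : ‖x - y‖ ≤ 1 := by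
  rw [sub_eq_add_neg]
  exact (Padic.nonarchimedean _ _).trans (max_le hx (by rwa [norm_neg]))

theorem norm_add_le_one {x y : ℚ_[ℓ]} (hx : ‖x‖ ≤ 1) (hy : ‖y‖ ≤ 1) : ‖x + y‖ ≤ 1 :=
  (Padic.nonarchimedean _ _).trans (max_le hx hy)

theorem norm_mul_le_one {x y : ℚ_[ℓ]} (hx : ‖x‖ ≤ 1) (hy : ‖y‖ ≤ 1) : ‖x * y‖ ≤ 1 := by
  rw [norm_mul]; exact mul_le_one₀ hx (norm_nonneg _) hy

theorem J_mul_J : J ℚ_[ℓ] * J ℚ_[ℓ] = -1 := by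
  ext i j
  fin_cases i <;> fin_cases j <;> simp [J, Matrix.mul_apply, Fin.sum_univ_four]

theorem norm_mul_apply_le {A B : Matrix (Fin 4) (Fin 4) ℚ_[ℓ]} {C D : ℝ} (hC : 0 ≤ C)
    (hD : 0 ≤ D) (hA : ∀ i j, ‖A i j‖ ≤ C) (hB : ∀ i j, ‖B i j‖ ≤ D) (i j : Fin 4) :
    ‖(A * B) i j‖ ≤ C * D := by
  rw [Matrix.mul_apply]
  refine IsUltrametricDist.norm_sum_le_of_forall_le_of_nonneg (by positivity) fun k _ => ?_
  rw [norm_mul]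
  exact mul_le_mul (hA _ _) (hB _ _) (norm_nonneg _) hC

/-- The similitude factor `μ(g)`. -/
def simil (g : GSp4 ℚ_[ℓ]) : ℚ_[ℓ] := (g.1.1ᵀ * J ℚ_[ℓ] * g.1.1) 0 3

theorem simil_eq_of {g : GSp4 ℚ_[ℓ]} {ν : ℚ_[ℓ]} (h : g.1.1ᵀ * J ℚ_[ℓ] * g.1.1 = ν • J ℚ_[ℓ]) :
    simil g = ν := by
  rw [simil, h]; simp [J]

theorem simil_spec (g : GSp4 ℚ_[ℓ]) : g.1.1ᵀ * J ℚ_[ℓ] * g.1.1 = simil g • J ℚ_[ℓ] := by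
  obtain ⟨g, ν, h⟩ := g
  rw [simil_eq_of (g := ⟨g, ν, h⟩) h]
  exact h

theorem simil_ne_zero (g : GSp4 ℚ_[ℓ]) : simil g ≠ 0 := by
  obtain ⟨g, ν, h⟩ := g
  rw [simil_eq_of (g := ⟨g, ν, h⟩) h]
  exact ν.ne_zero

theorem simil_mul (g g' : GSp4 ℚ_[ℓ]) : simil (g * g') = simil g * simil g' := by
  apply simil_eq_of
  calc (g * g').1.1ᵀ * J ℚ_[ℓ] * (g * g').1.1
      = g'.1.1ᵀ * (g.1.1ᵀ * J ℚ_[ℓ] * g.1.1) * g'.1.1 := by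
        simp [Matrix.transpose_mul, Matrix.mul_assoc]
    _ = _ := by
        rw [simil_spec, Matrix.mul_smul, Matrix.smul_mul, simil_spec, smul_smul]

theorem simil_one : simil (1 : GSp4 ℚ_[ℓ]) = 1 := simil_eq_of (by simp)

theorem gsp_inv_val (g : GSp4 ℚ_[ℓ]) : (g⁻¹ : GSp4 ℚ_[ℓ]).1.1 =
    -(simil g)⁻¹ • (J ℚ_[ℓ] * g.1.1ᵀ * J ℚ_[ℓ]) := by
  have h : (-(simil g)⁻¹ • (J ℚ_[ℓ] * g.1.1ᵀ * J ℚ_[ℓ])) * g.1.1 = 1 := by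
    rw [Matrix.smul_mul, Matrix.mul_assoc, Matrix.mul_assoc, ← Matrix.mul_assoc g.1.1ᵀ, simil_spec,
      Matrix.mul_smul, J_mul_J, smul_smul, smul_neg]
    simp [simil_ne_zero g]
  have h2 : g.1.1 * (g⁻¹ : GSp4 ℚ_[ℓ]).1.1 = 1 := by
    rw [← Units.val_mul, ← Subgroup.coe_mul]; simp
  exact (left_inv_eq_right_inv h h2).symm

theorem norm_J_le (i j : Fin 4) : ‖J ℚ_[ℓ] i j‖ ≤ 1 := by
  fin_cases i <;> fin_cases j <;> simp [J]

/-- The inverse is -μ(g)⁻¹ J gᵗ J, so it is integral as soon as g is and μ(g) is a unit. -/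
theorem mem_GSp4Int_of {g : GSp4 ℚ_[ℓ]} (h : ∀ i j, ‖g.1.1 i j‖ ≤ 1) (hs : ‖simil g‖ = 1) :
    g ∈ GSp4Int ℓ := by
  refine (mem_GLInt ℓ g.1).2 ⟨h, fun i j => ?_⟩
  change ‖(g⁻¹ : GSp4 ℚ_[ℓ]).1.1 i j‖ ≤ 1
  rw [gsp_inv_val, Matrix.smul_apply, smul_eq_mul, norm_mul, norm_neg, padic_norm_eq_one_inv hs,
    one_mul]
  have h1 : ∀ i j, ‖(J ℚ_[ℓ] * g.1.1ᵀ) i j‖ ≤ 1 * 1 :=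
    norm_mul_apply_le zero_le_one zero_le_one norm_J_le (fun i j => h j i)
  simpa using norm_mul_apply_le (by norm_num) zero_le_one h1 norm_J_le i j

theorem norm_apply_le_of_mem_GSp4Int {g : GSp4 ℚ_[ℓ]} (h : g ∈ GSp4Int ℓ) (i j : Fin 4) :
    ‖g.1.1 i j‖ ≤ 1 := ((mem_GLInt ℓ g.1).1 h).1 i j

/-- The element of `GSp₄(ℚ_ℓ)` with a given matrix. -/
def mkGSp (M : Matrix (Fin 4) (Fin 4) ℚ_[ℓ]) (ν : ℚ_[ℓ]) (hν : ν ≠ 0)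
    (h : Mᵀ * J ℚ_[ℓ] * M = ν • J ℚ_[ℓ]) : GSp4 ℚ_[ℓ] :=
  have hl : (-ν⁻¹ • (J ℚ_[ℓ] * Mᵀ * J ℚ_[ℓ])) * M = 1 := by
    rw [Matrix.smul_mul, Matrix.mul_assoc, Matrix.mul_assoc, ← Matrix.mul_assoc Mᵀ, h,
      Matrix.mul_smul, J_mul_J, smul_smul, smul_neg]
    simp [hν]
  ⟨⟨M, -ν⁻¹ • (J ℚ_[ℓ] * Mᵀ * J ℚ_[ℓ]), mul_eq_one_comm.1 hl, hl⟩, Units.mk0 ν hν, h⟩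

@[simp] theorem mkGSp_val (M : Matrix (Fin 4) (Fin 4) ℚ_[ℓ]) (ν : ℚ_[ℓ]) (hν : ν ≠ 0)
    (h : Mᵀ * J ℚ_[ℓ] * M = ν • J ℚ_[ℓ]) : (mkGSp M ν hν h).1.1 = M := rfl

theorem simil_mkGSp (M : Matrix (Fin 4) (Fin 4) ℚ_[ℓ]) (ν : ℚ_[ℓ]) (hν : ν ≠ 0)
    (h : Mᵀ * J ℚ_[ℓ] * M = ν • J ℚ_[ℓ]) : simil (mkGSp M ν hν h) = ν := simil_eq_of h

theorem mkGSp_mem_GSp4Int {M : Matrix (Fin 4) (Fin 4) ℚ_[ℓ]} {ν : ℚ_[ℓ]} {hν : ν ≠ 0}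
    {h : Mᵀ * J ℚ_[ℓ] * M = ν • J ℚ_[ℓ]} (hM : ∀ i j, ‖M i j‖ ≤ 1) (h1 : ‖ν‖ = 1) :
    mkGSp M ν hν h ∈ GSp4Int ℓ :=
  mem_GSp4Int_of hM (by rwa [simil_mkGSp])

theorem gsp_ext {g g' : GSp4 ℚ_[ℓ]} (h : g.1.1 = g'.1.1) : g = g' := Subtype.ext (Units.ext h)

theorem gsp_mul_val (g g' : GSp4 ℚ_[ℓ]) : (g * g').1.1 = g.1.1 * g'.1.1 := rfl

theorem iotaGSp4_val (h : H ℚ_[ℓ]) :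
    (iotaGSp4 ℓ h).1.1 = blockMat ℚ_[ℓ] (h.1.1.1, h.1.2.1) := rfl

theorem H_det_eq (h : H ℚ_[ℓ]) : h.1.1.1.det = h.1.2.1.det := congrArg Units.val h.2

theorem simil_iotaGSp4 (h : H ℚ_[ℓ]) : simil (iotaGSp4 ℓ h) = h.1.1.1.det := by
  rw [simil, iotaGSp4_val, det_fin_two]
  simp [blockMat, J, Matrix.mul_apply, Fin.sum_univ_four]
  ring

/-- The element `(a, b)` of `H(ℚ_ℓ)`. -/
def mkH (a b : GL (Fin 2) ℚ_[ℓ]) (h : a.1.det = b.1.det) : H ℚ_[ℓ] := ⟨(a, b), Units.ext h⟩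

theorem mem_HInt {h : H ℚ_[ℓ]} : h ∈ HInt ℓ ↔ h.1.1 ∈ GLInt ℓ 2 ∧ h.1.2 ∈ GLInt ℓ 2 := Iff.rfl

theorem iotaGSp4_mem_GSp4Int {h : H ℚ_[ℓ]} (hh : h ∈ HInt ℓ) : iotaGSp4 ℓ h ∈ GSp4Int ℓ :=
  map_HInt_le ℓ ⟨h, hh, rfl⟩

theorem norm_ell : ‖(ℓ : ℚ_[ℓ])‖ = (ℓ : ℝ)⁻¹ := Padic.norm_p

theorem ell_ne_zero : (ℓ : ℚ_[ℓ]) ≠ 0 := by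
  exact_mod_cast (Fact.out : ℓ.Prime).ne_zero

theorem one_lt_ell : (1 : ℝ) < ℓ := by exact_mod_cast (Fact.out : ℓ.Prime).one_lt

theorem norm_ell_pow_le (n : ℕ) : ‖(ℓ : ℚ_[ℓ]) ^ n‖ ≤ 1 := by
  rw [norm_pow]
  exact pow_le_one₀ (norm_nonneg _) (by rw [norm_ell]; exact inv_le_one_of_one_le₀ one_lt_ell.le)

theorem norm_ell_zpow (n : ℤ) : ‖(ℓ : ℚ_[ℓ]) ^ n‖ = (ℓ : ℝ) ^ (-n) := by
  rw [norm_zpow, norm_ell, _root_.inv_zpow, _root_.zpow_neg]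

end Basic

end

section

open Matrix

variable {ℓ : ℕ} [Fact ℓ.Prime]

/-! ### Representatives of H(ℚ_ℓ) \ GSp₄(ℚ_ℓ) / GSp₄(ℤ_ℓ). -/

section DoubleCosets

theorem mul_J_mul_transpose (g : GSp4 ℚ_[ℓ]) :
    g.1.1 * J ℚ_[ℓ] * g.1.1ᵀ = simil g • J ℚ_[ℓ] := by
  have h2 : g.1.1 * (g⁻¹ : GSp4 ℚ_[ℓ]).1.1 = 1 := by
    rw [← Units.val_mul, ← Subgroup.coe_mul]; simp
  rw [gsp_inv_val, Matrix.mul_smul] at h2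
  have h3 := congrArg (fun M => (simil g) • (M * J ℚ_[ℓ])) h2
  simp only [Matrix.smul_mul, Matrix.mul_assoc, J_mul_J, smul_smul, Matrix.one_mul] at h3
  rw [← h3]
  simp [simil_ne_zero g, Matrix.mul_assoc]

/-- The representatives of `H(ℚ_ℓ) \ GSp₄(ℚ_ℓ) / GSp₄(ℤ_ℓ)`. -/
def eta (m : ℕ) : GSp4 ℚ_[ℓ] :=
  mkGSp !![1, 0, 0, 0; 0, 1, 0, 0; 1, 0, (ℓ : ℚ_[ℓ]) ^ m, 0; 0, 1, 0, (ℓ : ℚ_[ℓ]) ^ m]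
    ((ℓ : ℚ_[ℓ]) ^ m) (pow_ne_zero _ ell_ne_zero) (by
      ext i j
      fin_cases i <;> fin_cases j <;> simp [J, Matrix.mul_apply, Fin.sum_univ_four])

theorem eta_val (m : ℕ) : (eta m : GSp4 ℚ_[ℓ]).1.1 =
    !![1, 0, 0, 0; 0, 1, 0, 0; 1, 0, (ℓ : ℚ_[ℓ]) ^ m, 0; 0, 1, 0, (ℓ : ℚ_[ℓ]) ^ m] := rfl

theorem simil_eta (m : ℕ) : simil (eta m : GSp4 ℚ_[ℓ]) = (ℓ : ℚ_[ℓ]) ^ m := simil_mkGSp ..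

/-- Column elimination inside SL₂(ℤ_ℓ): the larger of x and y serves as pivot, after a signed swap
of columns if it is y. -/
theorem exists_sl2_kill (x y : ℚ_[ℓ]) : ∃ p q r t : ℚ_[ℓ], ‖p‖ ≤ 1 ∧ ‖q‖ ≤ 1 ∧ ‖r‖ ≤ 1 ∧
    ‖t‖ ≤ 1 ∧ p * t - q * r = 1 ∧ x * q + y * t = 0 := by
  by_cases h : ‖y‖ ≤ ‖x‖
  · refine ⟨1, -(y / x), 0, 1, by simp, ?_, by simp, by simp, by ring, ?_⟩
    · rw [norm_neg, norm_div]; exact div_le_one_of_le₀ h (norm_nonneg _)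
    · by_cases hx : x = 0
      · have : y = 0 := by simpa [hx] using h
        simp [hx, this]
      · field_simp; ring
  · push Not at h
    have hy : y ≠ 0 := by rintro rfl; simp at h; exact absurd h (not_lt.2 (norm_nonneg _))
    refine ⟨0, 1, -1, -(x / y), by simp, by simp, by simp, ?_, by ring, ?_⟩
    · rw [norm_neg, norm_div]; exact div_le_one_of_le₀ h.le (norm_nonneg _)
    · field_simp; ring

/-- The two SL₂ factors of H(ℤ_ℓ) act on columns (0, 3) and (1, 2) and kill entries 3 and 2 of the
top row; an element of the Siegel Levi subgroup, mixing columns 0 and 1, then kills entry 1. -/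
theorem exists_row_zero (g : GSp4 ℚ_[ℓ]) : ∃ k ∈ GSp4Int ℓ,
    (g * k).1.1 0 1 = 0 ∧ (g * k).1.1 0 2 = 0 ∧ (g * k).1.1 0 3 = 0 := by
  obtain ⟨p, q, r, t, hp, hq, hr, ht, hd, h1⟩ := exists_sl2_kill (g.1.1 0 0) (g.1.1 0 3)
  obtain ⟨p', q', r', t', hp', hq', hr', ht', hd', h1'⟩ := exists_sl2_kill (g.1.1 0 1) (g.1.1 0 2)
  have hne : p * t - q * r ≠ 0 := by rw [hd]; exact one_ne_zero
  have hne' : p' * t' - q' * r' ≠ 0 := by rw [hd']; exact one_ne_zero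
  set h : H ℚ_[ℓ] := mkH (gl2 p q r t hne) (gl2 p' q' r' t' hne')
    (by rw [gl2_val, gl2_val, det_fin_two_of, det_fin_two_of, hd, hd']) with hh
  have hK : iotaGSp4 ℓ h ∈ GSp4Int ℓ := iotaGSp4_mem_GSp4Int
    ⟨gl2_mem_GLInt (h := hne) hp hq hr ht (by rw [hd, norm_one]),
      gl2_mem_GLInt (h := hne') hp' hq' hr' ht' (by rw [hd', norm_one])⟩
  obtain ⟨P, Q, R, T, hP, hQ, hR, hT, hD, h2⟩ :=
    exists_sl2_kill ((g * iotaGSp4 ℓ h).1.1 0 0) ((g * iotaGSp4 ℓ h).1.1 0 1)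
  have e2 : (g * iotaGSp4 ℓ h).1.1 0 2 = 0 := by
    change (g.1.1 * blockMat ℚ_[ℓ] (h.1.1.1, h.1.2.1)) 0 2 = 0
    simp [hh, mkH, blockMat, Matrix.mul_apply, Fin.sum_univ_four, h1']
  have e3 : (g * iotaGSp4 ℓ h).1.1 0 3 = 0 := by
    change (g.1.1 * blockMat ℚ_[ℓ] (h.1.1.1, h.1.2.1)) 0 3 = 0
    simp [hh, mkH, blockMat, Matrix.mul_apply, Fin.sum_univ_four, h1]
  let k : GSp4 ℚ_[ℓ] := mkGSp !![P, Q, 0, 0; R, T, 0, 0; 0, 0, P, -Q; 0, 0, -R, T] 1 one_ne_zero (by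
      ext i j
      fin_cases i <;> fin_cases j <;> simp [J, Matrix.mul_apply, Fin.sum_univ_four] <;>
        first | ring1 | linear_combination hD | linear_combination -hD)
  have hk : k ∈ GSp4Int ℓ := by
    refine mkGSp_mem_GSp4Int (fun i j => ?_) norm_one
    fin_cases i <;> fin_cases j <;> simp [hP, hQ, hR, hT]
  refine ⟨iotaGSp4 ℓ h * k, mul_mem hK hk, ?_⟩
  rw [← mul_assoc]
  generalize g * iotaGSp4 ℓ h = G at *
  rw [gsp_mul_val, mkGSp_val]
  refine ⟨?_, ?_, ?_⟩
  · simpa [Matrix.mul_apply, Fin.sum_univ_four, e2, e3] using h2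
  · simp [Matrix.mul_apply, Fin.sum_univ_four, e2, e3]
  · simp [Matrix.mul_apply, Fin.sum_univ_four, e2, e3]

/-- Once the top row is supported in column 0, acting on columns (1, 2) leaves it alone and clears
one entry of the bottom row. The outer entries are nonzero because c · δ is the similitude. -/
theorem exists_rows (g : GSp4 ℚ_[ℓ]) : ∃ k ∈ GSp4Int ℓ, ∃ c α β δ : ℚ_[ℓ], c ≠ 0 ∧ δ ≠ 0 ∧
    (g * k).1.1 0 = ![c, 0, 0, 0] ∧ (g * k).1.1 3 = ![α, β, 0, δ] := by
  obtain ⟨k, hk, h1, h2, h3⟩ := exists_row_zero g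
  suffices h : ∀ G : GSp4 ℚ_[ℓ], G.1.1 0 1 = 0 → G.1.1 0 2 = 0 → G.1.1 0 3 = 0 →
      ∃ k ∈ GSp4Int ℓ, ∃ c α β δ : ℚ_[ℓ], c ≠ 0 ∧ δ ≠ 0 ∧
        (G * k).1.1 0 = ![c, 0, 0, 0] ∧ (G * k).1.1 3 = ![α, β, 0, δ] by
    obtain ⟨k', hk', h⟩ := h _ h1 h2 h3
    exact ⟨k * k', mul_mem hk hk', by rwa [← mul_assoc]⟩
  clear h1 h2 h3
  intro G h1 h2 h3
  obtain ⟨p, q, r, t, hp, hq, hr, ht, hd, h4⟩ := exists_sl2_kill (G.1.1 3 1) (G.1.1 3 2)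
  have hne : p * t - q * r ≠ 0 := by rw [hd]; exact one_ne_zero
  set h : H ℚ_[ℓ] := mkH 1 (gl2 p q r t hne) (by
    rw [gl2_val, det_fin_two_of, hd]; simp) with hh
  have hK : iotaGSp4 ℓ h ∈ GSp4Int ℓ := iotaGSp4_mem_GSp4Int
    ⟨one_mem _, gl2_mem_GLInt (h := hne) hp hq hr ht (by rw [hd, norm_one])⟩
  have e : ∀ i j, (G * iotaGSp4 ℓ h).1.1 i j =
      (G.1.1 * blockMat ℚ_[ℓ] (1, !![p, q; r, t])) i j := fun i j => rfl
  have hrow0 : (G * iotaGSp4 ℓ h).1.1 0 = ![G.1.1 0 0, 0, 0, 0] := by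
    funext j
    rw [e]
    fin_cases j <;> simp [blockMat, Matrix.mul_apply, Fin.sum_univ_four, h1, h2, h3]
  have hrow3 : (G * iotaGSp4 ℓ h).1.1 3 = ![G.1.1 3 0, G.1.1 3 1 * p + G.1.1 3 2 * r, 0,
      G.1.1 3 3] := by
    funext j
    rw [e]
    fin_cases j <;> simp [blockMat, Matrix.mul_apply, Fin.sum_univ_four, h4]
  have hs := congrFun (congrFun (mul_J_mul_transpose G) 0) 3
  have hs' : G.1.1 0 0 * G.1.1 3 3 = simil G := by
    simp only [Matrix.mul_apply, Fin.sum_univ_four, h1, h2, h3] at hs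
    simpa [J] using hs
  have hmul : G.1.1 0 0 * G.1.1 3 3 ≠ 0 := hs' ▸ simil_ne_zero _
  exact ⟨_, hK, _, _, _, _, left_ne_zero_of_mul hmul, right_ne_zero_of_mul hmul, hrow0, hrow3⟩

/-- The form pairs rows 1 and 2 trivially with rows 0 and 3, which clears their outer entries, and
the similitude is 1. Hence the coset H(ℚ_ℓ)g is governed by the outer rows alone. -/
theorem exists_eq_iota {g : GSp4 ℚ_[ℓ]} (h0 : g.1.1 0 = ![1, 0, 0, 0])
    (h3 : g.1.1 3 = ![0, 0, 0, 1]) : ∃ h : H ℚ_[ℓ], g = iotaGSp4 ℓ h := by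
  have e0 : ∀ j, g.1.1 0 j = ![1, 0, 0, 0] j := fun j => congrFun h0 j
  have e3 : ∀ j, g.1.1 3 j = ![0, 0, 0, 1] j := fun j => congrFun h3 j
  have hs := mul_J_mul_transpose g
  have hsij : ∀ i j, (g.1.1 * J ℚ_[ℓ] * g.1.1ᵀ) i j = simil g * J ℚ_[ℓ] i j := fun i j => by
    rw [hs]; rfl
  simp only [Matrix.mul_apply, Fin.sum_univ_four, Matrix.transpose_apply] at hsij
  have h03 := hsij 0 3
  have h01 := hsij 0 1
  have h02 := hsij 0 2
  have h31 := hsij 3 1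
  have h32 := hsij 3 2
  have h12 := hsij 1 2
  simp [e0, e3, J] at h03 h01 h02 h31 h32 h12
  have hd : g.1.1 1 1 * g.1.1 2 2 - g.1.1 1 2 * g.1.1 2 1 = 1 := by
    rw [h01, h02, h31, h32] at h12
    linear_combination h12 - h03
  refine ⟨mkH 1 (gl2 (g.1.1 1 1) (g.1.1 1 2) (g.1.1 2 1) (g.1.1 2 2)
    (by rw [hd]; exact one_ne_zero)) (by
      rw [gl2_val, det_fin_two_of, hd]; simp), gsp_ext ?_⟩
  rw [iotaGSp4_val]
  ext i j
  fin_cases i <;> fin_cases j <;> simp [mkH, blockMat, e0, e3, h01, h02, h31, h32]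

theorem eta_inv_val (m : ℕ) : ((eta m : GSp4 ℚ_[ℓ])⁻¹).1.1 = !![1, 0, 0, 0; 0, 1, 0, 0;
    -((ℓ : ℚ_[ℓ]) ^ m)⁻¹, 0, ((ℓ : ℚ_[ℓ]) ^ m)⁻¹, 0;
    0, -((ℓ : ℚ_[ℓ]) ^ m)⁻¹, 0, ((ℓ : ℚ_[ℓ]) ^ m)⁻¹] := by
  have hm : (ℓ : ℚ_[ℓ]) ^ m ≠ 0 := pow_ne_zero _ ell_ne_zero
  have h2 : (eta m : GSp4 ℚ_[ℓ]).1.1 * ((eta m : GSp4 ℚ_[ℓ])⁻¹).1.1 = 1 := by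
    rw [← gsp_mul_val, mul_inv_cancel]; rfl
  refine (left_inv_eq_right_inv ?_ h2).symm
  rw [eta_val]
  ext i j
  fin_cases i <;> fin_cases j <;> simp [Matrix.mul_apply, Fin.sum_univ_four, hm]

theorem exists_iota_mul_eq_eta {g : GSp4 ℚ_[ℓ]} {m : ℕ} (h0 : g.1.1 0 = ![1, 0, 0, 0])
    (h3 : g.1.1 3 = ![0, 1, 0, (ℓ : ℚ_[ℓ]) ^ m]) : ∃ h : H ℚ_[ℓ], iotaGSp4 ℓ h * g = eta m := by
  have hm : (ℓ : ℚ_[ℓ]) ^ m ≠ 0 := pow_ne_zero _ ell_ne_zero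
  obtain ⟨h', hh'⟩ := exists_eq_iota (g := g * (eta m)⁻¹)
    (by
      funext j; rw [gsp_mul_val, eta_inv_val, Matrix.mul_apply, h0]
      fin_cases j <;> simp [Fin.sum_univ_four])
    (by
      funext j; rw [gsp_mul_val, eta_inv_val, Matrix.mul_apply, h3]
      fin_cases j <;> simp [Fin.sum_univ_four, hm])
  refine ⟨h'⁻¹, ?_⟩
  rw [map_inv, ← hh']
  simp

theorem exists_scaled_rows (g : GSp4 ℚ_[ℓ]) : ∃ k ∈ GSp4Int ℓ, ∃ β δ : ℚ_[ℓ], δ ≠ 0 ∧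
    ∀ e : ℚ_[ℓ], e ≠ 0 → ∃ h : H ℚ_[ℓ], (iotaGSp4 ℓ h * (g * k)).1.1 0 = ![1, 0, 0, 0] ∧
      (iotaGSp4 ℓ h * (g * k)).1.1 3 = ![0, β / e, 0, δ / e] := by
  obtain ⟨k, hk, c, α, β, δ, hc, hδ, h0, h3⟩ := exists_rows g
  refine ⟨k, hk, β, δ, hδ, fun e he => ?_⟩
  have hd : c⁻¹ * e⁻¹ - 0 * -(α / (c * e)) ≠ 0 := by simp [hc, he]
  -- The first factor normalizes c, clears α and divides the bottom row by e; the second only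
  -- matches its determinant, as it does not touch the outer rows.
  refine ⟨mkH (gl2 c⁻¹ 0 (-(α / (c * e))) e⁻¹ hd) (gl2 (c⁻¹ * e⁻¹) 0 0 1 (by simp [hc, he])) (by
    rw [gl2_val, gl2_val, det_fin_two_of, det_fin_two_of]; ring), ?_, ?_⟩
  · funext j
    rw [gsp_mul_val, iotaGSp4_val, Matrix.mul_apply, Fin.sum_univ_four, h0, h3]
    fin_cases j <;> simp [mkH, blockMat, hc]
  · funext j
    rw [gsp_mul_val, iotaGSp4_val, Matrix.mul_apply, Fin.sum_univ_four, h0, h3]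
    fin_cases j <;> simp [mkH, blockMat] <;> field_simp
    simp

/-- Every element of `GSp₄(ℚ_ℓ)` is in some `H(ℚ_ℓ) · eta m · GSp₄(ℤ_ℓ)`. -/
theorem exists_eta (g : GSp4 ℚ_[ℓ]) : ∃ m : ℕ, ∃ h : H ℚ_[ℓ], ∃ k ∈ GSp4Int ℓ,
    iotaGSp4 ℓ h * g * k = eta m := by
  suffices h : ∃ m : ℕ, ∃ h : H ℚ_[ℓ], ∃ k ∈ GSp4Int ℓ,
      (iotaGSp4 ℓ h * g * k).1.1 0 = ![1, 0, 0, 0] ∧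
      (iotaGSp4 ℓ h * g * k).1.1 3 = ![0, 1, 0, (ℓ : ℚ_[ℓ]) ^ m] by
    obtain ⟨m, h, k, hk, h0, h3⟩ := h
    obtain ⟨h', hh'⟩ := exists_iota_mul_eq_eta h0 h3
    exact ⟨m, h' * h, k, hk, by rw [← hh', map_mul]; simp only [mul_assoc]⟩
  obtain ⟨k, hk, β, δ, hδ, scale⟩ := exists_scaled_rows g
  -- If δ/β is integral, dividing by β makes the bottom row (0, 1, 0, uℓ^m), and the unit u is
  -- absorbed on the right. Otherwise dividing by δ gives (0, b, 0, 1) with b integral, and a column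
  -- shear turns b into 1, so that m = 0.
  by_cases hle : ‖δ‖ ≤ ‖β‖
  · have hβ : β ≠ 0 := by
      rintro rfl; rw [norm_zero] at hle; exact hδ (norm_le_zero_iff.1 hle)
    obtain ⟨h, h0', h3'⟩ := scale β hβ
    set d : ℤ_[ℓ] := ⟨δ / β, by rw [norm_div]; exact div_le_one_of_le₀ hle (norm_nonneg _)⟩ with hdd
    have hd0 : d ≠ 0 := by
      intro h; apply div_ne_zero hδ hβ; exact congrArg Subtype.val h
    have hu := PadicInt.unitCoeff_spec hd0
    have hu' : δ / β = ((PadicInt.unitCoeff hd0 : ℤ_[ℓ]) : ℚ_[ℓ]) * (ℓ : ℚ_[ℓ]) ^ d.valuation := by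
      have := congrArg (Subtype.val) hu
      simpa [hdd] using this
    set u : ℚ_[ℓ] := ((PadicInt.unitCoeff hd0 : ℤ_[ℓ]) : ℚ_[ℓ])
    have hun : ‖u‖ = 1 := PadicInt.norm_units _
    have hu0 : u ≠ 0 := by intro h; simp [h] at hun
    refine ⟨d.valuation, h, k * mkGSp !![1, 0, 0, 0; 0, 1, 0, 0; 0, 0, u⁻¹, 0; 0, 0, 0, u⁻¹] u⁻¹
      (inv_ne_zero hu0) (by
        ext i j
        fin_cases i <;> fin_cases j <;> simp [J, Matrix.mul_apply, Fin.sum_univ_four]),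
      mul_mem hk (mkGSp_mem_GSp4Int (fun i j => ?_) (padic_norm_eq_one_inv hun)), ?_, ?_⟩
    · fin_cases i <;> fin_cases j <;> simp [hun]
    · funext j
      rw [← mul_assoc, mul_assoc _ g, gsp_mul_val, mkGSp_val, Matrix.mul_apply, h0']
      fin_cases j <;> simp [Fin.sum_univ_four]
    · funext j
      rw [← mul_assoc, mul_assoc _ g, gsp_mul_val, mkGSp_val, Matrix.mul_apply, h3', hu']
      fin_cases j <;> simp [Fin.sum_univ_four, hβ]
      field_simp
  · push Not at hle
    obtain ⟨h, h0', h3'⟩ := scale δ hδ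
    have hb : ‖β / δ‖ ≤ 1 := by rw [norm_div]; exact div_le_one_of_le₀ hle.le (norm_nonneg _)
    set b := β / δ
    have hb1 : ‖1 - b‖ ≤ 1 := norm_sub_le_one (by simp) hb
    have hdd : δ / δ = 1 := div_self hδ
    refine ⟨0, h, k * mkGSp !![1, 0, 0, 0; 0, 1, 0, 0; 1 - b, 0, 1, 0; 0, 1 - b, 0, 1] 1
      one_ne_zero (by
        ext i j
        fin_cases i <;> fin_cases j <;> simp [J, Matrix.mul_apply, Fin.sum_univ_four]),
      mul_mem hk (mkGSp_mem_GSp4Int (fun i j => ?_) norm_one), ?_, ?_⟩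
    · fin_cases i <;> fin_cases j <;> simp [hb1]
    · funext j
      rw [← mul_assoc, mul_assoc _ g, gsp_mul_val, mkGSp_val, Matrix.mul_apply, h0']
      fin_cases j <;> simp [Fin.sum_univ_four]
    · funext j
      rw [← mul_assoc, mul_assoc _ g, gsp_mul_val, mkGSp_val, Matrix.mul_apply, h3', hdd]
      fin_cases j <;> simp [Fin.sum_univ_four]

end DoubleCosets

end

section

open Matrix

variable {ℓ : ℕ} [Fact ℓ.Prime]

/-! ### The Cartan decomposition of GL₂(ℚ_ℓ). -/

section Cartan

theorem exists_zpow_mul_unit {x : ℚ_[ℓ]} (hx : x ≠ 0) :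
    ∃ n : ℤ, ∃ u : ℚ_[ℓ], ‖u‖ = 1 ∧ x = (ℓ : ℚ_[ℓ]) ^ n * u := by
  have h : (ℓ : ℚ_[ℓ]) ^ x.valuation ≠ 0 := zpow_ne_zero _ ell_ne_zero
  refine ⟨x.valuation, x / (ℓ : ℚ_[ℓ]) ^ x.valuation, ?_, by field_simp⟩
  rw [norm_div, norm_ell_zpow, Padic.norm_eq_zpow_neg_valuation hx, div_self]
  exact zpow_ne_zero _ (by exact_mod_cast (Fact.out : ℓ.Prime).ne_zero)

theorem ell_zpow_ne_zero (n : ℤ) : (ℓ : ℚ_[ℓ]) ^ n ≠ 0 := zpow_ne_zero _ ell_ne_zero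

/-- The diagonal matrix with entries `ℓ ^ (x + a)` and `ℓ ^ x`. -/
def diagPow (x : ℤ) (a : ℕ) : GL (Fin 2) ℚ_[ℓ] :=
  gl2 ((ℓ : ℚ_[ℓ]) ^ (x + a)) 0 0 ((ℓ : ℚ_[ℓ]) ^ x)
    (by simpa using ⟨ell_zpow_ne_zero (x + a), ell_zpow_ne_zero x⟩)

/-- The Weyl element. -/
def weyl : GL (Fin 2) ℚ_[ℓ] := gl2 0 1 1 0 (by simp)

theorem weyl_mem : (weyl : GL (Fin 2) ℚ_[ℓ]) ∈ GLInt ℓ 2 :=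
  gl2_mem_GLInt (by simp) (by simp) (by simp) (by simp) (by simp)

theorem gl2_det_ne_zero (g : GL (Fin 2) ℚ_[ℓ]) : g.1.det ≠ 0 :=
  ((Matrix.isUnit_iff_isUnit_det _).1 g.isUnit).ne_zero

/-- Gaussian elimination with the largest entry t as pivot: q/t and r/t are integral, and the Schur
complement d is divisible by t, whence the exponent gap is nonnegative. -/
theorem cartan_of_norm_le {g : GL (Fin 2) ℚ_[ℓ]} (h : ∀ i j, ‖g.1 i j‖ ≤ ‖g.1 1 1‖) :
    ∃ κ ∈ GLInt ℓ 2, ∃ κ' ∈ GLInt ℓ 2, ∃ x : ℤ, ∃ a : ℕ, g = κ * diagPow x a * κ' := by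
  have hdet := gl2_det_ne_zero g
  set p := g.1 0 0 with hp
  set q := g.1 0 1 with hq
  set r := g.1 1 0 with hr
  set t := g.1 1 1 with ht
  have ht0 : t ≠ 0 := by
    intro h0
    have hz : ∀ i j, g.1 i j = 0 := fun i j => by
      have := h i j; rw [h0, norm_zero] at this; exact norm_le_zero_iff.1 this
    apply hdet
    rw [det_fin_two, hz, hz, hz]; simp
  set d := p - q * r / t with hd
  have hd0 : d ≠ 0 := by
    intro h0
    apply hdet
    rw [det_fin_two, ← hp, ← hq, ← hr, ← ht]
    have : p * t - q * r = d * t := by rw [hd]; field_simp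
    rw [this, h0, zero_mul]
  obtain ⟨n, u, hu, hdu⟩ := exists_zpow_mul_unit hd0
  obtain ⟨x, v, hv, htv⟩ := exists_zpow_mul_unit ht0
  have hqt : ‖q / t‖ ≤ 1 := by
    rw [norm_div]; exact div_le_one_of_le₀ (h 0 1) (norm_nonneg _)
  have hrt : ‖r / t‖ ≤ 1 := by
    rw [norm_div]; exact div_le_one_of_le₀ (h 1 0) (norm_nonneg _)
  have hpt : ‖p / t‖ ≤ 1 := by
    rw [norm_div]; exact div_le_one_of_le₀ (h 0 0) (norm_nonneg _)
  have hdt : ‖d / t‖ ≤ 1 := by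
    have : d / t = p / t - (q / t) * (r / t) := by rw [hd]; field_simp
    rw [this]
    exact norm_sub_le_one hpt (norm_mul_le_one hqt hrt)
  have hxn : x ≤ n := by
    rw [hdu, htv, norm_div, norm_mul, norm_mul, hu, hv, mul_one, mul_one, norm_ell_zpow,
      norm_ell_zpow, ← zpow_sub₀ (by exact_mod_cast (Fact.out : ℓ.Prime).ne_zero)] at hdt
    have := (zpow_le_one_iff_right₀ (one_lt_ell (ℓ := ℓ))).1 hdt
    omega
  have hu0 : u ≠ 0 := by rintro rfl; simp at hu
  have hv0 : v ≠ 0 := by rintro rfl; simp at hv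
  refine ⟨gl2 u (q / t * v) 0 v (by simp [hu0, hv0]), gl2_mem_GLInt hu.le
    (norm_mul_le_one hqt hv.le) (by simp) hv.le (by simp [hu, hv]),
    gl2 1 0 (r / t) 1 (by simp), gl2_mem_GLInt (by simp) (by simp) hrt (by simp) (by simp),
    x, (n - x).toNat, ?_⟩
  have hxa : x + ((n - x).toNat : ℤ) = n := by omega
  have hpd : p = d + q * r / t := by rw [hd]; ring
  apply gl2_ext
  · simp [diagPow, Matrix.mul_apply, Fin.sum_univ_two, hxa, -Int.ofNat_toNat]
    rw [← hp, hpd, hdu]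
    have : v * (ℓ : ℚ_[ℓ]) ^ x = t := by rw [htv]; ring
    calc _ = u * (ℓ : ℚ_[ℓ]) ^ n + q / t * t * (r / t) := by field_simp
      _ = _ := by rw [← this]; ring
  · simp [diagPow, Matrix.mul_apply, Fin.sum_univ_two, -Int.ofNat_toNat]
    rw [← hq]
    have : v * (ℓ : ℚ_[ℓ]) ^ x = t := by rw [htv]; ring
    rw [mul_assoc, this]; field_simp
  · simp [diagPow, Matrix.mul_apply, Fin.sum_univ_two, -Int.ofNat_toNat]
    have : v * (ℓ : ℚ_[ℓ]) ^ x = t := by rw [htv]; ring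
    rw [this, ← hr]; field_simp
  · simp [diagPow, Matrix.mul_apply, Fin.sum_univ_two, -Int.ofNat_toNat]
    rw [← ht, htv]; ring

/-- The Cartan decomposition of `GL₂(ℚ_ℓ)`. -/
theorem cartan (g : GL (Fin 2) ℚ_[ℓ]) :
    ∃ κ ∈ GLInt ℓ 2, ∃ κ' ∈ GLInt ℓ 2, ∃ x : ℤ, ∃ a : ℕ, g = κ * diagPow x a * κ' := by
  obtain ⟨⟨i, j⟩, -, hij⟩ := Finset.exists_max_image (Finset.univ : Finset (Fin 2 × Fin 2))
    (fun p => ‖g.1 p.1 p.2‖) ⟨(0, 0), Finset.mem_univ _⟩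
  have hmax : ∀ i' j', ‖g.1 i' j'‖ ≤ ‖g.1 i j‖ := fun i' j' => hij (i', j') (Finset.mem_univ _)
  clear hij
  have hw : (weyl : GL (Fin 2) ℚ_[ℓ]) * weyl = 1 := by
    apply gl2_ext <;> simp [weyl, Matrix.mul_apply, Fin.sum_univ_two]
  have hl : ∀ g : GL (Fin 2) ℚ_[ℓ], (∃ κ ∈ GLInt ℓ 2, ∃ κ' ∈ GLInt ℓ 2, ∃ x : ℤ, ∃ a : ℕ,
      weyl * g = κ * diagPow x a * κ') → ∃ κ ∈ GLInt ℓ 2, ∃ κ' ∈ GLInt ℓ 2, ∃ x : ℤ, ∃ a : ℕ,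
      g = κ * diagPow x a * κ' := by
    rintro g ⟨κ, hκ, κ', hκ', x, a, h⟩
    refine ⟨weyl * κ, mul_mem weyl_mem hκ, κ', hκ', x, a, ?_⟩
    rw [mul_assoc, mul_assoc, ← mul_assoc κ, ← h, ← mul_assoc, hw, one_mul]
  have hr : ∀ g : GL (Fin 2) ℚ_[ℓ], (∃ κ ∈ GLInt ℓ 2, ∃ κ' ∈ GLInt ℓ 2, ∃ x : ℤ, ∃ a : ℕ,
      g * weyl = κ * diagPow x a * κ') → ∃ κ ∈ GLInt ℓ 2, ∃ κ' ∈ GLInt ℓ 2, ∃ x : ℤ, ∃ a : ℕ,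
      g = κ * diagPow x a * κ' := by
    rintro g ⟨κ, hκ, κ', hκ', x, a, h⟩
    refine ⟨κ, hκ, κ' * weyl, mul_mem hκ' weyl_mem, x, a, ?_⟩
    rw [← mul_assoc, ← h, mul_assoc, hw, mul_one]
  have e1 : ∀ g : GL (Fin 2) ℚ_[ℓ], ∀ i j, (weyl * g).1 i j = g.1 (1 - i) j := by
    intro g i j
    rw [Units.val_mul, weyl, gl2_val]
    fin_cases i <;> simp [Matrix.mul_apply, Fin.sum_univ_two]
  have e2 : ∀ g : GL (Fin 2) ℚ_[ℓ], ∀ i j, (g * weyl).1 i j = g.1 i (1 - j) := by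
    intro g i j
    rw [Units.val_mul, weyl, gl2_val]
    fin_cases j <;> simp [Matrix.mul_apply, Fin.sum_univ_two]
  -- Weyl elements on either side bring the largest entry to the lower right corner.
  fin_cases i <;> fin_cases j
  · apply hl; apply hr
    apply cartan_of_norm_le
    intro i' j'
    rw [e2, e1, e2, e1]; exact hmax _ _
  · apply hl
    apply cartan_of_norm_le
    intro i' j'
    rw [e1, e1]; exact hmax _ _
  · apply hr
    apply cartan_of_norm_le
    intro i' j'
    rw [e2, e2]; exact hmax _ _
  · exact cartan_of_norm_le hmax

end Cartan

/-! ### The equivalence of triples, and the stabilizer of the coset of `eta m`. -/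

section Rel

/-- Two triples are related if they are in the same orbit of `H(ℚ_ℓ)` acting on
`GL₂(ℚ_ℓ)/GL₂(ℤ_ℓ) × GL₂(ℚ_ℓ)/GL₂(ℤ_ℓ) × GSp₄(ℚ_ℓ)/GSp₄(ℤ_ℓ)`. -/
def Rel (t t' : GL (Fin 2) ℚ_[ℓ] × GL (Fin 2) ℚ_[ℓ] × GSp4 ℚ_[ℓ]) : Prop :=
  ∃ h : H ℚ_[ℓ], ∃ κ₁ ∈ GLInt ℓ 2, ∃ κ₂ ∈ GLInt ℓ 2, ∃ k ∈ GSp4Int ℓ,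
    t'.1 = h.1.1 * t.1 * κ₁ ∧ t'.2.1 = h.1.2 * t.2.1 * κ₂ ∧ t'.2.2 = iotaGSp4 ℓ h * t.2.2 * k

theorem Rel.trans {t t' t'' : GL (Fin 2) ℚ_[ℓ] × GL (Fin 2) ℚ_[ℓ] × GSp4 ℚ_[ℓ]} (h : Rel t t')
    (h' : Rel t' t'') : Rel t t'' := by
  obtain ⟨h, κ₁, h₁, κ₂, h₂, k, hk, e₁, e₂, e₃⟩ := h
  obtain ⟨h', κ₁', h₁', κ₂', h₂', k', hk', e₁', e₂', e₃'⟩ := h'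
  refine ⟨h' * h, κ₁ * κ₁', mul_mem h₁ h₁', κ₂ * κ₂', mul_mem h₂ h₂', k * k', mul_mem hk hk',
    ?_, ?_, ?_⟩
  · rw [e₁', e₁]; simp [mul_assoc]
  · rw [e₂', e₂]; simp [mul_assoc]
  · rw [e₃', e₃]; simp [mul_assoc]

theorem Rel.symm {t t' : GL (Fin 2) ℚ_[ℓ] × GL (Fin 2) ℚ_[ℓ] × GSp4 ℚ_[ℓ]} (h : Rel t t') :
    Rel t' t := by
  obtain ⟨h, κ₁, h₁, κ₂, h₂, k, hk, e₁, e₂, e₃⟩ := h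
  refine ⟨h⁻¹, κ₁⁻¹, inv_mem h₁, κ₂⁻¹, inv_mem h₂, k⁻¹, inv_mem hk, ?_, ?_, ?_⟩
  · rw [e₁]; simp [mul_assoc]
  · rw [e₂]; simp [mul_assoc]
  · rw [e₃]; simp [mul_assoc]

theorem Rel.refl (t : GL (Fin 2) ℚ_[ℓ] × GL (Fin 2) ℚ_[ℓ] × GSp4 ℚ_[ℓ]) : Rel t t :=
  ⟨1, 1, one_mem _, 1, one_mem _, 1, one_mem _, by simp, by simp, by simp⟩

theorem rel_of_stab {h : H ℚ_[ℓ]} {m : ℕ} {k : GSp4 ℚ_[ℓ]} (hk : k ∈ GSp4Int ℓ)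
    (e : iotaGSp4 ℓ h * eta m = eta m * k) {a b a' b' κ₁ κ₂ : GL (Fin 2) ℚ_[ℓ]}
    (h₁ : κ₁ ∈ GLInt ℓ 2) (h₂ : κ₂ ∈ GLInt ℓ 2) (e₁ : a' = h.1.1 * a * κ₁)
    (e₂ : b' = h.1.2 * b * κ₂) : Rel (a, b, eta m) (a', b', eta m) :=
  ⟨h, κ₁, h₁, κ₂, h₂, k⁻¹, inv_mem hk, e₁, e₂, by rw [e]; simp⟩

theorem rel_right {a b κ₁ κ₂ : GL (Fin 2) ℚ_[ℓ]} {g k : GSp4 ℚ_[ℓ]} (h₁ : κ₁ ∈ GLInt ℓ 2)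
    (h₂ : κ₂ ∈ GLInt ℓ 2) (hk : k ∈ GSp4Int ℓ) : Rel (a, b, g) (a * κ₁, b * κ₂, g * k) :=
  ⟨1, κ₁, h₁, κ₂, h₂, k, hk, by simp, by simp, by simp⟩

/-- The pair (h, whw), with w the swap and h ∈ GL₂(ℤ_ℓ), stays integral when conjugated by `eta m`,
for every m. It acts on the first two components without moving the third. -/
theorem rel_conj {m : ℕ} {p q r t : ℚ_[ℓ]} (hp : ‖p‖ ≤ 1) (hq : ‖q‖ ≤ 1) (hr : ‖r‖ ≤ 1)
    (ht : ‖t‖ ≤ 1) (hd : ‖p * t - q * r‖ = 1) (hne : p * t - q * r ≠ 0)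
    (hne' : t * p - r * q ≠ 0) {a b a' b' κ₁ κ₂ : GL (Fin 2) ℚ_[ℓ]}
    (h₁ : κ₁ ∈ GLInt ℓ 2) (h₂ : κ₂ ∈ GLInt ℓ 2) (e₁ : a' = gl2 p q r t hne * a * κ₁)
    (e₂ : b' = gl2 t r q p hne' * b * κ₂) : Rel (a, b, eta m) (a', b', eta m) := by
  have hm := norm_ell_pow_le (ℓ := ℓ) m
  refine rel_of_stab (h := mkH (gl2 p q r t hne) (gl2 t r q p hne') (by
      rw [gl2_val, gl2_val, det_fin_two_of, det_fin_two_of]; ring))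
    (k := mkGSp !![p, q, 0, (ℓ : ℚ_[ℓ]) ^ m * q; r, t, (ℓ : ℚ_[ℓ]) ^ m * r, 0;
      0, 0, p, -q; 0, 0, -r, t] (p * t - q * r) hne ?_) ?_ ?_ h₁ h₂ e₁ e₂
  · ext i j
    fin_cases i <;> fin_cases j <;> simp [J, Matrix.mul_apply, Fin.sum_univ_four] <;> ring
  · refine mkGSp_mem_GSp4Int (fun i j => ?_) hd
    have h1 := norm_mul_le_one hm hq
    have h2 := norm_mul_le_one hm hr
    generalize (ℓ : ℚ_[ℓ]) ^ m = L at h1 h2 ⊢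
    rw [norm_mul] at h1 h2
    fin_cases i <;> fin_cases j <;> simp [hp, hq, hr, ht, h1, h2]
  · apply gsp_ext
    rw [gsp_mul_val, gsp_mul_val, eta_val, mkGSp_val, iotaGSp4_val]
    ext i j
    fin_cases i <;> fin_cases j <;>
      simp [mkH, blockMat, Matrix.mul_apply, Fin.sum_univ_four] <;> ring

/-- Beyond the pairs (h, whw), the second factor alone may move by a lower unipotent divisible by
ℓ^m; conjugation by `eta m` turns ℓ^m c into c. -/
theorem rel_unip {m : ℕ} {c : ℚ_[ℓ]} (hc : ‖c‖ ≤ 1) {a b b' : GL (Fin 2) ℚ_[ℓ]}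
    (e₂ : b' = gl2 1 0 ((ℓ : ℚ_[ℓ]) ^ m * c) 1 (by simp) * b) :
    Rel (a, b, eta m) (a, b', eta m) := by
  refine rel_of_stab (h := mkH 1 (gl2 1 0 ((ℓ : ℚ_[ℓ]) ^ m * c) 1 (by simp)) (by
      rw [gl2_val, det_fin_two_of]; simp))
    (k := mkGSp !![1, 0, 0, 0; 0, 1, 0, 0; 0, c, 1, 0; 0, 0, 0, 1] 1 one_ne_zero ?_) ?_ ?_
    (one_mem _) (one_mem _) (by simp [mkH]) (by simpa [mkH] using e₂)
  · ext i j
    fin_cases i <;> fin_cases j <;> simp [J, Matrix.mul_apply, Fin.sum_univ_four]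
  · refine mkGSp_mem_GSp4Int (fun i j => ?_) norm_one
    fin_cases i <;> fin_cases j <;> simp [hc]
  · apply gsp_ext
    rw [gsp_mul_val, gsp_mul_val, eta_val, mkGSp_val, iotaGSp4_val]
    ext i j
    fin_cases i <;> fin_cases j <;>
      simp [mkH, blockMat, Matrix.mul_apply, Fin.sum_univ_four]

end Rel

end

section

open Matrix

variable {ℓ : ℕ} [Fact ℓ.Prime]

/-! ### Reduction of every triple to a standard one. -/

section Rep

/-- The lower triangular matrix `ℓ ^ y • !![1, 0; z, ℓ ^ b]`. -/
def lowPow (y : ℤ) (b : ℕ) (z : ℚ_[ℓ]) : GL (Fin 2) ℚ_[ℓ] :=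
  gl2 ((ℓ : ℚ_[ℓ]) ^ y) 0 (z * (ℓ : ℚ_[ℓ]) ^ y) ((ℓ : ℚ_[ℓ]) ^ (y + b))
    (by simpa using ⟨ell_zpow_ne_zero y, ell_zpow_ne_zero (y + b)⟩)

/-- The standard triples. -/
def rep (x y : ℤ) (a b m : ℕ) (z : ℚ_[ℓ]) : GL (Fin 2) ℚ_[ℓ] × GL (Fin 2) ℚ_[ℓ] × GSp4 ℚ_[ℓ] :=
  (diagPow x a, lowPow y b z, eta m)

theorem zpow_add_nat (x : ℤ) (a : ℕ) :
    (ℓ : ℚ_[ℓ]) ^ (x + a) = (ℓ : ℚ_[ℓ]) ^ x * (ℓ : ℚ_[ℓ]) ^ a := by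
  rw [zpow_add₀ ell_ne_zero, zpow_natCast]

theorem rel_rep_add_right (x y : ℤ) (a b m : ℕ) (z : ℚ_[ℓ]) {c : ℚ_[ℓ]} (hc : ‖c‖ ≤ 1) :
    Rel (rep x y a b m z) (rep x y a b m (z + (ℓ : ℚ_[ℓ]) ^ b * c)) := by
  have h : lowPow y b (z + (ℓ : ℚ_[ℓ]) ^ b * c) = lowPow y b z * gl2 1 0 c 1 (by simp) := by
    apply gl2_ext <;> simp [lowPow, Matrix.mul_apply, Fin.sum_univ_two]
    rw [zpow_add_nat]; ring
  have := rel_right (a := diagPow x a) (b := lowPow y b z) (g := eta m) (one_mem (GLInt ℓ 2))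
    (gl2_mem_GLInt (h := by simp) (p := 1) (q := 0) (r := c) (t := 1) (by simp) (by simp) hc
      (by simp) (by simp)) (one_mem (GSp4Int ℓ))
  rwa [← h, mul_one, mul_one] at this

theorem rel_rep_add_depth (x y : ℤ) (a b m : ℕ) (z : ℚ_[ℓ]) {c : ℚ_[ℓ]} (hc : ‖c‖ ≤ 1) :
    Rel (rep x y a b m z) (rep x y a b m (z + (ℓ : ℚ_[ℓ]) ^ m * c)) := by
  refine rel_unip hc ?_
  apply gl2_ext <;> simp [lowPow, Matrix.mul_apply, Fin.sum_univ_two]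
  ring

/-- An upper unipotent with entry ℓ^a c passes through `diagPow x a` to an integral matrix, which
the right quotient absorbs; its swapped partner adds ℓ^a c to z. -/
theorem rel_rep_add_left (x y : ℤ) (a b m : ℕ) (z : ℚ_[ℓ]) {c : ℚ_[ℓ]} (hc : ‖c‖ ≤ 1) :
    Rel (rep x y a b m z) (rep x y a b m (z + (ℓ : ℚ_[ℓ]) ^ a * c)) := by
  refine rel_conj (p := 1) (q := (ℓ : ℚ_[ℓ]) ^ a * c) (r := 0) (t := 1) (by simp)
    (norm_mul_le_one (norm_ell_pow_le a) hc) (by simp) (by simp) (by simp) (by simp) (by simp)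
    (gl2_mem_GLInt (h := by simp) (p := 1) (q := -c) (r := 0) (t := 1) (by simp) (by simpa)
      (by simp) (by simp) (by simp)) (one_mem _) ?_ ?_
  · apply gl2_ext <;> simp [diagPow, Matrix.mul_apply, Fin.sum_univ_two]
    rw [zpow_add_nat]; ring
  · apply gl2_ext <;> simp [lowPow, Matrix.mul_apply, Fin.sum_univ_two]
    ring

/-- The stabilizing pair diag(u, 1), diag(1, u) multiplies z by u; the remaining unit factors are
absorbed on the right. -/
theorem rel_rep_unit (x y : ℤ) (a b m : ℕ) (z : ℚ_[ℓ]) {u : ℚ_[ℓ]} (hu : ‖u‖ = 1) :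
    Rel (rep x y a b m z) (rep x y a b m (u * z)) := by
  have hu0 : u ≠ 0 := by rintro rfl; simp at hu
  refine rel_conj (p := u) (q := 0) (r := 0) (t := 1) hu.le (by simp) (by simp) (by simp)
    (by simpa) (by simpa) (by simpa)
    (gl2_mem_GLInt (h := by simpa) (p := u⁻¹) (q := 0) (r := 0) (t := 1) (by simp [hu]) (by simp)
      (by simp) (by simp) (by simp [hu]))
    (gl2_mem_GLInt (h := by simpa) (p := 1) (q := 0) (r := 0) (t := u⁻¹) (by simp) (by simp)
      (by simp) (by simp [hu]) (by simp [hu])) ?_ ?_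
  · apply gl2_ext <;> simp [diagPow, Matrix.mul_apply, Fin.sum_univ_two]
    field_simp
  · apply gl2_ext <;> simp [lowPow, Matrix.mul_apply, Fin.sum_univ_two]
    · ring
    · field_simp

/-- Only z modulo ℓ^min(a, b, m) matters: the bounds a, b and m come respectively from the first
component, from the second component, and from the depth of `eta m`. Together with unit scaling this
leaves only powers of ℓ. -/
theorem rel_rep_add_min (x y : ℤ) (a b m : ℕ) (z : ℚ_[ℓ]) {c : ℚ_[ℓ]} (hc : ‖c‖ ≤ 1) {n : ℕ}
    (hn : min a (min b m) ≤ n) :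
    Rel (rep x y a b m z) (rep x y a b m (z + (ℓ : ℚ_[ℓ]) ^ n * c)) := by
  have key : ∀ {n' : ℕ}, n' ≤ n → (ℓ : ℚ_[ℓ]) ^ n * c =
      (ℓ : ℚ_[ℓ]) ^ n' * ((ℓ : ℚ_[ℓ]) ^ (n - n') * c) := fun h => by
    rw [← mul_assoc, ← pow_add, Nat.add_sub_cancel' h]
  have hc' : ∀ {n' : ℕ}, ‖(ℓ : ℚ_[ℓ]) ^ (n - n') * c‖ ≤ 1 := fun {n'} =>
    norm_mul_le_one (norm_ell_pow_le _) hc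
  rcases le_total a (min b m) with h | h
  · rw [min_eq_left h] at hn
    rw [key hn]; exact rel_rep_add_left _ _ _ _ _ _ hc'
  · rw [min_eq_right h] at hn
    rcases le_total b m with h' | h'
    · rw [min_eq_left h'] at hn
      rw [key hn]; exact rel_rep_add_right _ _ _ _ _ _ hc'
    · rw [min_eq_right h'] at hn
      rw [key hn]; exact rel_rep_add_depth _ _ _ _ _ _ hc'

theorem rel_rep_of_dvd (x y : ℤ) (a b m : ℕ) {c : ℚ_[ℓ]} (hc : ‖c‖ ≤ 1) {n i : ℕ}
    (hn : min a (min b m) ≤ n) (hi : min a (min b m) ≤ i) :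
    Rel (rep x y a b m ((ℓ : ℚ_[ℓ]) ^ n * c)) (rep x y a b m ((ℓ : ℚ_[ℓ]) ^ i)) := by
  have h1 := rel_rep_add_min x y a b m 0 hc hn
  have h2 := rel_rep_add_min x y a b m 0 (c := (1 : ℚ_[ℓ])) (by simp) hi
  rw [zero_add] at h1 h2
  rw [mul_one] at h2
  exact h1.symm.trans h2

theorem exists_pow_mul_unit {z : ℚ_[ℓ]} (hz : ‖z‖ ≤ 1) (h0 : z ≠ 0) :
    ∃ n : ℕ, ∃ u : ℚ_[ℓ], ‖u‖ = 1 ∧ z = (ℓ : ℚ_[ℓ]) ^ n * u := by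
  obtain ⟨n, u, hu, rfl⟩ := exists_zpow_mul_unit h0
  rw [norm_mul, hu, mul_one, norm_ell_zpow] at hz
  have := (zpow_le_one_iff_right₀ (one_lt_ell (ℓ := ℓ))).1 hz
  obtain ⟨k, rfl⟩ := Int.eq_ofNat_of_zero_le (show 0 ≤ n by omega)
  exact ⟨k, u, hu, by simp⟩

theorem exists_rel_rep_pow (x y : ℤ) (a b m : ℕ) {z : ℚ_[ℓ]} (hz : ‖z‖ ≤ 1) :
    ∃ i ≤ min a (min b m), Rel (rep x y a b m z) (rep x y a b m ((ℓ : ℚ_[ℓ]) ^ i)) := by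
  have hbig : ∀ {n : ℕ} {c : ℚ_[ℓ]}, ‖c‖ ≤ 1 → min a (min b m) ≤ n →
      ∃ i ≤ min a (min b m), Rel (rep x y a b m ((ℓ : ℚ_[ℓ]) ^ n * c))
        (rep x y a b m ((ℓ : ℚ_[ℓ]) ^ i)) := fun hc hn =>
    ⟨_, le_rfl, rel_rep_of_dvd x y a b m hc hn le_rfl⟩
  by_cases h0 : z = 0
  · have := hbig (n := min a (min b m)) (c := (0 : ℚ_[ℓ])) (by simp) le_rfl
    rwa [mul_zero, ← h0] at this
  obtain ⟨n, u, hu, rfl⟩ := exists_pow_mul_unit hz h0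
  by_cases hn : min a (min b m) ≤ n
  · exact hbig hu.le hn
  · refine ⟨n, by omega, ?_⟩
    rw [mul_comm]
    exact (rel_rep_unit x y a b m _ hu).symm

theorem eq_gl2 (g : GL (Fin 2) ℚ_[ℓ]) : g = gl2 (g.1 0 0) (g.1 0 1) (g.1 1 0) (g.1 1 1)
    (by rw [← det_fin_two]; exact gl2_det_ne_zero g) :=
  gl2_ext rfl rfl rfl rfl

/-- With q a unit, column operations bring κ diag(ℓ^b, 1) to lower triangular form, with z = t/q. -/
theorem rel_lowPow (x y : ℤ) (a b m : ℕ) {κ κ' : GL (Fin 2) ℚ_[ℓ]} (hκ : κ ∈ GLInt ℓ 2)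
    (hκ' : κ' ∈ GLInt ℓ 2) (hq : ‖κ.1 0 1‖ = 1) : ∃ z : ℚ_[ℓ], ‖z‖ ≤ 1 ∧
    Rel (diagPow x a, κ * diagPow y b * κ', eta m) (rep x y a b m z) := by
  obtain ⟨hi, hd⟩ := mem_GLInt_two.1 hκ
  rw [det_fin_two] at hd
  set p := κ.1 0 0 with hp
  set q := κ.1 0 1 with hqq
  set r := κ.1 1 0 with hr
  set t := κ.1 1 1 with ht
  have hq0 : q ≠ 0 := by intro h; rw [h, norm_zero] at hq; exact zero_ne_one hq
  have hz : ‖t / q‖ ≤ 1 := by rw [norm_div, hq, div_one]; exact hi 1 1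
  have hdet : p * (ℓ : ℚ_[ℓ]) ^ b * 0 - q * (r - t / q * p) = p * t - q * r := by
    field_simp; ring
  have hne : p * (ℓ : ℚ_[ℓ]) ^ b * 0 - q * (r - t / q * p) ≠ 0 := by
    rw [hdet]; intro h; rw [h, norm_zero] at hd; exact zero_ne_one hd
  have hM : gl2 (p * (ℓ : ℚ_[ℓ]) ^ b) q (r - t / q * p) 0 hne ∈ GLInt ℓ 2 :=
    gl2_mem_GLInt (norm_mul_le_one (hi 0 0) (norm_ell_pow_le b)) (hi 0 1)
      (norm_sub_le_one (hi 1 0) (norm_mul_le_one hz (hi 0 0))) (by simp) (by rw [hdet, hd])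
  refine ⟨t / q, hz, Rel.symm ?_⟩
  have e : κ * diagPow y b = lowPow y b (t / q) *
      gl2 (p * (ℓ : ℚ_[ℓ]) ^ b) q (r - t / q * p) 0 hne := by
    apply gl2_ext <;> simp [lowPow, diagPow, Matrix.mul_apply, Fin.sum_univ_two]
    · rw [zpow_add_nat, ← hp]; ring
    · rw [← hqq]; ring
    · rw [zpow_add_nat, ← hr]; ring
    · rw [← ht]; field_simp
  have := rel_right (a := diagPow x a) (b := lowPow y b (t / q)) (g := eta m)
    (one_mem (GLInt ℓ 2)) (mul_mem hM hκ') (one_mem (GSp4Int ℓ))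
  rwa [mul_one, mul_one, ← mul_assoc, ← e] at this

/-- Every triple is related to a standard one. -/
theorem exists_rel_rep (t : GL (Fin 2) ℚ_[ℓ] × GL (Fin 2) ℚ_[ℓ] × GSp4 ℚ_[ℓ]) :
    ∃ x y : ℤ, ∃ a b m i : ℕ, i ≤ min a (min b m) ∧ Rel t (rep x y a b m ((ℓ : ℚ_[ℓ]) ^ i)) := by
  obtain ⟨a₀, b₀, g⟩ := t
  obtain ⟨m, h, k, hk, hη⟩ := exists_eta g
  have r1 : Rel (a₀, b₀, g) (h.1.1 * a₀, h.1.2 * b₀, eta m) :=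
    ⟨h, 1, one_mem _, 1, one_mem _, k, hk, by simp, by simp, hη.symm⟩
  obtain ⟨κ, hκ, κ', hκ', x, a, e⟩ := cartan (h.1.1 * a₀)
  obtain ⟨hi, hd⟩ := mem_GLInt_two.1 (inv_mem hκ)
  have hd0 := gl2_det_ne_zero κ⁻¹
  rw [det_fin_two] at hd hd0
  obtain ⟨b', r2⟩ : ∃ b', Rel (h.1.1 * a₀, h.1.2 * b₀, eta m) (diagPow x a, b', eta m) := by
    refine ⟨_, rel_conj (hi 0 0) (hi 0 1) (hi 1 0) (hi 1 1) hd hd0 (by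
      intro h; apply hd0; rw [← h]; ring) (inv_mem hκ') (one_mem _) ?_ rfl⟩
    rw [← eq_gl2, e]; simp [mul_assoc]
  obtain ⟨κ₂, hκ₂, κ₂', hκ₂', y, b, rfl⟩ := cartan b'
  obtain ⟨z, hz, r3⟩ : ∃ z : ℚ_[ℓ], ‖z‖ ≤ 1 ∧
      Rel (diagPow x a, κ₂ * diagPow y b * κ₂', eta m) (rep x y a b m z) := by
    by_cases hq : ‖κ₂.1 0 1‖ = 1
    · exact rel_lowPow x y a b m hκ₂ hκ₂' hq
    · obtain ⟨hi2, hd2⟩ := mem_GLInt_two.1 hκ₂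
      have hlt : ‖κ₂.1 0 1‖ < 1 := lt_of_le_of_ne (hi2 0 1) hq
      have ht : ‖κ₂.1 1 1‖ = 1 := by
        by_contra hne
        have hlt' : ‖κ₂.1 1 1‖ < 1 := lt_of_le_of_ne (hi2 1 1) hne
        rw [det_fin_two, sub_eq_add_neg] at hd2
        have := Padic.nonarchimedean (κ₂.1 0 0 * κ₂.1 1 1) (-(κ₂.1 0 1 * κ₂.1 1 0))
        rw [hd2, norm_neg, norm_mul, norm_mul] at this
        have h1 : ‖κ₂.1 0 0‖ * ‖κ₂.1 1 1‖ < 1 := mul_lt_one_of_nonneg_of_lt_one_right (hi2 0 0)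
          (norm_nonneg _) hlt'
        have h2 : ‖κ₂.1 0 1‖ * ‖κ₂.1 1 0‖ < 1 := mul_lt_one_of_nonneg_of_lt_one_left
          (norm_nonneg _) hlt (hi2 1 0)
        exact absurd this (not_le.2 (max_lt h1 h2))
      -- When q is not a unit, t is; a shear of the second component replaces q by q + t. Its
      -- partner on the first component passes through the diagonal matrix and is absorbed on the
      -- right.
      have hs : gl2 (ℓ := ℓ) 1 1 0 1 (by simp) ∈ GLInt ℓ 2 :=
        gl2_mem_GLInt (by simp) (by simp) (by simp) (by simp) (by simp)
      obtain ⟨z, hz, r⟩ := rel_lowPow x y a b m (mul_mem hs hκ₂) hκ₂' (by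
        have : (gl2 (ℓ := ℓ) 1 1 0 1 (by simp) * κ₂).1 0 1 = κ₂.1 0 1 + κ₂.1 1 1 := by
          simp [Matrix.mul_apply, Fin.sum_univ_two]
        rw [this, Padic.add_eq_max_of_ne (by rw [ht]; exact hq), ht, max_eq_right hlt.le])
      refine ⟨z, hz, Rel.trans ?_ r⟩
      refine rel_conj (p := 1) (q := 0) (r := 1) (t := 1) (by simp) (by simp) (by simp) (by simp)
        (by simp) (by simp) (by simp) (gl2_mem_GLInt (h := by simp) (p := 1) (q := 0)
          (r := -(ℓ : ℚ_[ℓ]) ^ a) (t := 1) (by simp) (by simp)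
          (by rw [norm_neg]; exact norm_ell_pow_le a) (by simp) (by simp)) (one_mem _) ?_ ?_
      · apply gl2_ext <;> simp [diagPow, Matrix.mul_apply, Fin.sum_univ_two]
        rw [zpow_add_nat]; ring
      · simp [mul_assoc]
  obtain ⟨i, hi, r4⟩ := exists_rel_rep_pow x y a b m hz
  exact ⟨x, y, a, b, m, i, hi, ((r1.trans r2).trans r3).trans r4⟩

end Rep

end

section

open Matrix MeasureTheory TopologicalSpace

/-! ### Averages over compact groups. -/

section Mean

variable {C : Type*} [Group C] [TopologicalSpace C] [IsTopologicalGroup C] [CompactSpace C]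

instance : IsCompactOpen (⊤ : Subgroup C) where
  isCompact := isCompact_univ
  isOpen := isOpen_univ

instance {G : Type*} [Group G] [TopologicalSpace G] [IsTopologicalGroup G] (K : Subgroup G)
    [h : IsCompactOpen K] : CompactSpace K := isCompact_iff_compactSpace.1 h.isCompact

/-- The mean of a function on a compact group. -/
def mean (F : C → ℂ) : ℂ := haarInt (⊤ : Subgroup C) F

theorem mean_const (c : ℂ) : mean (fun _ : C => c) = c := by
  have h := haarInt_const_mul (⊤ : Subgroup C) c (fun _ => 1)
  have h1 : haarInt (⊤ : Subgroup C) (fun _ => 1) = 1 := by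
    have := haarInt_indicator (⊤ : Subgroup C)
    rw [Subgroup.coe_top, Set.indicator_univ] at this
    exact this
  rw [h1, mul_one] at h
  simpa [mean] using h

theorem mean_mul_left (a : C) (F : C → ℂ) : mean (fun k => F (a * k)) = mean F :=
  haarInt_mul_left _ a F

theorem mean_const_mul (c : ℂ) (F : C → ℂ) : mean (fun k => c * F k) = c * mean F :=
  haarInt_const_mul _ c F

theorem mean_add {F F' : C → ℂ} (hF : Continuous F) (hF' : Continuous F') :
    mean (fun k => F k + F' k) = mean F + mean F' :=
  haarInt_add _ hF (HasCompactSupport.of_compactSpace _) hF' (HasCompactSupport.of_compactSpace _)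

theorem mean_haarInt_swap {G : Type*} [Group G] [TopologicalSpace G] [IsTopologicalGroup G]
    (K : Subgroup G) [IsCompactOpen K] {F : C → G → ℂ} (hF : Continuous F.uncurry) {S : Set G}
    (hS : IsCompact S) (h : ∀ x y, F x y ≠ 0 → y ∈ S) :
    mean (fun x => haarInt K (fun y => F x y)) = haarInt K (fun y => mean (fun x => F x y)) :=
  haarInt_swap _ _ hF isCompact_univ hS fun x y hxy => ⟨trivial, h x y hxy⟩

theorem mean_swap {C' : Type*} [Group C'] [TopologicalSpace C'] [IsTopologicalGroup C']
    [CompactSpace C'] {F : C → C' → ℂ} (hF : Continuous F.uncurry) :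
    mean (fun x => mean (fun y => F x y)) = mean (fun y => mean (fun x => F x y)) :=
  mean_haarInt_swap _ hF isCompact_univ fun _ _ _ => trivial

/-- If c ≠ 0 then F/c is continuous with values 0 and 1 and is not identically zero, so its integral
is positive. This turns every averaging relation below into vanishing at a single point. -/
theorem eq_zero_of_mean_eq_zero {F : C → ℂ} (hF : Continuous F) {c : ℂ}
    (hc : ∀ k, F k = 0 ∨ F k = c) {k₀ : C} (h₀ : F k₀ = c) (hm : mean F = 0) : c = 0 := by
  letI : MeasurableSpace C := borel C
  haveI : BorelSpace C := ⟨rfl⟩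
  by_contra hne
  have hf : Continuous (fun k => (F k / c).re) := by fun_prop
  have e : ∀ k, F k = c * (((F k / c).re : ℝ) : ℂ) := by
    intro k
    rcases hc k with h | h <;> simp [h, hne]
  have hpos : 0 < ∫ k, (F k / c).re ∂(Measure.haarMeasure (posCompact (⊤ : Subgroup C))) := by
    refine hf.integral_pos_of_hasCompactSupport_nonneg_nonzero
      (HasCompactSupport.of_compactSpace _) (fun k => ?_) (x := k₀) ?_
    · rcases hc k with h | h <;> simp [h, hne]
    · simp [h₀, hne]
  have hm' : mean F = c * ((∫ k, (F k / c).re ∂(Measure.haarMeasure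
      (posCompact (⊤ : Subgroup C))) : ℝ) : ℂ) := by
    rw [← integral_complex_ofReal]
    conv_lhs => rw [funext e]
    exact mean_const_mul c _
  rw [hm'] at hm
  rcases mul_eq_zero.1 hm with h | h
  · exact hne h
  · exact hpos.ne' (by exact_mod_cast h)

end Mean

variable {ℓ : ℕ} [Fact ℓ.Prime]

/-! ### Admissible functions and the operators that preserve them. -/

section Admissible

/-- The `H(ℚ_ℓ)`-invariant functions on
`GL₂(ℚ_ℓ)/GL₂(ℤ_ℓ) × GL₂(ℚ_ℓ)/GL₂(ℤ_ℓ) × GSp₄(ℚ_ℓ)/GSp₄(ℤ_ℓ)` with vanishing means over the orbits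
of `GSp₄(ℤ_ℓ)`. -/
structure Admissible (Φ : GL (Fin 2) ℚ_[ℓ] × GL (Fin 2) ℚ_[ℓ] × GSp4 ℚ_[ℓ] → ℂ) : Prop where
  rel : ∀ t t', Rel t t' → Φ t = Φ t'
  mean_eq_zero : ∀ a b g, mean (fun k : GSp4Int ℓ => Φ (a, b, k * g)) = 0

variable {Φ : GL (Fin 2) ℚ_[ℓ] × GL (Fin 2) ℚ_[ℓ] × GSp4 ℚ_[ℓ] → ℂ}

theorem continuous_of_rel (h : ∀ t t', Rel t t' → Φ t = Φ t') : Continuous Φ := by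
  refine (isLocallyConstant_of_right (K := (GLInt ℓ 2).prod ((GLInt ℓ 2).prod (GSp4Int ℓ)))
    ?_).continuous
  rintro ⟨κ₁, κ₂, k⟩ ⟨h₁, h₂, hk⟩ ⟨a, b, g⟩
  exact (h _ _ (rel_right h₁ h₂ hk)).symm

theorem Admissible.continuous (h : Admissible Φ) : Continuous Φ := continuous_of_rel h.rel

/-- A Hecke operator in the first variable. -/
def heckeFst (d : GL (Fin 2) ℚ_[ℓ]) (Φ : GL (Fin 2) ℚ_[ℓ] × GL (Fin 2) ℚ_[ℓ] × GSp4 ℚ_[ℓ] → ℂ)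
    (t : GL (Fin 2) ℚ_[ℓ] × GL (Fin 2) ℚ_[ℓ] × GSp4 ℚ_[ℓ]) : ℂ :=
  mean (fun k : GLInt ℓ 2 => Φ (t.1 * k * d, t.2))

/-- A Hecke operator in the second variable. -/
def heckeSnd (d : GL (Fin 2) ℚ_[ℓ]) (Φ : GL (Fin 2) ℚ_[ℓ] × GL (Fin 2) ℚ_[ℓ] × GSp4 ℚ_[ℓ] → ℂ)
    (t : GL (Fin 2) ℚ_[ℓ] × GL (Fin 2) ℚ_[ℓ] × GSp4 ℚ_[ℓ]) : ℂ :=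
  mean (fun k : GLInt ℓ 2 => Φ (t.1, t.2.1 * k * d, t.2.2))

/-- Right translations in the first variable commute with the left action of H and with averaging in
the third variable; the inner mean restores right invariance under GL₂(ℤ_ℓ). -/
theorem Admissible.heckeFst (h : Admissible Φ) (d : GL (Fin 2) ℚ_[ℓ]) :
    Admissible (heckeFst d Φ) where
  rel := by
    rintro ⟨a, b, g⟩ ⟨a', b', g'⟩ ⟨η, κ₁, h₁, κ₂, h₂, k, hk, e₁, e₂, e₃⟩
    simp only at e₁ e₂ e₃
    subst e₁ e₂ e₃
    simp only [GSp4Hecke.heckeFst]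
    rw [← mean_mul_left (⟨κ₁, h₁⟩ : GLInt ℓ 2) (fun k => Φ (a * k * d, b, g))]
    congr 1
    funext κ
    exact h.rel _ _ ⟨η, 1, one_mem _, κ₂, h₂, k, hk, by simp [mul_assoc], by simp, by simp⟩
  mean_eq_zero a b g := by
    have hc := h.continuous
    simp only [GSp4Hecke.heckeFst]
    rw [mean_swap (F := fun (k : GSp4Int ℓ) (κ : GLInt ℓ 2) => Φ (a * κ * d, b, k * g))
      (hc.comp (((continuous_const.mul (continuous_subtype_val.comp continuous_snd)).mul
        continuous_const).prodMk (continuous_const.prodMk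
        ((continuous_subtype_val.comp continuous_fst).mul continuous_const))))]
    simp only [h.mean_eq_zero]
    exact mean_const 0

theorem Admissible.heckeSnd (h : Admissible Φ) (d : GL (Fin 2) ℚ_[ℓ]) :
    Admissible (heckeSnd d Φ) where
  rel := by
    rintro ⟨a, b, g⟩ ⟨a', b', g'⟩ ⟨η, κ₁, h₁, κ₂, h₂, k, hk, e₁, e₂, e₃⟩
    simp only at e₁ e₂ e₃
    subst e₁ e₂ e₃
    simp only [GSp4Hecke.heckeSnd]
    rw [← mean_mul_left (⟨κ₂, h₂⟩ : GLInt ℓ 2) (fun k => Φ (a, b * k * d, g))]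
    congr 1
    funext κ
    exact h.rel _ _ ⟨η, κ₁, h₁, 1, one_mem _, k, hk, by simp, by simp [mul_assoc], by simp⟩
  mean_eq_zero a b g := by
    have hc := h.continuous
    simp only [GSp4Hecke.heckeSnd]
    rw [mean_swap (F := fun (k : GSp4Int ℓ) (κ : GLInt ℓ 2) => Φ (a, b * κ * d, k * g))
      (hc.comp (continuous_const.prodMk (((continuous_const.mul
        (continuous_subtype_val.comp continuous_snd)).mul continuous_const).prodMk
        ((continuous_subtype_val.comp continuous_fst).mul continuous_const))))]
    simp only [h.mean_eq_zero]
    exact mean_const 0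

/-- Independent central shifts in the two GL₂ variables allow x and y to be normalized to 0. -/
theorem Admissible.translate (h : Admissible Φ) {z z' : GL (Fin 2) ℚ_[ℓ]}
    (hz : ∀ x, z * x = x * z) (hz' : ∀ x, z' * x = x * z') :
    Admissible (fun t => Φ (t.1 * z, t.2.1 * z', t.2.2)) where
  rel := by
    rintro ⟨a, b, g⟩ ⟨a', b', g'⟩ ⟨η, κ₁, h₁, κ₂, h₂, k, hk, e₁, e₂, e₃⟩
    simp only at e₁ e₂ e₃
    subst e₁ e₂ e₃
    exact h.rel _ _ ⟨η, κ₁, h₁, κ₂, h₂, k, hk, by simp only [mul_assoc, hz],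
      by simp only [mul_assoc, hz'], rfl⟩
  mean_eq_zero a b g := h.mean_eq_zero (a * z) (b * z') g

end Admissible

/-! ### Vanishing at standard triples, and perturbation of the last parameter. -/

section Vanish

variable (ℓ) in
/-- All admissible functions vanish on a standard triple, whatever its scaling. -/
def Vanish (a b m i : ℕ) : Prop :=
  ∀ Φ : GL (Fin 2) ℚ_[ℓ] × GL (Fin 2) ℚ_[ℓ] × GSp4 ℚ_[ℓ] → ℂ, Admissible Φ →
    ∀ x y : ℤ, Φ (rep x y a b m ((ℓ : ℚ_[ℓ]) ^ i)) = 0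

theorem norm_le_inv_of_lt_one {t : ℚ_[ℓ]} (h : ‖t‖ < 1) : ‖t / ℓ‖ ≤ 1 := by
  by_cases h0 : t = 0
  · simp [h0]
  obtain ⟨n, u, hu, rfl⟩ := exists_pow_mul_unit h.le h0
  have hn : n ≠ 0 := by rintro rfl; simp [hu] at h
  obtain ⟨k, rfl⟩ := Nat.exists_eq_succ_of_ne_zero hn
  have : (ℓ : ℚ_[ℓ]) ^ (k + 1) * u / ℓ = (ℓ : ℚ_[ℓ]) ^ k * u := by
    have := ell_ne_zero (ℓ := ℓ)
    field_simp; ring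
  rw [Nat.succ_eq_add_one, this]
  exact norm_mul_le_one (norm_ell_pow_le k) hu.le

theorem norm_one_sub_eq_one {v : ℚ_[ℓ]} (h : ‖v‖ < 1) : ‖1 - v‖ = 1 := by
  rw [sub_eq_add_neg, Padic.add_eq_max_of_ne (by rw [norm_neg, norm_one]; exact h.ne'), norm_neg,
    norm_one, max_eq_left h.le]

theorem norm_ell_pow_lt {n : ℕ} (hn : n ≠ 0) : ‖(ℓ : ℚ_[ℓ]) ^ n‖ < 1 := by
  rw [norm_pow, norm_ell]
  exact pow_lt_one₀ (by positivity) (inv_lt_one_of_one_lt₀ one_lt_ell) hn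

/-- How a standard triple changes when the last parameter moves by a multiple of `ℓ ^ n`. -/
theorem rel_rep_add_cases (x y : ℤ) (a b m i n : ℕ) {u : ℚ_[ℓ]} (hu : ‖u‖ ≤ 1) (hin : i ≤ n)
    (hn : min a (min b m) ≤ n + 1) :
    Rel (rep x y a b m ((ℓ : ℚ_[ℓ]) ^ i + (ℓ : ℚ_[ℓ]) ^ n * u))
        (rep x y a b m ((ℓ : ℚ_[ℓ]) ^ i)) ∨
      (i = n ∧ min a (min b m) = n + 1 ∧
        Rel (rep x y a b m ((ℓ : ℚ_[ℓ]) ^ i + (ℓ : ℚ_[ℓ]) ^ n * u))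
          (rep x y a b m ((ℓ : ℚ_[ℓ]) ^ (i + 1)))) := by
  have hunit : ∀ v : ℚ_[ℓ], ‖v‖ = 1 → Rel (rep x y a b m ((ℓ : ℚ_[ℓ]) ^ i * v))
      (rep x y a b m ((ℓ : ℚ_[ℓ]) ^ i)) := fun v hv => by
    rw [mul_comm]; exact (rel_rep_unit x y a b m _ hv).symm
  by_cases hmin : min a (min b m) ≤ n
  · exact Or.inl (rel_rep_add_min x y a b m _ hu hmin).symm
  rcases hin.lt_or_eq with hlt | rfl
  · left
    have e : (ℓ : ℚ_[ℓ]) ^ i + (ℓ : ℚ_[ℓ]) ^ n * u =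
        (ℓ : ℚ_[ℓ]) ^ i * (1 - (ℓ : ℚ_[ℓ]) ^ (n - i) * -u) := by
      have : (ℓ : ℚ_[ℓ]) ^ n = (ℓ : ℚ_[ℓ]) ^ i * (ℓ : ℚ_[ℓ]) ^ (n - i) := by
        rw [← pow_add, Nat.add_sub_cancel' hin]
      rw [this]; ring
    rw [e]
    refine hunit _ (norm_one_sub_eq_one ?_)
    rw [norm_mul, norm_neg]
    exact mul_lt_one_of_nonneg_of_lt_one_left (norm_nonneg _) (norm_ell_pow_lt (by omega)) hu
  · have e : (ℓ : ℚ_[ℓ]) ^ i + (ℓ : ℚ_[ℓ]) ^ i * u = (ℓ : ℚ_[ℓ]) ^ i * (1 + u) := by ring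
    rw [e]
    -- The class can change only if u ≡ -1 modulo ℓ; then ℓ^i(1 + u) is divisible by ℓ^(i+1), and i
    -- + 1 is already the modulus.
    by_cases h1 : ‖1 + u‖ = 1
    · exact Or.inl (hunit _ h1)
    · have hlt : ‖1 + u‖ < 1 := lt_of_le_of_ne (norm_add_le_one (by simp) hu) h1
      refine Or.inr ⟨rfl, by omega, ?_⟩
      have e' : (ℓ : ℚ_[ℓ]) ^ i * (1 + u) = (ℓ : ℚ_[ℓ]) ^ (i + 1) * ((1 + u) / ℓ) := by
        have := ell_ne_zero (ℓ := ℓ)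
        field_simp; ring
      rw [e']
      exact rel_rep_of_dvd x y a b m (norm_le_inv_of_lt_one hlt) hn hn

end Vanish

end

section

open Matrix

variable {ℓ : ℕ} [Fact ℓ.Prime]

/-! ### Propagation of vanishing by the Hecke operators of GL₂. -/

section HeckeRules

/-- The matrix `diag(1, ℓ)`. -/
def diagOneEll : GL (Fin 2) ℚ_[ℓ] := gl2 1 0 0 ℓ (by simpa using ell_ne_zero)

/-- These are the neighbours of a vertex in the tree of GL₂; which kind occurs depends on whether
the lower right entry of k is a unit. -/
theorem mul_diag_cases {k : GL (Fin 2) ℚ_[ℓ]} (hk : k ∈ GLInt ℓ 2) :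
    (∃ u : ℚ_[ℓ], ‖u‖ ≤ 1 ∧ ∃ κ ∈ GLInt ℓ 2,
      k * diagPow 0 1 = gl2 (ℓ : ℚ_[ℓ]) u 0 1 (by simpa using ell_ne_zero) * κ) ∨
    ∃ κ ∈ GLInt ℓ 2, k * diagPow 0 1 = diagOneEll * κ := by
  have hl := ell_ne_zero (ℓ := ℓ)
  obtain ⟨hi, hd⟩ := mem_GLInt_two.1 hk
  have hd0 := gl2_det_ne_zero k
  rw [det_fin_two] at hd hd0
  set p := k.1 0 0 with hp
  set q := k.1 0 1 with hq
  set r := k.1 1 0 with hr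
  set t := k.1 1 1 with ht
  have hl1 : ‖(ℓ : ℚ_[ℓ])‖ ≤ 1 := by simpa using norm_ell_pow_le (ℓ := ℓ) 1
  by_cases h : ‖t‖ = 1
  · left
    have ht0 : t ≠ 0 := by intro h0; rw [h0, norm_zero] at h; exact zero_ne_one h
    have hu : ‖q / t‖ ≤ 1 := by rw [norm_div, h, div_one]; exact hi 0 1
    have hdet : (p - q / t * r) * t - 0 * (ℓ * r) = p * t - q * r := by field_simp; ring
    refine ⟨q / t, hu, gl2 (p - q / t * r) 0 (ℓ * r) t (by rwa [hdet]),
      gl2_mem_GLInt (norm_sub_le_one (hi 0 0) (norm_mul_le_one hu (hi 1 0))) (by simp)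
        (norm_mul_le_one hl1 (hi 1 0)) (hi 1 1) (by rwa [hdet]), ?_⟩
    apply gl2_ext <;> simp [diagPow, Matrix.mul_apply, Fin.sum_univ_two]
    · rw [← hp]; ring
    · rw [← hq]; field_simp
    · rw [← hr]; ring
    · rw [← ht]
  · right
    have hlt : ‖t‖ < 1 := lt_of_le_of_ne (hi 1 1) h
    have hdet : (ℓ * p) * (t / ℓ) - q * r = p * t - q * r := by field_simp
    refine ⟨gl2 (ℓ * p) q r (t / ℓ) (by rwa [hdet]),
      gl2_mem_GLInt (norm_mul_le_one hl1 (hi 0 0)) (hi 0 1) (hi 1 0) (norm_le_inv_of_lt_one hlt)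
        (by rwa [hdet]), ?_⟩
    apply gl2_ext <;> simp [diagPow, diagOneEll, Matrix.mul_apply, Fin.sum_univ_two]
    · rw [← hp]; ring
    · rw [← hq]
    · rw [← hr]; ring
    · rw [← ht]; field_simp

theorem mul_diag_cases' {k : GL (Fin 2) ℚ_[ℓ]} (hk : k ∈ GLInt ℓ 2) :
    (∃ u : ℚ_[ℓ], ‖u‖ ≤ 1 ∧ ∃ κ ∈ GLInt ℓ 2,
      k * diagOneEll = gl2 1 0 u (ℓ : ℚ_[ℓ]) (by simpa using ell_ne_zero) * κ) ∨
    ∃ κ ∈ GLInt ℓ 2, k * diagOneEll = diagPow 0 1 * κ := by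
  have hl := ell_ne_zero (ℓ := ℓ)
  obtain ⟨hi, hd⟩ := mem_GLInt_two.1 hk
  have hd0 := gl2_det_ne_zero k
  rw [det_fin_two] at hd hd0
  set p := k.1 0 0 with hp
  set q := k.1 0 1 with hq
  set r := k.1 1 0 with hr
  set t := k.1 1 1 with ht
  have hl1 : ‖(ℓ : ℚ_[ℓ])‖ ≤ 1 := by simpa using norm_ell_pow_le (ℓ := ℓ) 1
  by_cases h : ‖p‖ = 1
  · left
    have ht0 : p ≠ 0 := by intro h0; rw [h0, norm_zero] at h; exact zero_ne_one h
    have hu : ‖r / p‖ ≤ 1 := by rw [norm_div, h, div_one]; exact hi 1 0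
    have hdet : p * (t - r / p * q) - (ℓ * q) * 0 = p * t - q * r := by field_simp; ring
    refine ⟨r / p, hu, gl2 p (ℓ * q) 0 (t - r / p * q) (by rwa [hdet]),
      gl2_mem_GLInt (hi 0 0) (norm_mul_le_one hl1 (hi 0 1)) (by simp)
        (norm_sub_le_one (hi 1 1) (norm_mul_le_one hu (hi 0 1))) (by rwa [hdet]), ?_⟩
    apply gl2_ext <;> simp [diagOneEll, Matrix.mul_apply, Fin.sum_univ_two]
    · rw [← hp]
    · rw [← hq]; ring
    · rw [← hr]; field_simp
    · rw [← ht]; ring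
  · right
    have hlt : ‖p‖ < 1 := lt_of_le_of_ne (hi 0 0) h
    have hdet : (p / ℓ) * (ℓ * t) - q * r = p * t - q * r := by field_simp
    refine ⟨gl2 (p / ℓ) q r (ℓ * t) (by rwa [hdet]),
      gl2_mem_GLInt (norm_le_inv_of_lt_one hlt) (hi 0 1) (hi 1 0) (norm_mul_le_one hl1 (hi 1 1))
        (by rwa [hdet]), ?_⟩
    apply gl2_ext <;> simp [diagPow, diagOneEll, Matrix.mul_apply, Fin.sum_univ_two]
    · rw [← hp]; field_simp
    · rw [← hq]; ring
    · rw [← hr]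
    · rw [← ht]; ring

theorem rel_fst_right {a κ : GL (Fin 2) ℚ_[ℓ]} (hκ : κ ∈ GLInt ℓ 2)
    (t : GL (Fin 2) ℚ_[ℓ] × GSp4 ℚ_[ℓ]) : Rel (a * κ, t) (a, t) :=
  Rel.symm ⟨1, κ, hκ, 1, one_mem _, 1, one_mem _, by simp, by simp, by simp⟩

theorem rel_snd_right {b κ : GL (Fin 2) ℚ_[ℓ]} (hκ : κ ∈ GLInt ℓ 2) (a : GL (Fin 2) ℚ_[ℓ])
    (g : GSp4 ℚ_[ℓ]) : Rel (a, b * κ, g) (a, b, g) :=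
  Rel.symm ⟨1, 1, one_mem _, κ, hκ, 1, one_mem _, by simp, by simp, by simp⟩

/-- Apply the hypothesis at (a, b, m, i) to the Hecke transform of Φ. Its value is an average over
neighbours: those with a + 1 give the desired value or, exceptionally, the triple with i + 1; the
others have a - 1. The last two kinds vanish by `hdiag` and `hpred`. -/
theorem vanish_succ_left {a b m i : ℕ} (hi : i ≤ min a (min b m)) (h : Vanish ℓ a b m i)
    (hpred : ∀ a', a = a' + 1 → Vanish ℓ a' b m (min i a'))
    (hdiag : i = a → i < min b m → Vanish ℓ (a + 1) b m (i + 1)) : Vanish ℓ (a + 1) b m i := by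
  intro Φ hΦ x y
  have hl := ell_ne_zero (ℓ := ℓ)
  have hc := hΦ.continuous
  have h0 := h _ (hΦ.heckeFst (diagPow 0 1)) x y
  refine eq_zero_of_mean_eq_zero (C := GLInt ℓ 2)
    (F := fun k => Φ (diagPow x a * k.1 * diagPow 0 1, lowPow y b ((ℓ : ℚ_[ℓ]) ^ i), eta m))
    (hc.comp (((continuous_const.mul continuous_subtype_val).mul continuous_const).prodMk
      continuous_const)) (k₀ := 1) ?_ ?_ h0
  · rintro ⟨k, hk⟩
    simp only [rep]
    rw [mul_assoc]
    rcases mul_diag_cases hk with ⟨u, hu, κ, hκ, e⟩ | ⟨κ, hκ, e⟩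
    · rw [e, ← mul_assoc, hΦ.rel _ _ (rel_fst_right hκ _)]
      have r1 : Rel (diagPow x a * gl2 (ℓ : ℚ_[ℓ]) u 0 1 (by simpa using ell_ne_zero),
          lowPow y b ((ℓ : ℚ_[ℓ]) ^ i), eta m)
          (rep x y (a + 1) b m ((ℓ : ℚ_[ℓ]) ^ i + (ℓ : ℚ_[ℓ]) ^ a * -u)) := by
        refine rel_conj (p := 1) (q := (ℓ : ℚ_[ℓ]) ^ a * -u) (r := 0) (t := 1) (by simp)
          (norm_mul_le_one (norm_ell_pow_le a) (by rwa [norm_neg])) (by simp) (by simp) (by simp)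
          (by simp) (by simp) (one_mem _) (one_mem _) ?_ ?_
        · apply gl2_ext <;> simp [diagPow, Matrix.mul_apply, Fin.sum_univ_two]
          · rw [← add_assoc, zpow_add_one₀ hl]
          · rw [zpow_add_nat]; ring
        · apply gl2_ext <;> simp [lowPow, Matrix.mul_apply, Fin.sum_univ_two]
          ring
      rw [hΦ.rel _ _ r1]
      rcases rel_rep_add_cases x y (a + 1) b m i a (u := -u) (by rwa [norm_neg])
        (hi.trans (min_le_left _ _)) (min_le_left _ _) with r2 | ⟨hia, hmin, r2⟩
      · right; exact hΦ.rel _ _ r2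
      · left
        rw [hΦ.rel _ _ r2]
        exact hdiag hia (by omega) Φ hΦ x y
    · rw [e, ← mul_assoc, hΦ.rel _ _ (rel_fst_right hκ _)]
      rcases Nat.eq_zero_or_pos a with rfl | ha
      -- For a = 0 there is no backward neighbour: the Weyl element turns diag(1, ℓ) into diag(ℓ,
      -- 1), giving the desired value again.
      · right
        obtain rfl : i = 0 := by omega
        refine hΦ.rel _ _ (rel_conj (p := 0) (q := 1) (r := 1) (t := 0) (by simp) (by simp)
          (by simp) (by simp) (by simp) (by simp) (by simp) weyl_mem
          (gl2_mem_GLInt (p := 1) (q := (ℓ : ℚ_[ℓ]) ^ b) (r := 0) (t := -1) (h := by simp) (by simp)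
            (norm_ell_pow_le b) (by simp) (by simp) (by simp)) ?_ ?_)
        · apply gl2_ext <;> simp [diagPow, diagOneEll, weyl, Matrix.mul_apply, Fin.sum_univ_two]
          rw [zpow_add_one₀ hl]
        · apply gl2_ext <;> simp [lowPow, Matrix.mul_apply, Fin.sum_univ_two, zpow_add_nat]
      · left
        obtain ⟨a', rfl⟩ := Nat.exists_eq_succ_of_ne_zero ha.ne'
        have e2 : (diagPow x (a' + 1) * diagOneEll : GL (Fin 2) ℚ_[ℓ]) = diagPow (x + 1) a' := by
          apply gl2_ext <;> simp [diagPow, diagOneEll, Matrix.mul_apply, Fin.sum_univ_two]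
          · congr 1; ring
          · rw [zpow_add_one₀ hl]
        rw [Nat.succ_eq_add_one, e2]
        have r2 : Rel (rep (x + 1) y a' b m ((ℓ : ℚ_[ℓ]) ^ i))
            (rep (x + 1) y a' b m ((ℓ : ℚ_[ℓ]) ^ (min i a'))) := by
          rcases le_total i a' with h | h
          · rw [min_eq_left h]; exact Rel.refl _
          · rw [min_eq_right h]
            have := rel_rep_of_dvd (x + 1) y a' b m (c := (1 : ℚ_[ℓ])) (by simp) (n := i) (i := a')
              (by omega) (by omega)
            rwa [mul_one] at this
        exact (hΦ.rel _ _ r2).trans (hpred a' rfl Φ hΦ _ _)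
  · simp only [rep]
    congr 2
    apply gl2_ext <;> simp [diagPow, Matrix.mul_apply, Fin.sum_univ_two]
    rw [← add_assoc, zpow_add_one₀ hl]

/-- The counterpart in the second variable. Here diag(1, ℓ) is the operator that raises b, because
the second component is in lower triangular form. -/
theorem vanish_succ_right {a b m i : ℕ} (hi : i ≤ min a (min b m)) (h : Vanish ℓ a b m i)
    (hpred : ∀ b', b = b' + 1 → Vanish ℓ a b' m (min i b'))
    (hdiag : i = b → i < min a m → Vanish ℓ a (b + 1) m (i + 1)) : Vanish ℓ a (b + 1) m i := by
  intro Φ hΦ x y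
  have hl := ell_ne_zero (ℓ := ℓ)
  have hl1 : ‖(ℓ : ℚ_[ℓ])‖ ≤ 1 := by simpa using norm_ell_pow_le (ℓ := ℓ) 1
  have hc := hΦ.continuous
  have h0 := h _ (hΦ.heckeSnd diagOneEll) x y
  refine eq_zero_of_mean_eq_zero (C := GLInt ℓ 2)
    (F := fun k => Φ (diagPow x a, lowPow y b ((ℓ : ℚ_[ℓ]) ^ i) * k.1 * diagOneEll, eta m))
    (hc.comp (continuous_const.prodMk (((continuous_const.mul continuous_subtype_val).mul
      continuous_const).prodMk continuous_const))) (k₀ := 1) ?_ ?_ h0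
  · rintro ⟨k, hk⟩
    simp only [rep]
    rw [mul_assoc]
    rcases mul_diag_cases' hk with ⟨u, hu, κ, hκ, e⟩ | ⟨κ, hκ, e⟩
    · have e1 : lowPow y b ((ℓ : ℚ_[ℓ]) ^ i) * gl2 1 0 u (ℓ : ℚ_[ℓ]) (by simpa using ell_ne_zero) =
          lowPow y (b + 1) ((ℓ : ℚ_[ℓ]) ^ i + (ℓ : ℚ_[ℓ]) ^ b * u) := by
        apply gl2_ext <;> simp [lowPow, Matrix.mul_apply, Fin.sum_univ_two]
        · rw [zpow_add_nat]; ring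
        · rw [← add_assoc, zpow_add_one₀ hl]
      rw [e, ← mul_assoc, hΦ.rel _ _ (rel_snd_right hκ _ _), e1]
      rcases rel_rep_add_cases x y a (b + 1) m i b hu
        (by omega) (by omega) with r2 | ⟨hia, hmin, r2⟩
      · right; exact hΦ.rel _ _ r2
      · left
        exact (hΦ.rel _ _ r2).trans (hdiag hia (by omega) Φ hΦ x y)
    · rw [e, ← mul_assoc, hΦ.rel _ _ (rel_snd_right hκ _ _)]
      rcases Nat.eq_zero_or_pos b with rfl | hb
      · right
        obtain rfl : i = 0 := by omega
        -- For b = 0 the swapped shear replaces [ℓ, 0; ℓ, 1] by [2ℓ, 1; ℓ, 1], up to ℓ^y; the matrix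
        -- [0, -1; 1, 2ℓ] then gives the standard form [1, 0; 1, ℓ].
        refine hΦ.rel _ _ (rel_conj (p := 1) (q := 0) (r := 1) (t := 1) (by simp) (by simp)
          (by simp) (by simp) (by simp) (by simp) (by simp)
          (gl2_mem_GLInt (p := 1) (q := 0) (r := -(ℓ : ℚ_[ℓ]) ^ a) (t := 1) (h := by simp) (by simp)
            (by simp) (by rw [norm_neg]; exact norm_ell_pow_le a) (by simp) (by simp))
          (gl2_mem_GLInt (p := 0) (q := -1) (r := 1) (t := (ℓ : ℚ_[ℓ]) + (ℓ : ℚ_[ℓ])) (h := by simp) (by simp)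
            (by simp) (by simp) (norm_add_le_one hl1 hl1) (by simp)) ?_ ?_)
        · apply gl2_ext <;> simp [diagPow, Matrix.mul_apply, Fin.sum_univ_two]
          rw [zpow_add_nat]; ring
        · apply gl2_ext <;> simp [lowPow, diagPow, Matrix.mul_apply, Fin.sum_univ_two]
          · ring
          · rw [zpow_add_one₀ hl]; ring
      · left
        obtain ⟨b', rfl⟩ := Nat.exists_eq_succ_of_ne_zero hb.ne'
        have e2 : (lowPow y (b' + 1) ((ℓ : ℚ_[ℓ]) ^ i) * diagPow 0 1 : GL (Fin 2) ℚ_[ℓ]) =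
            lowPow (y + 1) b' ((ℓ : ℚ_[ℓ]) ^ i) := by
          apply gl2_ext <;> simp [lowPow, diagPow, Matrix.mul_apply, Fin.sum_univ_two]
          · rw [zpow_add_one₀ hl]
          · rw [zpow_add_one₀ hl]; ring
          · congr 1; ring
        rw [Nat.succ_eq_add_one, e2]
        have r2 : Rel (rep x (y + 1) a b' m ((ℓ : ℚ_[ℓ]) ^ i))
            (rep x (y + 1) a b' m ((ℓ : ℚ_[ℓ]) ^ (min i b'))) := by
          rcases le_total i b' with h | h
          · rw [min_eq_left h]; exact Rel.refl _
          · rw [min_eq_right h]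
            have := rel_rep_of_dvd x (y + 1) a b' m (c := (1 : ℚ_[ℓ])) (by simp) (n := i) (i := b')
              (by omega) (by omega)
            rwa [mul_one] at this
        exact (hΦ.rel _ _ r2).trans (hpred b' rfl Φ hΦ _ _)
  · have e1 : lowPow y b ((ℓ : ℚ_[ℓ]) ^ i) * diagOneEll = lowPow y (b + 1) ((ℓ : ℚ_[ℓ]) ^ i) := by
      apply gl2_ext <;> simp [lowPow, diagOneEll, Matrix.mul_apply, Fin.sum_univ_two]
      rw [← add_assoc, zpow_add_one₀ hl]
    simp only [rep, OneMemClass.coe_one, mul_one, e1]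

/-- The standard triples with a given third component are reached from the special ones. -/
theorem vanish_of_diag {m C : ℕ} (hQ : ∀ j ≤ C, j ≤ m → Vanish ℓ j j m j) :
    ∀ a b i : ℕ, i ≤ min a (min b m) → min a (min b m) ≤ C → Vanish ℓ a b m i := by
  suffices h : ∀ N a b i : ℕ, a + b = N → i ≤ min a (min b m) → min a (min b m) ≤ C →
      Vanish ℓ a b m i from fun a b i => h _ a b i rfl
  intro N
  induction N using Nat.strong_induction_on with
  | _ N ih =>
    rintro a b i rfl hi hC
    by_cases h1 : a = i ∧ b = i
    · obtain ⟨rfl, rfl⟩ := h1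
      exact hQ _ (by omega) (by omega)
    -- The exceptional neighbour with i + 1 has the same a + b as the goal, so the induction does
    -- not reach it. Descent in a is chosen exactly when that neighbour is absent or is itself
    -- diagonal; otherwise descent in b creates none.
    by_cases h2 : i < a ∧ (i + 1 < a ∨ min b m ≤ i ∨ b = i + 1)
    · obtain ⟨a', rfl⟩ := Nat.exists_eq_succ_of_ne_zero (show a ≠ 0 by omega)
      refine vanish_succ_left (by omega) (ih _ (by omega) a' b i rfl (by omega) (by omega)) ?_ ?_
      · rintro a'' rfl
        exact ih _ (by omega) _ _ _ rfl (by omega) (by omega)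
      · rintro rfl hlt
        obtain rfl : b = i + 1 := by omega
        exact hQ _ (by omega) (by omega)
    · obtain ⟨b', rfl⟩ := Nat.exists_eq_succ_of_ne_zero (show b ≠ 0 by omega)
      refine vanish_succ_right (by omega) (ih _ (by omega) a b' i rfl (by omega) (by omega))
        ?_ ?_
      · rintro b'' rfl
        exact ih _ (by omega) _ _ _ rfl (by omega) (by omega)
      · rintro rfl hlt
        omega

end HeckeRules

end

section

open Matrix

variable {ℓ : ℕ} [Fact ℓ.Prime]

/-! ### Size bounds for entries, 2 × 2 minors and similitudes. -/

section Minors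

/-- A bound for the `2 × 2` minors of a matrix. -/
def MinorLe (X : Matrix (Fin 4) (Fin 4) ℚ_[ℓ]) (C : ℝ) : Prop :=
  ∀ r s c d, ‖X r c * X s d - X r d * X s c‖ ≤ C

theorem MinorLe.transpose {X : Matrix (Fin 4) (Fin 4) ℚ_[ℓ]} {C : ℝ} (h : MinorLe X C) :
    MinorLe Xᵀ C := by
  intro r s c d
  have := h c d r s
  simp only [Matrix.transpose_apply]
  rwa [mul_comm (X d r)]

/-- Cauchy–Binet, with the ultrametric inequality: minors of a product are integral combinations of
minors of X. -/
theorem MinorLe.mul_right {X B : Matrix (Fin 4) (Fin 4) ℚ_[ℓ]} {C : ℝ} (h : MinorLe X C)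
    (hB : ∀ i j, ‖B i j‖ ≤ 1) : MinorLe (X * B) C := by
  intro r s c d
  have hC : 0 ≤ C := (norm_nonneg _).trans (h 0 0 0 0)
  have e : (X * B) r c * (X * B) s d - (X * B) r d * (X * B) s c =
      ∑ p, ∑ q, (X r p * X s q - X r q * X s p) * (B p c * B q d) := by
    simp only [Matrix.mul_apply, Finset.sum_mul_sum, sub_mul, Finset.sum_sub_distrib]
    congr 1
    · exact Finset.sum_congr rfl fun p _ => Finset.sum_congr rfl fun q _ => by ring
    · rw [Finset.sum_comm]
      exact Finset.sum_congr rfl fun p _ => Finset.sum_congr rfl fun q _ => by ring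
  rw [e]
  refine IsUltrametricDist.norm_sum_le_of_forall_le_of_nonneg hC fun p _ =>
    IsUltrametricDist.norm_sum_le_of_forall_le_of_nonneg hC fun q _ => ?_
  rw [norm_mul]
  exact (mul_le_of_le_one_right (norm_nonneg _) (norm_mul_le_one (hB _ _) (hB _ _))).trans
    (h _ _ _ _)

theorem MinorLe.mul_left {X A : Matrix (Fin 4) (Fin 4) ℚ_[ℓ]} {C : ℝ} (h : MinorLe X C)
    (hA : ∀ i j, ‖A i j‖ ≤ 1) : MinorLe (A * X) C := by
  have := (h.transpose.mul_right (B := Aᵀ) fun i j => hA j i).transpose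
  rwa [← Matrix.transpose_mul, Matrix.transpose_transpose] at this

theorem minorLe_diagonal {e : Fin 4 → ℚ_[ℓ]} {C : ℝ} (hC : 0 ≤ C)
    (h : ∀ r s, r ≠ s → ‖e r * e s‖ ≤ C) : MinorLe (Matrix.diagonal e) C := by
  intro r s c d
  by_cases hrs : r = s
  · subst hrs; rw [mul_comm, sub_self, norm_zero]; exact hC
  have h1 := h r s hrs
  simp only [Matrix.diagonal_apply]
  by_cases h1c : r = c <;> by_cases h1d : r = d <;> by_cases h2c : s = c <;> by_cases h2d : s = d <;>
    simp_all

theorem blockMat_norm_le {P Q : Matrix (Fin 2) (Fin 2) ℚ_[ℓ]} {C : ℝ} (hC : 0 ≤ C)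
    (hP : ∀ i j, ‖P i j‖ ≤ C) (hQ : ∀ i j, ‖Q i j‖ ≤ C) (i j : Fin 4) :
    ‖blockMat ℚ_[ℓ] (P, Q) i j‖ ≤ C := by
  fin_cases i <;> fin_cases j <;> simp [blockMat, hP, hQ, hC]

theorem eta_norm_le (m : ℕ) (i j : Fin 4) : ‖(eta m : GSp4 ℚ_[ℓ]).1.1 i j‖ ≤ 1 := by
  have := norm_ell_pow_le (ℓ := ℓ) m
  rw [eta_val]
  generalize (ℓ : ℚ_[ℓ]) ^ m = L at *
  fin_cases i <;> fin_cases j <;> simp [this]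

/-- The similitudes of k and k⁻¹ are both integral, and their product is 1. -/
theorem norm_simil_of_mem {k : GSp4 ℚ_[ℓ]} (hk : k ∈ GSp4Int ℓ) : ‖simil k‖ = 1 := by
  have key : ∀ k : GSp4 ℚ_[ℓ], k ∈ GSp4Int ℓ → ‖simil k‖ ≤ 1 := by
    intro k hk
    have h := norm_apply_le_of_mem_GSp4Int hk
    have h1 : ∀ i j, ‖(k.1.1ᵀ * J ℚ_[ℓ]) i j‖ ≤ 1 * 1 :=
      norm_mul_apply_le zero_le_one zero_le_one (fun i j => h j i) norm_J_le
    simpa [simil] using norm_mul_apply_le (by norm_num) zero_le_one h1 h 0 3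
  have h1 := key k hk
  have h2 := key k⁻¹ (inv_mem hk)
  have h3 : simil k * simil k⁻¹ = 1 := by rw [← simil_mul, mul_inv_cancel, simil_one]
  have h4 : ‖simil k‖ * ‖simil k⁻¹‖ = 1 := by rw [← norm_mul, h3, norm_one]
  nlinarith [norm_nonneg (simil k), norm_nonneg (simil k⁻¹)]

end Minors

/-! ### The diagonal triples, and the vanishing of admissible functions. -/

section Base

theorem diagPow_inv_val (x : ℤ) (a : ℕ) : ((diagPow x a : GL (Fin 2) ℚ_[ℓ])⁻¹).1 =
    !![(ℓ : ℚ_[ℓ]) ^ (-(x + a)), 0; 0, (ℓ : ℚ_[ℓ]) ^ (-x)] := by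
  have h1 := ell_zpow_ne_zero (ℓ := ℓ) (x + a)
  have h2 := ell_zpow_ne_zero (ℓ := ℓ) x
  rw [gl2_inv_val, diagPow, gl2_val, det_fin_two_of, _root_.zpow_neg, _root_.zpow_neg]
  ext i j
  fin_cases i <;> fin_cases j <;> simp <;> field_simp

theorem lowPow_inv_val (y : ℤ) (b : ℕ) (z : ℚ_[ℓ]) : ((lowPow y b z : GL (Fin 2) ℚ_[ℓ])⁻¹).1 =
    !![(ℓ : ℚ_[ℓ]) ^ (-y), 0; -(z * (ℓ : ℚ_[ℓ]) ^ (-(y + b))), (ℓ : ℚ_[ℓ]) ^ (-(y + b))] := by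
  have h1 := ell_zpow_ne_zero (ℓ := ℓ) (y + b)
  have h2 := ell_zpow_ne_zero (ℓ := ℓ) y
  rw [gl2_inv_val, lowPow, gl2_val, det_fin_two_of, _root_.zpow_neg, _root_.zpow_neg]
  ext i j
  fin_cases i <;> fin_cases j <;> simp <;> field_simp

theorem norm_det_diagPow (x : ℤ) (a : ℕ) :
    ‖(diagPow x a : GL (Fin 2) ℚ_[ℓ]).1.det‖ = (ℓ : ℝ) ^ (-(2 * x + a)) := by
  rw [diagPow, gl2_val, det_fin_two_of, mul_zero, sub_zero, ← zpow_add₀ ell_ne_zero, norm_ell_zpow]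
  congr 1; ring

theorem norm_det_lowPow (y : ℤ) (b : ℕ) (z : ℚ_[ℓ]) :
    ‖(lowPow y b z : GL (Fin 2) ℚ_[ℓ]).1.det‖ = (ℓ : ℝ) ^ (-(2 * y + b)) := by
  rw [lowPow, gl2_val, det_fin_two_of, zero_mul, sub_zero, ← zpow_add₀ ell_ne_zero, norm_ell_zpow]
  congr 1; ring

theorem zpow_le_iff {a b : ℤ} : (ℓ : ℝ) ^ a ≤ (ℓ : ℝ) ^ b ↔ a ≤ b :=
  zpow_le_zpow_iff_right₀ one_lt_ell

theorem zpow_eq_iff {a b : ℤ} : (ℓ : ℝ) ^ a = (ℓ : ℝ) ^ b ↔ a = b := by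
  rw [le_antisymm_iff, zpow_le_iff, zpow_le_iff, le_antisymm_iff]

/-- The third component of a special triple, once the first two components are moved to `1`. -/
def baseElt (m i : ℕ) : GSp4 ℚ_[ℓ] :=
  iotaGSp4 ℓ (mkH (diagPow 0 i)⁻¹ (lowPow 0 i 0)⁻¹ (by
    rw [diagPow_inv_val, lowPow_inv_val, det_fin_two_of, det_fin_two_of]; simp)) * eta m

theorem baseElt_val (m i : ℕ) : (baseElt m i : GSp4 ℚ_[ℓ]).1.1 =
    blockMat ℚ_[ℓ] (!![(ℓ : ℚ_[ℓ]) ^ (-(i : ℤ)), 0; 0, 1], !![1, 0; 0, (ℓ : ℚ_[ℓ]) ^ (-(i : ℤ))]) *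
      (eta m).1.1 := by
  rw [baseElt, gsp_mul_val, iotaGSp4_val]
  simp only [mkH]
  rw [diagPow_inv_val, lowPow_inv_val]
  simp

theorem baseElt_norm_le (m i : ℕ) (r s : Fin 4) :
    ‖(baseElt m i : GSp4 ℚ_[ℓ]).1.1 r s‖ ≤ (ℓ : ℝ) ^ (i : ℤ) := by
  have h1 : (1 : ℝ) ≤ (ℓ : ℝ) ^ (i : ℤ) := one_le_zpow₀ one_lt_ell.le (by positivity)
  have h0 : (0 : ℝ) ≤ (ℓ : ℝ) ^ (i : ℤ) := by linarith
  have h2 : ‖(ℓ : ℚ_[ℓ]) ^ (-(i : ℤ))‖ ≤ (ℓ : ℝ) ^ (i : ℤ) := by rw [norm_ell_zpow, neg_neg]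
  rw [baseElt_val, ← mul_one ((ℓ : ℝ) ^ (i : ℤ))]
  refine norm_mul_apply_le h0 zero_le_one (blockMat_norm_le h0 (fun i' j' => ?_) fun i' j' => ?_)
    (eta_norm_le m) r s
  · generalize (ℓ : ℚ_[ℓ]) ^ (-(i : ℤ)) = L at *
    generalize (ℓ : ℝ) ^ (i : ℤ) = R at *
    fin_cases i' <;> fin_cases j' <;> simp [h0, h1, h2]
  · generalize (ℓ : ℚ_[ℓ]) ^ (-(i : ℤ)) = L at *
    generalize (ℓ : ℝ) ^ (i : ℤ) = R at *
    fin_cases i' <;> fin_cases j' <;> simp [h0, h1, h2]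

theorem baseElt_apply_zero (m i : ℕ) :
    ‖(baseElt m i : GSp4 ℚ_[ℓ]).1.1 0 0‖ = (ℓ : ℝ) ^ (i : ℤ) := by
  have : (baseElt m i : GSp4 ℚ_[ℓ]).1.1 0 0 = (ℓ : ℚ_[ℓ]) ^ (-(i : ℤ)) := by
    rw [baseElt_val, eta_val]
    simp [blockMat, Matrix.mul_apply, Fin.sum_univ_four]
  rw [this, norm_ell_zpow, neg_neg]

/-- Up to an integral left factor, the element is diag(ℓ^(-i), 1, ℓ^(m-i), ℓ^m); as i ≤ m, no two of
the exponents sum to less than -i. -/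
theorem baseElt_minorLe {m i : ℕ} (hi : i ≤ m) :
    MinorLe (baseElt m i : GSp4 ℚ_[ℓ]).1.1 ((ℓ : ℝ) ^ (i : ℤ)) := by
  let e : Fin 4 → ℤ := ![-i, 0, m - i, m]
  have hd : MinorLe (Matrix.diagonal fun r => (ℓ : ℚ_[ℓ]) ^ e r) ((ℓ : ℝ) ^ (i : ℤ)) := by
    refine minorLe_diagonal (by positivity) fun r s hrs => ?_
    rw [← zpow_add₀ ell_ne_zero, norm_ell_zpow, zpow_le_iff]
    fin_cases r <;> fin_cases s <;> simp [e] at hrs ⊢ <;> omega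
  have := hd.mul_left (A := !![1, 0, 0, 0; 0, 1, 0, 0; 1, 0, 1, 0; 0, 1, 0, 1]) (by
    intro i j; fin_cases i <;> fin_cases j <;> simp)
  convert this using 1
  rw [baseElt_val, eta_val]
  ext r s
  fin_cases r <;> fin_cases s <;>
    simp [blockMat, Matrix.mul_apply, Fin.sum_univ_four, e, Matrix.diagonal_apply]
  rw [sub_eq_add_neg, zpow_add₀ ell_ne_zero, _root_.zpow_neg, zpow_natCast, zpow_natCast, mul_comm]

theorem norm_simil_baseElt (m i : ℕ) :
    ‖simil (baseElt m i : GSp4 ℚ_[ℓ])‖ = (ℓ : ℝ) ^ ((i : ℤ) - m) := by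
  rw [baseElt, simil_mul, simil_iotaGSp4, simil_eta]
  simp only [mkH]
  rw [diagPow_inv_val, det_fin_two_of]
  simp only [zero_add, neg_zero, zpow_zero, mul_one, mul_zero, sub_zero]
  rw [← zpow_natCast, ← zpow_add₀ ell_ne_zero, norm_ell_zpow]
  congr 1; ring

/-- With a = b = i, the parameter ℓ^i may be replaced by 0, so both GL₂ components become diagonal
of equal determinant and are undone by one element of H. -/
theorem rel_baseElt (m i : ℕ) : Rel (rep 0 0 i i m ((ℓ : ℚ_[ℓ]) ^ i)) (1, 1, baseElt m i) := by
  have h1 := rel_rep_add_min 0 0 i i m 0 (c := (1 : ℚ_[ℓ])) (by simp) (n := i) (min_le_left _ _)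
  rw [zero_add, mul_one] at h1
  exact h1.symm.trans ⟨mkH (diagPow 0 i)⁻¹ (lowPow 0 i 0)⁻¹ (by
    rw [diagPow_inv_val, lowPow_inv_val, det_fin_two_of, det_fin_two_of]; simp),
    1, one_mem _, 1, one_mem _, 1, one_mem _, by simp [rep, mkH],
    by simp [rep, mkH], by simp [rep, baseElt]⟩

/-- The numerical constraints on the standard triples met by the `GSp₄(ℤ_ℓ)`-orbit of
`baseElt m i`. -/
theorem constraints_of_rel {m i : ℕ} (hi : i ≤ m) {k : GSp4 ℚ_[ℓ]} (hk : k ∈ GSp4Int ℓ) {x y : ℤ}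
    {a b m' i' : ℕ} (h : Rel (1, 1, k * baseElt m i) (rep x y a b m' ((ℓ : ℚ_[ℓ]) ^ i'))) :
    x + a ≤ i ∧ y + b ≤ i ∧ (x + a = i ∨ y + b = i) ∧ 2 * x + a ≤ i ∧
      (x + a) + (y + b) - i' ≤ i ∧ 2 * x + a = 2 * y + b ∧ (m' : ℤ) = m - i + (2 * x + a) := by
  obtain ⟨η, κ₁, h₁, κ₂, h₂, k', hk', e₁, e₂, e₃⟩ := h
  simp only [rep, mul_one] at e₁ e₂ e₃
  have hκ₁ := mem_GLInt_two.1 h₁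
  have hκ₂ := mem_GLInt_two.1 h₂
  have hd1 : ‖η.1.1.1.det‖ = (ℓ : ℝ) ^ (-(2 * x + a)) := by
    rw [← norm_det_diagPow, e₁, Units.val_mul, det_mul, norm_mul, hκ₁.2, mul_one]
  have hd2 : ‖η.1.2.1.det‖ = (ℓ : ℝ) ^ (-(2 * y + b)) := by
    rw [← norm_det_lowPow _ _ ((ℓ : ℚ_[ℓ]) ^ i'), e₂, Units.val_mul, det_mul, norm_mul, hκ₂.2,
      mul_one]
  have hxy : 2 * x + a = 2 * y + b := by
    have := hd1.symm.trans ((congrArg norm (H_det_eq η)).trans hd2)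
    rw [zpow_eq_iff] at this
    omega
  have hm : (m' : ℤ) = m - i + (2 * x + a) := by
    have := congrArg (fun g => ‖simil g‖) e₃
    simp only [simil_mul, norm_mul, simil_eta, simil_iotaGSp4, norm_simil_of_mem hk,
      norm_simil_of_mem hk', norm_simil_baseElt, hd1, mul_one, one_mul] at this
    rw [← zpow_natCast, norm_ell_zpow, ← zpow_add₀ (by
      exact_mod_cast (Fact.out : ℓ.Prime).ne_zero), zpow_eq_iff] at this
    omega
  -- X is the third component after the GL₂ components of the standard triple are moved to 1. It
  -- differs from `baseElt m i` only by integral invertible factors on both sides, so maximal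
  -- entries and minors can be compared.
  set X : Matrix (Fin 4) (Fin 4) ℚ_[ℓ] := blockMat ℚ_[ℓ]
    (((diagPow x a : GL (Fin 2) ℚ_[ℓ])⁻¹).1, ((lowPow y b ((ℓ : ℚ_[ℓ]) ^ i'))⁻¹).1) *
      (eta m').1.1 with hX
  have hXgl : X =
      (blockGL ℚ_[ℓ] (κ₁⁻¹, κ₂⁻¹) * k.1 * (baseElt m i).1 * k'.1 : GL (Fin 4) ℚ_[ℓ]).1 := by
    have e : (blockGL ℚ_[ℓ] ((diagPow x a)⁻¹, (lowPow y b ((ℓ : ℚ_[ℓ]) ^ i'))⁻¹) * (eta m').1 :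
        GL (Fin 4) ℚ_[ℓ]) = blockGL ℚ_[ℓ] (κ₁⁻¹, κ₂⁻¹) * k.1 * (baseElt m i).1 * k'.1 := by
      have e' : ((eta m').1 : GL (Fin 4) ℚ_[ℓ]) =
          blockGL ℚ_[ℓ] (η.1.1, η.1.2) * (k.1 * (baseElt m i).1) * k'.1 := congrArg Subtype.val e₃
      have e'' : (((diagPow x a)⁻¹, (lowPow y b ((ℓ : ℚ_[ℓ]) ^ i'))⁻¹) :
          GL (Fin 2) ℚ_[ℓ] × GL (Fin 2) ℚ_[ℓ]) = (κ₁⁻¹, κ₂⁻¹) * (η.1.1, η.1.2)⁻¹ := by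
        rw [e₁, e₂, _root_.mul_inv_rev, _root_.mul_inv_rev]; rfl
      rw [e', e'', map_mul, map_inv]
      simp only [mul_assoc, inv_mul_cancel_left]
    rw [← e]; rfl
  have hA : ∀ i j, ‖(blockGL ℚ_[ℓ] (κ₁⁻¹, κ₂⁻¹) * k.1 : GL (Fin 4) ℚ_[ℓ]).1 i j‖ ≤ 1 := by
    intro i j
    have := norm_mul_apply_le zero_le_one zero_le_one
      (blockMat_norm_le zero_le_one (mem_GLInt_two.1 (inv_mem h₁)).1
        (mem_GLInt_two.1 (inv_mem h₂)).1) (norm_apply_le_of_mem_GSp4Int hk) i j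
    rw [mul_one] at this
    exact this
  have hA' : ∀ i j, ‖((blockGL ℚ_[ℓ] (κ₁⁻¹, κ₂⁻¹) * k.1 : GL (Fin 4) ℚ_[ℓ])⁻¹).1 i j‖ ≤ 1 := by
    intro i j
    have := norm_mul_apply_le zero_le_one zero_le_one
      (norm_apply_le_of_mem_GSp4Int (inv_mem hk)) (blockMat_norm_le zero_le_one hκ₁.1 hκ₂.1) i j
    rw [mul_one] at this
    rw [_root_.mul_inv_rev, ← map_inv]
    simp only [Prod.inv_mk, inv_inv]
    exact this
  set A : GL (Fin 4) ℚ_[ℓ] := blockGL ℚ_[ℓ] (κ₁⁻¹, κ₂⁻¹) * k.1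
  have hB := norm_apply_le_of_mem_GSp4Int hk'
  have hB' := norm_apply_le_of_mem_GSp4Int (inv_mem hk')
  have hXmul : X = A.1 * (baseElt m i).1.1 * k'.1.1 := hXgl
  have hXle : ∀ r s, ‖X r s‖ ≤ (ℓ : ℝ) ^ (i : ℤ) := by
    intro r s
    rw [hXmul]
    have h1 : ∀ r s : Fin 4, ‖(A.1 * (baseElt m i).1.1 : Matrix (Fin 4) (Fin 4) ℚ_[ℓ]) r s‖ ≤
        1 * (ℓ : ℝ) ^ (i : ℤ) :=
      norm_mul_apply_le zero_le_one (by positivity) hA (baseElt_norm_le m i)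
    simpa using norm_mul_apply_le (by positivity) zero_le_one h1 hB r s
  have hXminor : MinorLe X ((ℓ : ℝ) ^ (i : ℤ)) := by
    rw [hXmul]; exact ((baseElt_minorLe hi).mul_left hA).mul_right hB
  have hX' : X = blockMat ℚ_[ℓ] (!![(ℓ : ℚ_[ℓ]) ^ (-(x + a)), 0; 0, (ℓ : ℚ_[ℓ]) ^ (-x)],
      !![(ℓ : ℚ_[ℓ]) ^ (-y), 0; -((ℓ : ℚ_[ℓ]) ^ i' * (ℓ : ℚ_[ℓ]) ^ (-(y + b))),
        (ℓ : ℚ_[ℓ]) ^ (-(y + b))]) * (eta m').1.1 := by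
    rw [hX, diagPow_inv_val, lowPow_inv_val]
  have x00 : X 0 0 = (ℓ : ℚ_[ℓ]) ^ (-(x + a)) := by
    rw [hX', eta_val]; simp [blockMat, Matrix.mul_apply, Fin.sum_univ_four]
  have x01 : X 0 1 = 0 := by
    rw [hX', eta_val]; simp [blockMat, Matrix.mul_apply, Fin.sum_univ_four]
  have x20 : X 2 0 = (ℓ : ℚ_[ℓ]) ^ (-(y + b)) := by
    rw [hX', eta_val]; simp [blockMat, Matrix.mul_apply, Fin.sum_univ_four]
  have x21 : X 2 1 = -(ℓ : ℚ_[ℓ]) ^ ((i' : ℤ) - (y + b)) := by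
    rw [hX', eta_val, sub_eq_add_neg, zpow_add₀ ell_ne_zero, zpow_natCast]
    simp [blockMat, Matrix.mul_apply, Fin.sum_univ_four]
  have x31 : X 3 1 = (ℓ : ℚ_[ℓ]) ^ (-x) := by
    rw [hX', eta_val]; simp [blockMat, Matrix.mul_apply, Fin.sum_univ_four]
  have c1 : x + a ≤ i := by
    have := hXle 0 0
    rwa [x00, norm_ell_zpow, neg_neg, zpow_le_iff] at this
  have c2 : y + b ≤ i := by
    have := hXle 2 0
    rwa [x20, norm_ell_zpow, neg_neg, zpow_le_iff] at this
  have c3 : 2 * x + a ≤ i := by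
    have := hXminor 0 3 0 1
    rw [x00, x01, x31, zero_mul, sub_zero, ← zpow_add₀ ell_ne_zero, norm_ell_zpow,
      zpow_le_iff] at this
    omega
  have c4 : (x + a) + (y + b) - i' ≤ i := by
    have := hXminor 0 2 0 1
    rw [x00, x01, x21, zero_mul, sub_zero, mul_neg, norm_neg, ← zpow_add₀ ell_ne_zero,
      norm_ell_zpow, zpow_le_iff] at this
    omega
  refine ⟨c1, c2, ?_, c3, c4, hxy, hm⟩
  -- If both exponents were below i, all entries of X, hence of `baseElt m i`, would be at most
  -- ℓ^(i-1) in norm; but its corner entry has norm ℓ^i.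
  by_contra hne
  push Not at hne
  have hC : (0 : ℝ) ≤ (ℓ : ℝ) ^ ((i : ℤ) - 1) := by positivity
  have hz : ∀ n : ℤ, n ≤ i - 1 → ‖(ℓ : ℚ_[ℓ]) ^ (-n)‖ ≤ (ℓ : ℝ) ^ ((i : ℤ) - 1) := fun n hn => by
    rw [norm_ell_zpow, neg_neg, zpow_le_iff]; exact hn
  have hsmall : ∀ r s, ‖X r s‖ ≤ (ℓ : ℝ) ^ ((i : ℤ) - 1) := by
    have z1 := hz (x + a) (by omega)
    have z2 := hz x (by omega)
    have z3 := hz y (by omega)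
    have z4 := hz (y + b) (by omega)
    have z5 : ‖(ℓ : ℚ_[ℓ]) ^ i' * (ℓ : ℚ_[ℓ]) ^ (-(y + b))‖ ≤ (ℓ : ℝ) ^ ((i : ℤ) - 1) := by
      rw [norm_mul]
      exact (mul_le_of_le_one_left (norm_nonneg _) (norm_ell_pow_le i')).trans z4
    intro r s
    rw [hX', ← mul_one ((ℓ : ℝ) ^ ((i : ℤ) - 1))]
    refine norm_mul_apply_le hC zero_le_one (blockMat_norm_le hC (fun i' j' => ?_)
      fun i' j' => ?_) (eta_norm_le m') r s
    · fin_cases i' <;> fin_cases j'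
      · exact z1
      · simpa using hC
      · simpa using hC
      · exact z2
    · fin_cases i' <;> fin_cases j'
      · exact z3
      · simpa using hC
      · rw [← norm_neg] at z5; exact z5
      · exact z4
  have hback : (baseElt m i).1.1 = (A⁻¹).1 * X * (k'⁻¹).1.1 := by
    have : (baseElt m i).1 = A⁻¹ * (A * (baseElt m i).1 * k'.1) * (k'⁻¹).1 := by
      simp [mul_assoc]
    rw [hXmul]
    exact congrArg Units.val this
  have h1 : ∀ r s : Fin 4, ‖((A⁻¹).1 * X : Matrix (Fin 4) (Fin 4) ℚ_[ℓ]) r s‖ ≤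
      1 * (ℓ : ℝ) ^ ((i : ℤ) - 1) :=
    norm_mul_apply_le zero_le_one hC hA' hsmall
  have h2 := norm_mul_apply_le (by positivity) zero_le_one h1 hB' 0 0
  rw [← hback, baseElt_apply_zero, one_mul, mul_one, zpow_le_iff] at h2
  omega

/-- The values of Φ along the GSp₄(ℤ_ℓ)-orbit of `baseElt m i` have mean zero. They are either the
value sought or zero by induction, since every other triple met reduces to smaller diagonal ones. -/
theorem vanish_diag {m i : ℕ} (hi : i ≤ m) (ih : ∀ m' j, j ≤ m' →
    (m' + j < m + i ∨ (m' + j = m + i ∧ m' < m)) → Vanish ℓ j j m' j) : Vanish ℓ i i m i := by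
  suffices h : ∀ Φ : GL (Fin 2) ℚ_[ℓ] × GL (Fin 2) ℚ_[ℓ] × GSp4 ℚ_[ℓ] → ℂ, Admissible Φ →
      Φ (rep 0 0 i i m ((ℓ : ℚ_[ℓ]) ^ i)) = 0 by
    intro Φ hΦ x y
    have hcomm : ∀ (n : ℤ) (g : GL (Fin 2) ℚ_[ℓ]), diagPow n 0 * g = g * diagPow n 0 := by
      intro n g
      apply gl2_ext <;> simp [diagPow, Matrix.mul_apply, Fin.sum_univ_two, mul_comm]
    have := h _ (hΦ.translate (hcomm x) (hcomm y))
    rw [← this]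
    simp only [rep]
    congr 2
    · apply gl2_ext <;> simp [diagPow, Matrix.mul_apply, Fin.sum_univ_two]
      rw [zpow_add_nat]; ring
    · congr 1
      apply gl2_ext <;> simp [diagPow, lowPow, Matrix.mul_apply, Fin.sum_univ_two]
      rw [zpow_add_nat]; ring
  intro Φ hΦ
  have hc := hΦ.continuous
  refine eq_zero_of_mean_eq_zero (F := fun k : GSp4Int ℓ => Φ (1, 1, k.1 * baseElt m i))
    (hc.comp (continuous_const.prodMk (continuous_const.prodMk
      (continuous_subtype_val.mul continuous_const)))) (k₀ := 1) ?_ ?_ (hΦ.mean_eq_zero _ _ _)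
  · rintro ⟨k, hk⟩
    obtain ⟨x, y, a, b, m', i', hi', hr⟩ := exists_rel_rep (1, 1, k * baseElt m i)
    obtain ⟨c1, c2, c3, c4, c5, c6, c7⟩ := constraints_of_rel hi hk hr
    simp only
    rw [hΦ.rel _ _ hr]
    by_cases ht : x = 0 ∧ y = 0 ∧ a = i ∧ b = i ∧ m' = m ∧ i' = i
    · obtain ⟨rfl, rfl, rfl, rfl, rfl, rfl⟩ := ht
      exact Or.inr rfl
    · left
      refine vanish_of_diag (C := min a (min b m')) (fun j hj hj' => ih m' j hj' ?_) a b i' hi'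
        le_rfl Φ hΦ x y
      -- Put s = 2x + a. Then m' = m - i + s and a ≤ 2i - s, so m' + j ≤ m + i, while m' ≤ m.
      -- Equality in both forces x = y = 0 and a = b = i, and the minor bound then forces i' = i:
      -- the excluded triple.
      omega
  · simp only [OneMemClass.coe_one, one_mul]
    exact (hΦ.rel _ _ (rel_baseElt m i)).symm

/-- An admissible function vanishes. -/
theorem Admissible.eq_zero {Φ : GL (Fin 2) ℚ_[ℓ] × GL (Fin 2) ℚ_[ℓ] × GSp4 ℚ_[ℓ] → ℂ}
    (hΦ : Admissible Φ) (t : GL (Fin 2) ℚ_[ℓ] × GL (Fin 2) ℚ_[ℓ] × GSp4 ℚ_[ℓ]) : Φ t = 0 := by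
  -- Lexicographic induction, on m + i and then on m.
  have key : ∀ N M m i : ℕ, m + i = N → m = M → i ≤ m → Vanish ℓ i i m i := by
    intro N
    induction N using Nat.strong_induction_on with
    | _ N ihN =>
      intro M
      induction M using Nat.strong_induction_on with
      | _ M ihM =>
        rintro m i rfl rfl hi
        refine vanish_diag hi fun m' j hj h => ?_
        rcases h with h | ⟨h, h'⟩
        · exact ihN _ h _ m' j rfl rfl hj
        · exact ihM _ h' m' j h rfl hj
  obtain ⟨x, y, a, b, m, i, hi, hr⟩ := exists_rel_rep t
  rw [hΦ.rel _ _ hr]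
  exact vanish_of_diag (C := m) (fun j _ hj => key _ _ m j rfl rfl hj) a b i hi (by omega) Φ hΦ x y

end Base

end

section

/-! ### Averages of vector-valued functions, and decomposition into characteristic functions. -/

section VectorMean

variable {C : Type*} [Group C] [TopologicalSpace C] [IsTopologicalGroup C] [CompactSpace C]

/-- Unimodularity of compact groups: integrate F(j⁻¹k) in both orders. -/
theorem mean_inv {F : C → ℂ} (hF : Continuous F) : mean (fun k => F k⁻¹) = mean F := by
  have h := mean_swap (F := fun j k : C => F (j⁻¹ * k)) (hF.comp (by fun_prop))
  have h1 : ∀ j : C, mean (fun k => F (j⁻¹ * k)) = mean F := fun j => mean_mul_left _ _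
  have h2 : ∀ k : C, mean (fun j => F (j⁻¹ * k)) = mean (fun j => F j⁻¹) := fun k => by
    rw [← mean_mul_left k⁻¹ (fun j => F j⁻¹)]; simp
  simp only [h1, h2, mean_const] at h
  exact h.symm

theorem mean_mul_right {F : C → ℂ} (hF : Continuous F) (a : C) :
    mean (fun k => F (k * a)) = mean F := by
  rw [← mean_inv (F := fun k => F (k * a)) (hF.comp (by fun_prop)), ← mean_inv hF,
    ← mean_mul_left a⁻¹ (fun k => F k⁻¹)]
  simp

theorem mean_sum {ι : Type*} (s : Finset ι) {F : ι → C → ℂ} (hF : ∀ i, Continuous (F i)) :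
    mean (fun k => ∑ i ∈ s, F i k) = ∑ i ∈ s, mean (F i) := by
  classical
  induction s using Finset.induction_on with
  | empty => simpa using mean_const (C := C) 0
  | insert i s hi ih =>
    simp only [Finset.sum_insert hi]
    rw [mean_add (hF i) (continuous_finsetSum _ fun i _ => hF i), ih]

variable {W : Type*} [AddCommGroup W] [Module ℂ W]

open Classical in
/-- The mean of a locally constant vector valued function on a compact group. -/
def vmean (F : C → W) : W := ∑ᶠ w : W, mean (fun k => if F k = w then 1 else 0) • w

/-- Compactness makes the range finite, so the vector mean is a finite sum and commutes with
functionals, with no topology on W. -/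
theorem map_vmean {F : C → W} (hF : IsLocallyConstant F) (μ : W →ₗ[ℂ] ℂ) :
    μ (vmean F) = mean (fun k => μ (F k)) := by
  classical
  have hfin := hF.range_finite
  have hc : ∀ w : W, Continuous (fun k => if F k = w then (1 : ℂ) else 0) := fun w =>
    (hF.comp (fun v => if v = w then (1 : ℂ) else 0)).continuous
  have hs : (Function.support fun w : W => mean (fun k => if F k = w then 1 else 0) • w) ⊆
      hfin.toFinset := by
    intro w hw
    by_contra hne
    have : ∀ k, F k ≠ w := fun k hk => hne (by simp [← hk])
    exact hw (by simp [this, mean_const])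
  have e : ∀ k, μ (F k) = ∑ w ∈ hfin.toFinset, μ w * (if F k = w then 1 else 0) := by
    intro k
    rw [Finset.sum_eq_single (F k)] <;> simp +contextual [eq_comm]
  rw [vmean, finsum_eq_sum_of_support_subset _ hs, map_sum]
  simp only [e]
  rw [mean_sum (F := fun w k => μ w * (if F k = w then 1 else 0)) _
    fun w => continuous_const.mul (hc w)]
  refine Finset.sum_congr rfl fun w _ => ?_
  rw [map_smul, mean_const_mul, smul_eq_mul, mul_comm]

theorem isLocallyConstant_of_mul_right {G : Type*} [Group G] [TopologicalSpace G]
    [IsTopologicalGroup G] {X : Type*} (K : Subgroup G) [hK : IsCompactOpen K] {f : G → X}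
    (h : ∀ k ∈ K, ∀ x, f (x * k) = f x) : IsLocallyConstant f := by
  rw [IsLocallyConstant.iff_exists_open]
  intro x
  refine ⟨(fun y => x⁻¹ * y) ⁻¹' K, hK.isOpen.preimage (by fun_prop), by simp [K.one_mem], ?_⟩
  intro y hy
  simpa using h _ hy x

end VectorMean

/-- A compactly supported function constant on the open classes of a setoid is a combination of
characteristic functions of classes. -/
theorem exists_eq_sum_indicator {X : Type*} [TopologicalSpace X] (r : Setoid X)
    (hr : ∀ x, IsOpen {y | r x y}) {f : X → ℂ} (hf : HasCompactSupport f)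
    (hc : ∀ x y, r x y → f x = f y) :
    ∃ T : Finset X, (∀ x ∈ T, f x ≠ 0) ∧
      f = ∑ x ∈ T, f x • {y | r x y}.indicator (1 : X → ℂ) := by
  classical
  obtain ⟨t, ht⟩ := hf.isCompact.elim_finite_subcover (fun x => {y | r x y}) hr
    fun x _ => Set.mem_iUnion.2 ⟨x, r.refl x⟩
  let q : X → Quotient r := Quotient.mk r
  let T := ((t.filter fun x => f x ≠ 0).image q).image Quotient.out
  have hT : ∀ x ∈ T, f x ≠ 0 := by
    intro x hx
    simp only [T, Finset.mem_image, Finset.mem_filter] at hx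
    obtain ⟨_, ⟨z, ⟨-, hz⟩, rfl⟩, rfl⟩ := hx
    rwa [hc _ z (Quotient.mk_out z)]
  have hinj : ∀ x ∈ T, ∀ y ∈ T, r x y → x = y := by
    intro x hx y hy hxy
    simp only [T, Finset.mem_image] at hx hy
    obtain ⟨a, -, rfl⟩ := hx
    obtain ⟨b, -, rfl⟩ := hy
    have := Quotient.sound hxy
    rw [Quotient.out_eq, Quotient.out_eq] at this
    rw [this]
  refine ⟨T, hT, ?_⟩
  ext y
  simp only [Finset.sum_apply, Pi.smul_apply, smul_eq_mul]
  by_cases hy : f y = 0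
  · rw [hy]
    refine (Finset.sum_eq_zero fun x hx => ?_).symm
    rw [Set.indicator_of_notMem, mul_zero]
    exact fun h => hT x hx ((hc _ _ h).trans hy)
  · obtain ⟨x, hx⟩ := Set.mem_iUnion.1 (ht (subset_tsupport _ hy))
    obtain ⟨hxt, hxy⟩ := Set.mem_iUnion.1 hx
    have hxy : r x y := hxy
    have hmem : (q x).out ∈ T := Finset.mem_image_of_mem _ (Finset.mem_image_of_mem _
      (Finset.mem_filter.2 ⟨hxt, by rwa [hc _ _ hxy]⟩))
    have hrel : r (q x).out y := r.trans (Quotient.mk_out x) hxy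
    rw [Finset.sum_eq_single_of_mem _ hmem]
    · rw [Set.indicator_of_mem (by exact hrel), hc _ _ hrel]; simp
    · intro z hz hne
      rw [Set.indicator_of_notMem, mul_zero]
      exact fun h => hne (hinj _ hz _ hmem (r.trans h (r.symm hrel)))

/-! ### Characteristic functions of cosets and their orbit averages. -/

section Coset

variable {G : Type*} [Group G] [TopologicalSpace G] [IsTopologicalGroup G]

/-- The characteristic function of `g K`. -/
def chCoset (K : Subgroup G) [IsCompactOpen K] (g : G) : CcBi ⊥ K :=
  leftTranslation (ContinuousMonoidHom.id G) K g (ch ⊥ K bot_le)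

variable {K : Subgroup G} [IsCompactOpen K]

theorem chCoset_apply (g x : G) :
    (chCoset K g).1 x = (K : Set G).indicator 1 (g⁻¹ * x) := rfl

theorem chCoset_mul_apply (a g x : G) : (chCoset K (a * g)).1 x = (chCoset K g).1 (a⁻¹ * x) := by
  simp [chCoset_apply, mul_assoc]

theorem chCoset_mul_mem (g : G) {k : G} (hk : k ∈ K) : chCoset K (g * k) = chCoset K g := by
  ext x
  rw [chCoset_apply, chCoset_apply, mul_inv_rev, mul_assoc]
  by_cases hx : g⁻¹ * x ∈ K
  · rw [Set.indicator_of_mem (by exact mul_mem (inv_mem hk) hx), Set.indicator_of_mem hx]; rfl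
  · rw [Set.indicator_of_notMem, Set.indicator_of_notMem hx]
    exact fun h => hx ((K.mul_mem_cancel_left (inv_mem hk)).1 h)

theorem isLocallyConstant_chCoset : IsLocallyConstant (chCoset K) :=
  isLocallyConstant_of_mul_right K fun _ hk g => chCoset_mul_mem g hk

theorem leftTranslation_chCoset {A : Type*} [Group A] [TopologicalSpace A] [IsTopologicalGroup A]
    (ι : A →ₜ* G) (a : A) (g : G) :
    leftTranslation ι K a (chCoset K g) = chCoset K (ι a * g) := by
  ext x
  rw [chCoset_mul_apply]; rfl

theorem exists_eq_sum_chCoset {f : G → ℂ} (hf : HasCompactSupport f)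
    (hr : ∀ k ∈ K, ∀ x, f (x * k) = f x) :
    ∃ T : Finset G, f = ∑ x ∈ T, f x • (chCoset K x).1 := by
  have hK := ‹IsCompactOpen K›
  obtain ⟨T, -, hT⟩ := exists_eq_sum_indicator (QuotientGroup.leftRel K) (fun x => by
    have : {y | QuotientGroup.leftRel K x y} = (fun y => x⁻¹ * y) ⁻¹' K := by
      ext y; exact QuotientGroup.leftRel_apply
    rw [this]
    exact hK.isOpen.preimage (by fun_prop)) hf fun x y hxy => by
      have := hr _ (QuotientGroup.leftRel_apply.1 hxy) x
      simpa using this.symm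
  refine ⟨T, hT.trans (Finset.sum_congr rfl fun x _ => ?_)⟩
  congr 1
  ext y
  rw [chCoset_apply]
  by_cases hy : x⁻¹ * y ∈ K
  · rw [Set.indicator_of_mem (by exact QuotientGroup.leftRel_apply.2 hy),
      Set.indicator_of_mem hy]; rfl
  · rw [Set.indicator_of_notMem (s := {y | QuotientGroup.leftRel K x y})
      (fun h => hy (QuotientGroup.leftRel_apply.1 h)), Set.indicator_of_notMem hy]

/-- Evaluation at a point. -/
def evalAt (L K : Subgroup G) (x : G) : CcBi L K →ₗ[ℂ] ℂ where
  toFun f := f.1 x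
  map_add' _ _ := rfl
  map_smul' _ _ := rfl

theorem evalAt_apply {L : Subgroup G} (x : G) (f : CcBi L K) : evalAt L K x f = f.1 x := rfl

/-- A left `K`-invariant function is in the Hecke orbit of the characteristic function of `K`. -/
theorem exists_rightAct_ch_eq {L : Subgroup G} (hLK : L ≤ K) (f : CcBi L K)
    (hf : ∀ k ∈ K, ∀ x, f.1 (k * x) = f.1 x) : ∃ θ : CcBi K K, rightAct θ (ch L K hLK) = f := by
  have hl : ∀ k ∈ K, ∀ x, f.1 (k * x)⁻¹ = f.1 x⁻¹ := fun k hk x => by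
    rw [mul_inv_rev]; exact CcBi.right f (inv_mem hk) _
  have hr : ∀ k ∈ K, ∀ x, f.1 (x * k)⁻¹ = f.1 x⁻¹ := fun k hk x => by
    rw [mul_inv_rev]; exact hf _ (inv_mem hk) _
  -- Since ch(xg) is supported on g ∈ x⁻¹K, the operator θ(g) = f(g⁻¹) takes ch to f.
  refine ⟨⟨fun x => f.1 x⁻¹, isLocallyConstant_of_right hr,
    (CcBi.compact f).comp_homeomorph (Homeomorph.inv G), hl, hr⟩, ?_⟩
  ext x
  rw [rightAct_apply, ← haarInt_mul_left K x⁻¹]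
  have : ∀ g, f.1 (x⁻¹ * g)⁻¹ * (ch L K hLK).1 (x * (x⁻¹ * g)) =
      f.1 x * (K : Set G).indicator 1 g := by
    intro g
    rw [mul_inv_cancel_left, mul_inv_rev, inv_inv]
    by_cases hg : g ∈ K
    · rw [hf _ (inv_mem hg)]; rfl
    · simp [ch, hg]
  simp only [this]
  rw [haarInt_const_mul, haarInt_indicator, mul_one]

variable {A : Type*} [Group A] [TopologicalSpace A] [IsTopologicalGroup A] (ι : A →ₜ* G)
  {B : Subgroup A} [IsCompactOpen B]

theorem isLocallyConstant_chCoset_comp (g : G) :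
    IsLocallyConstant (fun b : B => chCoset K (ι b * g)) := by
  have hι : Continuous ι := ι.continuous_toFun
  exact isLocallyConstant_chCoset.comp_continuous
    ((hι.comp continuous_subtype_val).mul continuous_const)

theorem vmean_chCoset_apply (g x : G) : (vmean (fun b : B => chCoset K (ι b * g))).1 x =
    mean (fun b : B => (chCoset K (ι b * g)).1 x) :=
  map_vmean (isLocallyConstant_chCoset_comp ι g) (evalAt ⊥ K x)

/-- The mean over `B` of the left translates of the characteristic function of `g K`. -/
def orbitMean {L : Subgroup G} (hL : L = B.map (ι : A →* G)) (g : G) : CcBi L K :=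
  ⟨(vmean (fun b : B => chCoset K (ι b * g))).1, (vmean (fun b : B => chCoset K (ι b * g))).2.1,
    CcBi.compact _, by
      subst hL
      rintro _ ⟨b, hb, rfl⟩ x
      rw [vmean_chCoset_apply, vmean_chCoset_apply,
        ← mean_mul_left (⟨b, hb⟩ : B) (fun b : B => (chCoset K (ι b * g)).1 (_ * x))]
      congr 1
      funext b'
      have : ι ((⟨b, hb⟩ * b' : B) : A) = ι b * ι b' := map_mul ι b b'
      rw [this, mul_assoc, chCoset_mul_apply]
      simp, fun k hk x => CcBi.right _ hk x⟩

variable {ι} {L : Subgroup G} (hL : L = B.map (ι : A →* G))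

theorem orbitMean_apply (g x : G) : (orbitMean ι (K := K) hL g).1 x =
    mean (fun b : B => (chCoset K (ι b * g)).1 x) := vmean_chCoset_apply ι g x

theorem orbitMean_mul_right (g : G) {k : G} (hk : k ∈ K) :
    orbitMean ι (K := K) hL (g * k) = orbitMean ι hL g := by
  ext x
  simp only [orbitMean_apply, ← mul_assoc, chCoset_mul_mem _ hk]

theorem orbitMean_mul_left (g : G) {b : A} (hb : b ∈ B) :
    orbitMean ι (K := K) hL (ι b * g) = orbitMean ι hL g := by
  ext x
  rw [orbitMean_apply, orbitMean_apply, ← mean_mul_right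
    (F := fun b : B => (chCoset K (ι b * g)).1 x)
    (((isLocallyConstant_chCoset_comp ι g).comp (evalAt ⊥ K x)).continuous) (⟨b, hb⟩ : B)]
  congr 1
  funext b'
  have : ι ((b' * ⟨b, hb⟩ : B) : A) = ι b' * ι b := map_mul ι b'.1 b
  rw [this, mul_assoc]

theorem isLocallyConstant_orbitMean : IsLocallyConstant (orbitMean ι (K := K) hL) :=
  isLocallyConstant_of_mul_right K fun _ hk g => orbitMean_mul_right hL g hk

/-- The functions `orbitMean` span. -/
theorem eq_zero_of_orbitMean_eq_zero (μ : CcBi L K →ₗ[ℂ] ℂ)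
    (h : ∀ g, μ (orbitMean ι hL g) = 0) : μ = 0 := by
  ext f
  obtain ⟨T, hT⟩ := exists_eq_sum_chCoset (CcBi.compact f) (K := K) fun k hk x => CcBi.right f hk x
  -- Expand f in cosets and average over B: f is left invariant and equals its own average, while
  -- each coset function becomes an orbit mean.
  have : f = ∑ x ∈ T, f.1 x • orbitMean ι hL x := by
    ext y
    have h1 : ∀ b : B, f.1 y = ∑ x ∈ T, f.1 x * (chCoset K (ι b * x)).1 y := by
      rintro ⟨b, hb⟩
      have hbL : (ι b)⁻¹ ∈ L := by
        rw [hL]; exact ⟨b⁻¹, B.inv_mem hb, by simp⟩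
      rw [← CcBi.left f hbL y]
      conv_lhs => rw [hT]
      simp [chCoset_mul_apply]
    have h2 := mean_const (C := B) (f.1 y)
    have hc : ∀ x, Continuous (fun b : B => f.1 x * (chCoset K (ι b * x)).1 y) := fun x =>
      continuous_const.mul
        (((isLocallyConstant_chCoset_comp ι x).comp (evalAt ⊥ K y)).continuous)
    have h3 : mean (fun b : B => f.1 y) =
        mean (fun b : B => ∑ x ∈ T, f.1 x * (chCoset K (ι b * x)).1 y) :=
      congrArg mean (funext h1)
    rw [mean_sum _ hc, h2] at h3
    rw [h3]
    simp [mean_const_mul, orbitMean_apply]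
  rw [this]
  simp [h]

end Coset

end

section

/-! ### Averaging over K as a product of Hecke operators. -/

section General

variable {G : Type*} [Group G] [TopologicalSpace G] [IsTopologicalGroup G]
  {K : Subgroup G} [hK : IsCompactOpen K]
  {A : Type*} [Group A] [TopologicalSpace A] [IsTopologicalGroup A] {ι : A →ₜ* G}
  {B : Subgroup A} [hB : IsCompactOpen B] {L : Subgroup G} (hL : L = B.map (ι : A →* G))

/-- A bi-`K`-invariant function as a left `L`-invariant one, for `L ≤ K`. -/
def CcBi.restrictLeft (hLK : L ≤ K) (f : CcBi K K) : CcBi L K :=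
  ⟨f.1, f.2.1, CcBi.compact f, fun _ hl x => CcBi.left f (hLK hl) x,
    fun _ hk x => CcBi.right f hk x⟩

/-- Averaging ch(b a k g K) over k first gives a left K-invariant function β translated by ba. As
ι(B) ≤ K, integrating translates of β over the coset baB yields that same translate, so the mean
over b is the Hecke action of the averaged ch(baB) on β. -/
theorem vmean_orbitMean (hLK : L ≤ K) (a : A) (g : G) :
    vmean (fun k : K => orbitMean ι (K := K) hL (ι a * (k * g))) =
      leftAct ι hL (orbitMean (K := B) (ContinuousMonoidHom.id A) (eq_map_id B) a)
        (CcBi.restrictLeft hLK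
          (orbitMean (K := K) (ContinuousMonoidHom.id G) (eq_map_id K) g)) := by
  have hι : Continuous ι := ι.continuous_toFun
  ext x
  set β := orbitMean (K := K) (ContinuousMonoidHom.id G) (eq_map_id K) g with hβ
  have hβ' : ∀ y, (CcBi.restrictLeft hLK β).1 y = β.1 y := fun _ => rfl
  have hl := map_vmean (F := fun k : K => orbitMean ι (K := K) hL (ι a * (k * g)))
    ((isLocallyConstant_orbitMean hL).comp_continuous (by fun_prop)) (evalAt L K x)
  have hL' : (vmean (fun k : K => orbitMean ι (K := K) hL (ι a * (k * g)))).1 x =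
      mean (fun k : K => mean (fun b : B => (chCoset K (ι b * (ι a * (k * g)))).1 x)) := by
    rw [← evalAt_apply, hl]
    simp only [evalAt_apply, orbitMean_apply]
  have hR : (leftAct ι hL (orbitMean (K := B) (ContinuousMonoidHom.id A) (eq_map_id B) a)
      (CcBi.restrictLeft hLK β)).1 x = mean (fun b : B => β.1 ((ι (b * a))⁻¹ * x)) := by
    rw [leftAct_apply]
    calc _ = haarInt B (fun h => mean (fun b : B =>
          (chCoset B ((b : A) * a)).1 h * β.1 ((ι h)⁻¹ * x))) := by
          congr 1
          funext h
          rw [orbitMean_apply, hβ', mul_comm, ← mean_const_mul]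
          congr 1
          funext b
          exact mul_comm _ _
      _ = mean (fun b : B => haarInt B (fun h =>
          (chCoset B ((b : A) * a)).1 h * β.1 ((ι h)⁻¹ * x))) := by
          refine (mean_haarInt_swap B (F := fun (b : B) h =>
            (chCoset B ((b : A) * a)).1 h * β.1 ((ι h)⁻¹ * x)) ?_
            (hB.isCompact.mul ((isCompact_singleton (x := a)).mul hB.isCompact)) ?_).symm
          · refine Continuous.mul ?_ ((CcBi.continuous β).comp (by fun_prop))
            have h1 : Continuous (fun p : B × A => (ch ⊥ B bot_le).1 ((p.1.1 * a)⁻¹ * p.2)) :=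
              (CcBi.continuous (ch ⊥ B bot_le)).comp (by fun_prop)
            exact h1
          · intro b h hne
            have h1 : (chCoset B ((b : A) * a)).1 h ≠ 0 := left_ne_zero_of_mul hne
            have h2 : ((b : A) * a)⁻¹ * h ∈ B := by
              by_contra hn
              exact h1 (by rw [chCoset_apply, Set.indicator_of_notMem hn])
            exact ⟨b, b.2, a * (((b : A) * a)⁻¹ * h), ⟨a, rfl, _, h2, rfl⟩, by
              simp [mul_assoc]⟩
      _ = _ := by
          congr 1
          funext b
          rw [← haarInt_mul_left B ((b : A) * a)]
          have : ∀ h, (chCoset B ((b : A) * a)).1 (b * a * h) * β.1 ((ι (b * a * h))⁻¹ * x) =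
              β.1 ((ι (b * a))⁻¹ * x) * (B : Set A).indicator 1 h := by
            intro h
            rw [chCoset_apply, inv_mul_cancel_left]
            by_cases hh : h ∈ B
            · have hk : (ι h)⁻¹ ∈ K := hLK (by
                rw [hL]; exact ⟨h⁻¹, B.inv_mem hh, by simp⟩)
              rw [map_mul, mul_inv_rev, mul_assoc, CcBi.left β hk, mul_comm]
            · simp [hh]
          simp only [this]
          rw [haarInt_const_mul, haarInt_indicator, mul_one]
  rw [hL', hR, mean_swap (F := fun (k : K) (b : B) => (chCoset K (ι b * (ι a * (k * g)))).1 x)]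
  · congr 1
    funext b
    rw [hβ, orbitMean_apply]
    congr 1
    funext k
    rw [← chCoset_mul_apply, map_mul, mul_assoc]
    rfl
  · refine (isLocallyConstant_chCoset.comp (evalAt ⊥ K x)).continuous.comp
      (g := _) (f := fun p : K × B => ι p.2 * (ι a * (p.1 * g))) ?_
    fun_prop

/-- The left K-invariant factor is itself a right Hecke translate of ch(K), so the average lies in
the two-sided Hecke orbit. -/
theorem mean_map_orbitMean (hLK : L ≤ K) (μ : CcBi L K →ₗ[ℂ] ℂ) (a : A) (g : G) :
    ∃ θ₁ θ₂, mean (fun k : K => μ (orbitMean ι hL (ι a * (k * g)))) =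
      μ (leftAct ι hL θ₁ (rightAct θ₂ (ch L K hLK))) := by
  obtain ⟨θ₂, hθ₂⟩ := exists_rightAct_ch_eq hLK (CcBi.restrictLeft hLK
    (orbitMean (K := K) (ContinuousMonoidHom.id _) (eq_map_id K) g))
    fun k hk x => CcBi.left (orbitMean (K := K) (ContinuousMonoidHom.id _) (eq_map_id K) g) hk x
  refine ⟨orbitMean (K := B) (ContinuousMonoidHom.id A) (eq_map_id B) a, θ₂, ?_⟩
  rw [hθ₂, ← vmean_orbitMean hL hLK]
  exact (map_vmean (F := fun k : K => orbitMean ι (K := K) hL (ι a * (k * g)))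
    ((isLocallyConstant_orbitMean hL).comp_continuous (by fun_prop)) μ).symm

end General

/-! ### Cyclicity of the module of functions on H(ℤ_ℓ) \ GSp₄(ℚ_ℓ) / GSp₄(ℤ_ℓ). -/

section Shintani

variable {ℓ : ℕ} [Fact ℓ.Prime]

open Classical in
/-- The function of a triple attached to a function on `H(ℤ_ℓ) \ GSp₄(ℚ_ℓ) / GSp₄(ℤ_ℓ)`. -/
def tripleFun (f : GSp4 ℚ_[ℓ] → ℂ) (t : GL (Fin 2) ℚ_[ℓ] × GL (Fin 2) ℚ_[ℓ] × GSp4 ℚ_[ℓ]) : ℂ :=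
  if h : ∃ η : H ℚ_[ℓ], t.1⁻¹ * η.1.1 ∈ GLInt ℓ 2 ∧ t.2.1⁻¹ * η.1.2 ∈ GLInt ℓ 2 then
    f ((iotaGSp4 ℓ h.choose)⁻¹ * t.2.2) else 0

variable {f : GSp4 ℚ_[ℓ] → ℂ}

/-- Two choices of η differ by an element of H(ℤ_ℓ), under which f is left invariant. -/
theorem tripleFun_eq (hl : ∀ h ∈ HInt ℓ, ∀ x, f (iotaGSp4 ℓ h * x) = f x)
    {t : GL (Fin 2) ℚ_[ℓ] × GL (Fin 2) ℚ_[ℓ] × GSp4 ℚ_[ℓ]} {η : H ℚ_[ℓ]}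
    (h₁ : t.1⁻¹ * η.1.1 ∈ GLInt ℓ 2) (h₂ : t.2.1⁻¹ * η.1.2 ∈ GLInt ℓ 2) :
    tripleFun f t = f ((iotaGSp4 ℓ η)⁻¹ * t.2.2) := by
  have hex : ∃ η : H ℚ_[ℓ], t.1⁻¹ * η.1.1 ∈ GLInt ℓ 2 ∧ t.2.1⁻¹ * η.1.2 ∈ GLInt ℓ 2 :=
    ⟨η, h₁, h₂⟩
  rw [tripleFun, dif_pos hex]
  obtain ⟨c₁, c₂⟩ := hex.choose_spec
  generalize hex.choose = c at *
  have hmem : c⁻¹ * η ∈ HInt ℓ := by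
    refine mem_HInt.2 ⟨?_, ?_⟩
    · have := mul_mem (inv_mem c₁) h₁
      simpa [mul_assoc] using this
    · have := mul_mem (inv_mem c₂) h₂
      simpa [mul_assoc] using this
  rw [← hl _ hmem ((iotaGSp4 ℓ η)⁻¹ * t.2.2)]
  simp [mul_assoc]

theorem tripleFun_rel (hl : ∀ h ∈ HInt ℓ, ∀ x, f (iotaGSp4 ℓ h * x) = f x)
    (hr : ∀ k ∈ GSp4Int ℓ, ∀ x, f (x * k) = f x)
    (t t' : GL (Fin 2) ℚ_[ℓ] × GL (Fin 2) ℚ_[ℓ] × GSp4 ℚ_[ℓ]) (h : Rel t t') :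
    tripleFun f t = tripleFun f t' := by
  have key : ∀ t t' : GL (Fin 2) ℚ_[ℓ] × GL (Fin 2) ℚ_[ℓ] × GSp4 ℚ_[ℓ], Rel t t' →
      ∀ η : H ℚ_[ℓ], t.1⁻¹ * η.1.1 ∈ GLInt ℓ 2 → t.2.1⁻¹ * η.1.2 ∈ GLInt ℓ 2 →
      tripleFun f t = tripleFun f t' := by
    rintro ⟨a, b, g⟩ ⟨a', b', g'⟩ ⟨ζ, κ₁, h₁, κ₂, h₂, k, hk, e₁, e₂, e₃⟩ η hη₁ hη₂
    simp only at e₁ e₂ e₃ hη₁ hη₂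
    subst e₁ e₂ e₃
    have h₁' : (ζ.1.1 * a * κ₁)⁻¹ * (ζ * η).1.1 ∈ GLInt ℓ 2 := by
      have := mul_mem (inv_mem h₁) hη₁
      simpa [mul_assoc] using this
    have h₂' : (ζ.1.2 * b * κ₂)⁻¹ * (ζ * η).1.2 ∈ GLInt ℓ 2 := by
      have := mul_mem (inv_mem h₂) hη₂
      simpa [mul_assoc] using this
    refine (tripleFun_eq (t := (a, b, g)) hl hη₁ hη₂).trans (Eq.trans ?_ (tripleFun_eq
      (t := (ζ.1.1 * a * κ₁, ζ.1.2 * b * κ₂, iotaGSp4 ℓ ζ * g * k)) hl h₁' h₂').symm)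
    have : (iotaGSp4 ℓ (ζ * η))⁻¹ * (iotaGSp4 ℓ ζ * g * k) = (iotaGSp4 ℓ η)⁻¹ * g * k := by
      simp only [map_mul, mul_inv_rev, mul_assoc, inv_mul_cancel_left]
    simp only [this, hr _ hk]
  by_cases ht : ∃ η : H ℚ_[ℓ], t.1⁻¹ * η.1.1 ∈ GLInt ℓ 2 ∧ t.2.1⁻¹ * η.1.2 ∈ GLInt ℓ 2
  · obtain ⟨η, h₁, h₂⟩ := ht
    exact key t t' h η h₁ h₂
  by_cases ht' : ∃ η : H ℚ_[ℓ], t'.1⁻¹ * η.1.1 ∈ GLInt ℓ 2 ∧ t'.2.1⁻¹ * η.1.2 ∈ GLInt ℓ 2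
  · obtain ⟨η, h₁, h₂⟩ := ht'
    exact (key t' t h.symm η h₁ h₂).symm
  · rw [tripleFun, tripleFun, dif_neg ht, dif_neg ht']

theorem mean_orbitMean_eq_zero
    {μ : CcBi ((HInt ℓ).map (iotaGSp4 ℓ : H ℚ_[ℓ] →* GSp4 ℚ_[ℓ])) (GSp4Int ℓ) →ₗ[ℂ] ℂ}
    (h : ∀ θ₁ θ₂, μ (leftAct (iotaGSp4 ℓ) rfl θ₁ (rightAct θ₂ (ch _ _ (map_HInt_le ℓ)))) = 0)
    (η : H ℚ_[ℓ]) (g : GSp4 ℚ_[ℓ]) : mean (fun k : GSp4Int ℓ =>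
      μ (orbitMean (iotaGSp4 ℓ) rfl (iotaGSp4 ℓ η * (k * g)))) = 0 := by
  obtain ⟨θ₁, θ₂, e⟩ := mean_map_orbitMean rfl (map_HInt_le ℓ) μ η g
  exact e.trans (h θ₁ θ₂)

theorem admissible_tripleFun (hl : ∀ h ∈ HInt ℓ, ∀ x, f (iotaGSp4 ℓ h * x) = f x)
    (hr : ∀ k ∈ GSp4Int ℓ, ∀ x, f (x * k) = f x)
    (hm : ∀ (η : H ℚ_[ℓ]) (g : GSp4 ℚ_[ℓ]),
      mean (fun k : GSp4Int ℓ => f (iotaGSp4 ℓ η * (k * g))) = 0) :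
    Admissible (tripleFun f) := by
  refine ⟨tripleFun_rel hl hr, fun a b g => ?_⟩
  by_cases ht : ∃ η : H ℚ_[ℓ], a⁻¹ * η.1.1 ∈ GLInt ℓ 2 ∧ b⁻¹ * η.1.2 ∈ GLInt ℓ 2
  · obtain ⟨η, h₁, h₂⟩ := ht
    rw [← hm η⁻¹ g]
    congr 1
    funext k
    rw [map_inv]
    exact tripleFun_eq (t := (a, b, k * g)) hl h₁ h₂
  · have e : ∀ k : GSp4Int ℓ, tripleFun f (a, b, k * g) = 0 := fun k => dif_neg ht
    simp only [e]
    exact mean_const 0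

theorem eq_zero_of_hecke_orbit
    (μ : CcBi ((HInt ℓ).map (iotaGSp4 ℓ : H ℚ_[ℓ] →* GSp4 ℚ_[ℓ])) (GSp4Int ℓ) →ₗ[ℂ] ℂ)
    (h : ∀ θ₁ θ₂, μ (leftAct (iotaGSp4 ℓ) rfl θ₁ (rightAct θ₂ (ch _ _ (map_HInt_le ℓ)))) = 0) :
    μ = 0 := by
  have hl : ∀ h ∈ HInt ℓ, ∀ x, μ (orbitMean (iotaGSp4 ℓ) rfl (iotaGSp4 ℓ h * x)) =
      μ (orbitMean (iotaGSp4 ℓ) rfl x) := fun h hh x =>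
    congrArg μ (orbitMean_mul_left rfl x hh)
  have hr : ∀ k ∈ GSp4Int ℓ, ∀ x, μ (orbitMean (iotaGSp4 ℓ) rfl (x * k)) =
      μ (orbitMean (iotaGSp4 ℓ) rfl x) := fun k hk x =>
    congrArg μ (orbitMean_mul_right rfl x hk)
  have hm := mean_orbitMean_eq_zero h
  refine eq_zero_of_orbitMean_eq_zero rfl μ fun g => ?_
  generalize hf : (fun g => μ (orbitMean (iotaGSp4 ℓ) rfl g)) = f
  have hf' : ∀ g, μ (orbitMean (iotaGSp4 ℓ) rfl g) = f g := congrFun hf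
  simp only [hf'] at hl hr hm ⊢
  -- At a = b = 1 one may take η = 1, so the function on triples returns f itself.
  have h0 := (admissible_tripleFun hl hr hm).eq_zero (1, 1, g)
  rw [tripleFun_eq (t := (1, 1, g)) (η := 1) hl (by simp [one_mem]) (by simp [one_mem])] at h0
  simpa using h0

theorem span_chGSp4 : Submodule.span (HeckeAlg (HInt ℓ) ⊗[ℂ] HeckeAlg (GSp4Int ℓ)) {chGSp4 ℓ} =
    ⊤ := by
  have htop : Submodule.span ℂ (Set.range fun θ : HeckeAlg (HInt ℓ) × HeckeAlg (GSp4Int ℓ) =>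
      θ.1 • θ.2 • chGSp4 ℓ) = ⊤ := by
    by_contra hne
    obtain ⟨μ, hμ, hle⟩ := Submodule.exists_le_ker_of_lt_top _ (lt_top_iff_ne_top.2 hne)
    exact hμ (eq_zero_of_hecke_orbit μ fun θ₁ θ₂ =>
      hle (Submodule.subset_span ⟨(θ₁, θ₂), rfl⟩))
  rw [eq_top_iff]
  rintro ξ -
  have hξ : ξ ∈ Submodule.span ℂ (Set.range fun θ : HeckeAlg (HInt ℓ) × HeckeAlg (GSp4Int ℓ) =>
      θ.1 • θ.2 • chGSp4 ℓ) := htop ▸ Submodule.mem_top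
  induction hξ using Submodule.span_induction with
  | mem x hx =>
    obtain ⟨θ, rfl⟩ := hx
    have : θ.1 • θ.2 • chGSp4 ℓ = (θ.1 ⊗ₜ[ℂ] θ.2) • chGSp4 ℓ :=
      (TensorProduct.Algebra.smul_def _ _ _).symm
    simp only [this]
    exact Submodule.smul_mem _ _ (Submodule.mem_span_singleton_self _)
  | zero => exact zero_mem _
  | add x y _ _ hx hy => exact add_mem hx hy
  | smul c x _ hx =>
    have : c • x = ((c • (1 : HeckeAlg (HInt ℓ))) ⊗ₜ[ℂ] (1 : HeckeAlg (GSp4Int ℓ))) • x := by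
      rw [TensorProduct.Algebra.smul_def, one_smul, smul_assoc, one_smul]
    rw [this]
    exact Submodule.smul_mem _ _ hx

end Shintani

end

section

open Matrix

variable {ℓ : ℕ} [Fact ℓ.Prime]

/-! ### Orbits of GL₂(ℤ_ℓ) on row vectors. -/

section RowVectors

theorem norm_vecMul_le {g : Matrix (Fin 2) (Fin 2) ℚ_[ℓ]} (hg : ∀ i j, ‖g i j‖ ≤ 1)
    (v : Fin 2 → ℚ_[ℓ]) : ‖v ᵥ* g‖ ≤ ‖v‖ := by
  refine (pi_norm_le_iff_of_nonneg (norm_nonneg _)).2 fun j => ?_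
  rw [Matrix.vecMul, dotProduct, Fin.sum_univ_two]
  refine (Padic.nonarchimedean _ _).trans (max_le ?_ ?_) <;> rw [norm_mul]
  · exact (mul_le_of_le_one_right (norm_nonneg _) (hg 0 j)).trans (norm_le_pi_norm v 0)
  · exact (mul_le_of_le_one_right (norm_nonneg _) (hg 1 j)).trans (norm_le_pi_norm v 1)

theorem norm_vecMul_eq {κ : GL (Fin 2) ℚ_[ℓ]} (hκ : κ ∈ GLInt ℓ 2) (v : Fin 2 → ℚ_[ℓ]) :
    ‖v ᵥ* κ.1‖ = ‖v‖ := by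
  refine le_antisymm (norm_vecMul_le (mem_GLInt_two.1 hκ).1 v) ?_
  have := norm_vecMul_le (mem_GLInt_two.1 (inv_mem hκ)).1 (v ᵥ* κ.1)
  rwa [Matrix.vecMul_vecMul, ← Units.val_mul, mul_inv_cancel, Units.val_one, Matrix.vecMul_one]
    at this

/-- Every nonzero row vector is the translate of a standard one by `GL₂(ℤ_ℓ)`. -/
theorem exists_eq_vecMul {v : Fin 2 → ℚ_[ℓ]} (hv : v ≠ 0) :
    ∃ j : ℤ, ∃ κ ∈ GLInt ℓ 2, v = ![(ℓ : ℚ_[ℓ]) ^ j, 0] ᵥ* κ.1 := by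
  rcases le_total ‖v 1‖ ‖v 0‖ with h | h
  · have h0 : v 0 ≠ 0 := by
      intro h0
      rw [h0, norm_zero] at h
      exact hv (funext fun i => by
        fin_cases i
        · exact h0
        · exact norm_le_zero_iff.1 h)
    obtain ⟨j, u, hu, e⟩ := exists_zpow_mul_unit h0
    have hz := ell_zpow_ne_zero (ℓ := ℓ) j
    have hu0 : u ≠ 0 := by rintro rfl; simp at hu
    have hw : ‖v 1 / (ℓ : ℚ_[ℓ]) ^ j‖ ≤ 1 := by
      rw [norm_div]
      refine div_le_one_of_le₀ (h.trans ?_) (norm_nonneg _)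
      rw [e, norm_mul, hu, mul_one]
    refine ⟨j, gl2 u (v 1 / (ℓ : ℚ_[ℓ]) ^ j) 0 1 (by simpa using hu0),
      gl2_mem_GLInt hu.le hw (by simp) (by simp) (by simpa using hu), ?_⟩
    ext i
    fin_cases i
    · simp [Matrix.vecMul, dotProduct, Fin.sum_univ_two, e]
    · simp [Matrix.vecMul, dotProduct, Fin.sum_univ_two]; field_simp
  · have h0 : v 1 ≠ 0 := by
      intro h0
      rw [h0, norm_zero] at h
      exact hv (funext fun i => by
        fin_cases i
        · exact norm_le_zero_iff.1 h
        · exact h0)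
    obtain ⟨j, u, hu, e⟩ := exists_zpow_mul_unit h0
    have hz := ell_zpow_ne_zero (ℓ := ℓ) j
    have hu0 : u ≠ 0 := by rintro rfl; simp at hu
    have hw : ‖v 0 / (ℓ : ℚ_[ℓ]) ^ j‖ ≤ 1 := by
      rw [norm_div]
      refine div_le_one_of_le₀ (h.trans ?_) (norm_nonneg _)
      rw [e, norm_mul, hu, mul_one]
    refine ⟨j, gl2 (v 0 / (ℓ : ℚ_[ℓ]) ^ j) u 1 0 (by simpa using hu0),
      gl2_mem_GLInt hw hu.le (by simp) (by simp) (by simpa using hu), ?_⟩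
    ext i
    fin_cases i
    · simp [Matrix.vecMul, dotProduct, Fin.sum_univ_two]; field_simp
    · simp [Matrix.vecMul, dotProduct, Fin.sum_univ_two, e]

theorem norm_std (j : ℤ) : ‖(![(ℓ : ℚ_[ℓ]) ^ j, 0] : Fin 2 → ℚ_[ℓ])‖ = (ℓ : ℝ) ^ (-j) := by
  refine le_antisymm ((pi_norm_le_iff_of_nonneg (by positivity)).2 fun i => ?_) ?_
  · fin_cases i
    · simp only [Fin.zero_eta, cons_val_zero]; rw [norm_ell_zpow]
    · simp only [Fin.mk_one, cons_val_one, cons_val_fin_one, norm_zero]; positivity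
  · rw [← norm_ell_zpow]
    exact norm_le_pi_norm (![(ℓ : ℚ_[ℓ]) ^ j, 0] : Fin 2 → ℚ_[ℓ]) 0

end RowVectors

/-! ### Functionals on Schwartz functions determined by lattices. -/

section Schwartz

/-- The action of `GL₂(ℚ_ℓ)` on Schwartz functions. -/
def glAct (h : GL (Fin 2) ℚ_[ℓ]) : Schwartz ℓ →ₗ[ℂ] Schwartz ℓ := schwartzRep ℓ (mkH h h rfl)

theorem glAct_apply (h : GL (Fin 2) ℚ_[ℓ]) (φ : Schwartz ℓ) (v : Fin 2 → ℚ_[ℓ]) :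
    (glAct h φ).1 v = φ.1 (v ᵥ* h.1) := rfl

theorem schwartzRep_eq (η : H ℚ_[ℓ]) : schwartzRep ℓ η = glAct η.1.1 := rfl

theorem glAct_mul (h h' : GL (Fin 2) ℚ_[ℓ]) (φ : Schwartz ℓ) :
    glAct (h * h') φ = glAct h (glAct h' φ) := by
  ext v
  simp [glAct_apply, Matrix.vecMul_vecMul]

/-- The characteristic function of `v + ℓ ^ n ℤ_ℓ²`. -/
def chBall (v : Fin 2 → ℚ_[ℓ]) (n : ℤ) : Schwartz ℓ :=
  ⟨(Metric.closedBall v ((ℓ : ℝ) ^ (-n))).indicator 1, by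
    have hp : (ℓ : ℝ) ^ (-n) ≠ 0 := (zpow_pos (by linarith [one_lt_ell (ℓ := ℓ)]) _).ne'
    have hc := IsUltrametricDist.isClopen_closedBall v hp
    refine (IsLocallyConstant.iff_exists_open _).2 fun x => ?_
    by_cases hx : x ∈ Metric.closedBall v ((ℓ : ℝ) ^ (-n))
    · exact ⟨_, hc.2, hx, fun y hy => by
        rw [Set.indicator_of_mem hy, Set.indicator_of_mem hx]; rfl⟩
    · exact ⟨_, hc.compl.2, hx, fun y hy => by
        rw [Set.indicator_of_notMem hy, Set.indicator_of_notMem hx]⟩, by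
    refine HasCompactSupport.of_support_subset_isCompact
      (isCompact_closedBall v ((ℓ : ℝ) ^ (-n))) ?_
    simp⟩

open Classical in
theorem chBall_apply (v w : Fin 2 → ℚ_[ℓ]) (n : ℤ) :
    (chBall v n).1 w = if ‖w - v‖ ≤ (ℓ : ℝ) ^ (-n) then 1 else 0 := by
  simp [chBall, Set.indicator_apply, dist_eq_norm]

theorem chLattice_eq : chLattice ℓ = chBall 0 0 := by
  apply Subtype.ext
  simp only [chLattice, chBall, neg_zero, zpow_zero]
  rw [closedBall_pi _ zero_le_one]
  rfl

open Classical in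
theorem chLattice_apply (w : Fin 2 → ℚ_[ℓ]) :
    (chLattice ℓ).1 w = if ‖w‖ ≤ 1 then 1 else 0 := by
  rw [chLattice_eq, chBall_apply]; simp

theorem glAct_chLattice {κ : GL (Fin 2) ℚ_[ℓ]} (hκ : κ ∈ GLInt ℓ 2) :
    glAct κ (chLattice ℓ) = chLattice ℓ := by
  ext v
  rw [glAct_apply, chLattice_apply, chLattice_apply, norm_vecMul_eq hκ]

theorem isLocallyConstant_glAct_chLattice :
    IsLocallyConstant (fun h : GL (Fin 2) ℚ_[ℓ] => glAct h (chLattice ℓ)) :=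
  isLocallyConstant_of_mul_right (GLInt ℓ 2) fun k hk h => by rw [glAct_mul, glAct_chLattice hk]

/-- Scalar matrices. -/
def scalarGL (c : ℚ_[ℓ]) (hc : c ≠ 0) : GL (Fin 2) ℚ_[ℓ] := gl2 c 0 0 c (by simpa using hc)

theorem vecMul_scalarGL (c : ℚ_[ℓ]) (hc : c ≠ 0) (v : Fin 2 → ℚ_[ℓ]) :
    v ᵥ* (scalarGL c hc).1 = c • v := by
  ext i
  fin_cases i <;> simp [scalarGL, Matrix.vecMul, dotProduct, Fin.sum_univ_two, mul_comm]

theorem scalarGL_mul (c : ℚ_[ℓ]) (hc : c ≠ 0) (g : GL (Fin 2) ℚ_[ℓ]) :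
    scalarGL c hc * g = g * scalarGL c hc := by
  apply gl2_ext <;> simp [scalarGL, Matrix.mul_apply, Fin.sum_univ_two, mul_comm]

theorem zpow_neg_iff {x : ℝ} {n : ℤ} :
    (ℓ : ℝ) ^ n * x ≤ 1 ↔ x ≤ (ℓ : ℝ) ^ (-n) := by
  have hp : (0 : ℝ) < (ℓ : ℝ) ^ n := zpow_pos (by linarith [one_lt_ell (ℓ := ℓ)]) _
  rw [_root_.zpow_neg, ← one_div, le_div_iff₀ hp, mul_comm]

theorem chBall_zero_eq (n : ℤ) : (chBall 0 n : Schwartz ℓ) =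
    glAct (scalarGL ((ℓ : ℚ_[ℓ]) ^ (-n)) (ell_zpow_ne_zero _)) (chLattice ℓ) := by
  ext v
  simp only [glAct_apply, chLattice_apply, chBall_apply, vecMul_scalarGL, norm_smul, norm_ell_zpow,
    neg_neg, sub_zero, zpow_neg_iff]

theorem exists_norm_eq {v : Fin 2 → ℚ_[ℓ]} (hv : v ≠ 0) : ∃ n : ℤ, ‖v‖ = (ℓ : ℝ) ^ (-n) := by
  obtain ⟨j, κ, hκ, rfl⟩ := exists_eq_vecMul hv
  exact ⟨j, by rw [norm_vecMul_eq hκ, norm_std]⟩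

theorem exists_zpow_le {δ : ℝ} (hδ : 0 < δ) : ∃ N : ℤ, (ℓ : ℝ) ^ (-N) < δ := by
  obtain ⟨n, hn⟩ := exists_pow_lt_of_lt_one hδ (inv_lt_one_of_one_lt₀ (one_lt_ell (ℓ := ℓ)))
  exact ⟨n, by rwa [_root_.zpow_neg, zpow_natCast, ← inv_pow]⟩

theorem map_eq_zero_of_classes (μ : Schwartz ℓ →ₗ[ℂ] ℂ) (r : Setoid (Fin 2 → ℚ_[ℓ]))
    (hr : ∀ x, ∃ β : Schwartz ℓ, β.1 = {y | r x y}.indicator 1 ∧ μ β = 0) (φ : Schwartz ℓ)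
    (hc : ∀ x y, r x y → φ.1 x = φ.1 y) : μ φ = 0 := by
  choose β hβ hμ using hr
  have ho : ∀ x, IsOpen {y | r x y} := by
    intro x
    have : {y | r x y} = (β x).1 ⁻¹' {1} := by
      ext y
      rw [hβ]
      by_cases h : r x y <;> simp [h]
    rw [this]
    exact (β x).2.1 {1}
  obtain ⟨T, -, hT⟩ := exists_eq_sum_indicator r ho φ.2.2 hc
  have : φ = ∑ x ∈ T, φ.1 x • β x := by
    apply Subtype.ext
    refine hT.trans ?_
    simp [hβ]
  rw [this]
  simp [hμ]

/-- A functional vanishing on the characteristic functions of the `ℓ ^ n ℤ_ℓ²` vanishes on the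
`GL₂(ℤ_ℓ)`-invariant Schwartz functions. -/
theorem map_eq_zero_of_invariant (μ : Schwartz ℓ →ₗ[ℂ] ℂ) (hμ : ∀ n, μ (chBall 0 n) = 0)
    (φ : Schwartz ℓ) (hφ : ∀ κ ∈ GLInt ℓ 2, glAct κ φ = φ) : μ φ = 0 := by
  obtain ⟨U, hU, h0, hU'⟩ := (IsLocallyConstant.iff_exists_open _).1 φ.2.1 0
  obtain ⟨δ, hδ, hδU⟩ := Metric.isOpen_iff.1 hU 0 h0
  obtain ⟨N, hN⟩ := exists_zpow_le (ℓ := ℓ) hδ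
  have hsmall : ∀ v : Fin 2 → ℚ_[ℓ], ‖v‖ ≤ (ℓ : ℝ) ^ (-N) → φ.1 v = φ.1 0 := fun v hv =>
    hU' v (hδU (by simpa using hv.trans_lt hN))
  have hφ' : ∀ κ ∈ GLInt ℓ 2, ∀ v, φ.1 (v ᵥ* κ.1) = φ.1 v := fun κ hκ v => by
    conv_rhs => rw [← hφ κ hκ]
    rfl
  have hnorm : ∀ v w : Fin 2 → ℚ_[ℓ], v ≠ 0 → ‖v‖ = ‖w‖ → φ.1 v = φ.1 w := by
    intro v w hv h
    have hw : w ≠ 0 := by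
      rintro rfl
      rw [norm_zero, norm_eq_zero] at h
      exact hv h
    obtain ⟨j, κ, hκ, rfl⟩ := exists_eq_vecMul hv
    obtain ⟨j', κ', hκ', rfl⟩ := exists_eq_vecMul hw
    rw [norm_vecMul_eq hκ, norm_vecMul_eq hκ', norm_std, norm_std, zpow_eq_iff] at h
    rw [hφ' κ hκ, hφ' κ' hκ', neg_injective h]
  -- The classes are a small ball at 0, on which φ is constant, and spheres, on which GL₂(ℤ_ℓ) is
  -- transitive; a sphere is a difference of two balls ℓ^n ℤ_ℓ².
  refine map_eq_zero_of_classes μ (Setoid.ker fun v => max ‖v‖ ((ℓ : ℝ) ^ (-N))) (fun v => ?_) φ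
    fun v w h => ?_
  · simp only [Setoid.ker_def]
    by_cases hv : ‖v‖ ≤ (ℓ : ℝ) ^ (-N)
    · refine ⟨chBall 0 N, ?_, hμ N⟩
      simp only [chBall]
      congr 1
      ext w
      rw [Set.mem_ofPred_eq, max_eq_right hv, Metric.mem_closedBall, dist_zero_right, eq_comm,
        max_eq_right_iff]
    · have hv0 : v ≠ 0 := by
        rintro rfl
        exact hv (by rw [norm_zero]; positivity)
      obtain ⟨n, hn⟩ := exists_norm_eq hv0
      refine ⟨chBall 0 n - chBall 0 (n + 1), ?_, by rw [map_sub, hμ, hμ, sub_zero]⟩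
      have hnN : n < N := by
        rw [hn, zpow_le_iff] at hv
        omega
      ext w
      have hw : (max ‖v‖ ((ℓ : ℝ) ^ (-N)) = max ‖w‖ ((ℓ : ℝ) ^ (-N))) ↔
          ‖w‖ ≤ (ℓ : ℝ) ^ (-n) ∧ ¬ ‖w‖ ≤ (ℓ : ℝ) ^ (-(n + 1)) := by
        rw [max_eq_left (not_le.1 hv).le, hn]
        by_cases hw0 : w = 0
        · subst hw0
          simp only [norm_zero]
          rw [max_eq_right (by positivity), zpow_eq_iff]
          constructor
          · intro h; omega
          · rintro ⟨-, h⟩; exact absurd (by positivity) h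
        · obtain ⟨m, hm⟩ := exists_norm_eq hw0
          rw [hm, zpow_le_iff, zpow_le_iff]
          rcases le_total ((ℓ : ℝ) ^ (-m)) ((ℓ : ℝ) ^ (-N)) with h | h
          · rw [max_eq_right h, zpow_eq_iff]
            rw [zpow_le_iff] at h
            omega
          · rw [max_eq_left h, zpow_eq_iff]
            omega
      have e : (chBall 0 n - chBall 0 (n + 1) : Schwartz ℓ).1 w =
          (chBall 0 n).1 w - (chBall 0 (n + 1)).1 w := rfl
      rw [e, chBall_apply, chBall_apply, sub_zero, Set.indicator_apply]
      simp only [Set.mem_ofPred_eq, hw, Pi.one_apply]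
      have hmono : ‖w‖ ≤ (ℓ : ℝ) ^ (-(n + 1)) → ‖w‖ ≤ (ℓ : ℝ) ^ (-n) := fun h =>
        h.trans (zpow_le_iff.2 (by omega))
      by_cases h1 : ‖w‖ ≤ (ℓ : ℝ) ^ (-n) <;> by_cases h2 : ‖w‖ ≤ (ℓ : ℝ) ^ (-(n + 1))
      · simp only [h1, h2]; simp
      · simp only [h1, h2]; simp
      · exact absurd (hmono h2) h1
      · simp only [h1, h2]; simp
  · rw [Setoid.ker_def] at h
    rcases le_total ‖v‖ ((ℓ : ℝ) ^ (-N)) with h1 | h1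
    · rw [max_eq_right h1] at h
      rw [hsmall v h1, hsmall w (by rw [h]; exact le_max_left _ _)]
    · by_cases h2 : ‖w‖ ≤ (ℓ : ℝ) ^ (-N)
      · rw [max_eq_left h1, max_eq_right h2] at h
        rw [hsmall v h.le, hsmall w h2]
      · rw [max_eq_left h1, max_eq_left (not_le.1 h2).le] at h
        refine hnorm v w ?_ h
        rintro rfl
        rw [norm_zero] at h
        exact h2 (by rw [← h]; positivity)

/-- Lebesgue numbers on the compact support make φ uniformly locally constant. -/
theorem exists_uniform (φ : Schwartz ℓ) : ∃ N : ℤ, ∀ v w : Fin 2 → ℚ_[ℓ],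
    ‖v - w‖ ≤ (ℓ : ℝ) ^ (-N) → φ.1 v = φ.1 w := by
  obtain ⟨δ, hδ, hδ'⟩ := lebesgue_number_lemma_of_metric (s := tsupport φ.1)
    (c := fun c : ℂ => φ.1 ⁻¹' {c}) φ.2.2.isCompact (fun c => φ.2.1 _)
    fun x _ => Set.mem_iUnion.2 ⟨φ.1 x, rfl⟩
  obtain ⟨N, hN⟩ := exists_zpow_le (ℓ := ℓ) hδ
  have key : ∀ v w : Fin 2 → ℚ_[ℓ], v ∈ tsupport φ.1 → ‖v - w‖ ≤ (ℓ : ℝ) ^ (-N) →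
      φ.1 v = φ.1 w := by
    intro v w hv h
    obtain ⟨c, hc⟩ := hδ' v hv
    have h1 : φ.1 v = c := hc (Metric.mem_ball_self hδ)
    have h2 : φ.1 w = c := hc (by
      rw [Metric.mem_ball, dist_comm, dist_eq_norm]; exact h.trans_lt hN)
    rw [h1, h2]
  refine ⟨N, fun v w h => ?_⟩
  by_cases hv : v ∈ tsupport φ.1
  · exact key v w hv h
  by_cases hw : w ∈ tsupport φ.1
  · exact (key w v hw (by rwa [norm_sub_rev])).symm
  · rw [image_eq_zero_of_notMem_tsupport hv, image_eq_zero_of_notMem_tsupport hw]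

variable (ℓ) in
/-- Congruence modulo `ℓ ^ N ℤ_ℓ²`. -/
def ballSetoid (N : ℤ) : Setoid (Fin 2 → ℚ_[ℓ]) where
  r v w := ‖v - w‖ ≤ (ℓ : ℝ) ^ (-N)
  iseqv := ⟨fun v => by simp; positivity, fun h => by rwa [norm_sub_rev], fun {u v w} h h' => by
    rw [← dist_eq_norm] at *
    exact (dist_triangle_max u v w).trans (max_le h h')⟩

theorem chBall_eq_indicator (v : Fin 2 → ℚ_[ℓ]) (N : ℤ) :
    (chBall v N).1 = {w | ballSetoid ℓ N v w}.indicator 1 := by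
  simp only [chBall]
  congr 1
  ext w
  rw [Metric.mem_closedBall, dist_comm, dist_eq_norm]
  rfl

theorem isOpen_ballSetoid (N : ℤ) (v : Fin 2 → ℚ_[ℓ]) : IsOpen {w | ballSetoid ℓ N v w} := by
  have : {w | ballSetoid ℓ N v w} = (chBall v N).1 ⁻¹' {1} := by
    rw [chBall_eq_indicator]
    ext w
    by_cases h : ballSetoid ℓ N v w <;> simp [h]
  rw [this]
  exact (chBall v N).2.1 {1}

theorem chBall_congr {v w : Fin 2 → ℚ_[ℓ]} {N : ℤ} (h : ‖v - w‖ ≤ (ℓ : ℝ) ^ (-N)) :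
    chBall v N = chBall w N := by
  apply Subtype.ext
  rw [chBall_eq_indicator, chBall_eq_indicator]
  congr 1
  ext x
  have h' : ballSetoid ℓ N v w := h
  exact ⟨fun hx => (ballSetoid ℓ N).trans ((ballSetoid ℓ N).symm h') hx,
    fun hx => (ballSetoid ℓ N).trans h' hx⟩

theorem glAct_chBall {κ : GL (Fin 2) ℚ_[ℓ]} (hκ : κ ∈ GLInt ℓ 2) (v : Fin 2 → ℚ_[ℓ]) (N : ℤ) :
    glAct κ (chBall (v ᵥ* κ.1) N) = chBall v N := by
  ext w
  rw [glAct_apply, chBall_apply, chBall_apply, ← Matrix.sub_vecMul, norm_vecMul_eq hκ]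

theorem scalarGL_mem {u : ℚ_[ℓ]} (hu : ‖u‖ = 1) (hu0 : u ≠ 0) : scalarGL u hu0 ∈ GLInt ℓ 2 :=
  gl2_mem_GLInt hu.le (by simp) (by simp) hu.le (by simp [hu])

open Classical in
theorem glAct_diag_apply (i N : ℤ) (v : Fin 2 → ℚ_[ℓ])
    (h : (ℓ : ℚ_[ℓ]) ^ (-i) * (ℓ : ℚ_[ℓ]) ^ (-N) - 0 * 0 ≠ 0) :
    (glAct (gl2 ((ℓ : ℚ_[ℓ]) ^ (-i)) 0 0 ((ℓ : ℚ_[ℓ]) ^ (-N)) h) (chLattice ℓ)).1 v =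
      if ‖v 0‖ ≤ (ℓ : ℝ) ^ (-i) ∧ ‖v 1‖ ≤ (ℓ : ℝ) ^ (-N) then 1 else 0 := by
  rw [glAct_apply, chLattice_apply]
  congr 1
  rw [pi_norm_le_iff_of_nonneg zero_le_one, Fin.forall_fin_two]
  simp only [gl2_val, Matrix.vecMul, dotProduct, Fin.sum_univ_two, of_apply, cons_val', cons_val_zero,
    cons_val_fin_one, cons_val_one, mul_zero, add_zero, zero_add, norm_mul, norm_ell_zpow, neg_neg]
  rw [mul_comm, zpow_neg_iff, mul_comm, zpow_neg_iff]

/-- The difference of the lattices ℓ^j ℤ_ℓ × ℓ^N ℤ_ℓ and ℓ^(j+1) ℤ_ℓ × ℓ^N ℤ_ℓ is a nonempty finite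
union of unit multiples of the given ball. All these balls have the same image under `μ`, and the
images sum to zero. -/
theorem map_chBall_std {μ : Schwartz ℓ →ₗ[ℂ] ℂ} (h₁ : ∀ h, μ (glAct h (chLattice ℓ)) = 0)
    (h₂ : ∀ u (hu0 : u ≠ 0), ‖u‖ = 1 → ∀ φ, μ (glAct (scalarGL u hu0) φ) = μ φ) {j N : ℤ}
    (hj : j < N) : μ (chBall ![(ℓ : ℚ_[ℓ]) ^ j, 0] N) = 0 := by
  classical
  have hne : ∀ i : ℤ, (ℓ : ℚ_[ℓ]) ^ (-i) * (ℓ : ℚ_[ℓ]) ^ (-N) - 0 * 0 ≠ 0 := fun i => by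
    rw [mul_zero, sub_zero]
    exact mul_ne_zero (ell_zpow_ne_zero _) (ell_zpow_ne_zero _)
  let D : ℤ → Schwartz ℓ := fun i =>
    glAct (gl2 ((ℓ : ℚ_[ℓ]) ^ (-i)) 0 0 ((ℓ : ℚ_[ℓ]) ^ (-N)) (hne i)) (chLattice ℓ)
  let y : Schwartz ℓ := D j - D (j + 1)
  have hy : ∀ v, y.1 v = if ‖v 0‖ = (ℓ : ℝ) ^ (-j) ∧ ‖v 1‖ ≤ (ℓ : ℝ) ^ (-N) then 1 else 0 := by
    intro v
    have e : y.1 v = (D j).1 v - (D (j + 1)).1 v := rfl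
    rw [e]
    simp only [D, glAct_diag_apply]
    by_cases h1 : ‖v 1‖ ≤ (ℓ : ℝ) ^ (-N)
    · simp only [h1, and_true]
      by_cases h0 : v 0 = 0
      · have hp : ∀ n : ℤ, (0 : ℝ) < (ℓ : ℝ) ^ n := fun n =>
          zpow_pos (by linarith [one_lt_ell (ℓ := ℓ)]) _
        simp [h0, (hp _).le, (hp (-j)).ne, -_root_.zpow_neg]
      · obtain ⟨n, u, hu, e⟩ := exists_zpow_mul_unit h0
        simp only [e, norm_mul, hu, mul_one, norm_ell_zpow, zpow_le_iff, zpow_eq_iff]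
        by_cases c1 : n < j
        · rw [if_neg (by omega), if_neg (by omega), if_neg (by omega)]; simp
        · by_cases c2 : n = j
          · rw [if_pos (by omega), if_neg (by omega), if_pos (by omega)]; simp
          · rw [if_pos (by omega), if_pos (by omega), if_neg (by omega)]; simp
    · simp only [h1, and_false, if_false, sub_zero]
  have hμy : μ y = 0 := by simp only [y, D, map_sub, h₁, sub_zero]
  obtain ⟨T, hT, hsum⟩ := exists_eq_sum_indicator (ballSetoid ℓ N) (isOpen_ballSetoid N) y.2.2
    (fun v w h => by
      have h' : ‖v - w‖ ≤ (ℓ : ℝ) ^ (-N) := h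
      have c0 : ‖v 0 - w 0‖ ≤ (ℓ : ℝ) ^ (-N) := (norm_le_pi_norm (v - w) 0).trans h'
      have c1 : ‖v 1 - w 1‖ ≤ (ℓ : ℝ) ^ (-N) := (norm_le_pi_norm (v - w) 1).trans h'
      have key : ∀ v w : Fin 2 → ℚ_[ℓ], ‖v 0 - w 0‖ ≤ (ℓ : ℝ) ^ (-N) →
          ‖v 1 - w 1‖ ≤ (ℓ : ℝ) ^ (-N) → ‖v 0‖ = (ℓ : ℝ) ^ (-j) ∧ ‖v 1‖ ≤ (ℓ : ℝ) ^ (-N) →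
          ‖w 0‖ = (ℓ : ℝ) ^ (-j) ∧ ‖w 1‖ ≤ (ℓ : ℝ) ^ (-N) := by
        rintro v w c0 c1 ⟨d0, d1⟩
        have hlt : (ℓ : ℝ) ^ (-N) < (ℓ : ℝ) ^ (-j) :=
          not_le.1 fun h => by rw [zpow_le_iff] at h; omega
        constructor
        · have : w 0 = v 0 + -(v 0 - w 0) := by ring
          rw [this, Padic.add_eq_max_of_ne (by rw [norm_neg, d0]; exact (c0.trans_lt hlt).ne'),
            norm_neg, d0, max_eq_left (c0.trans hlt.le)]
        · have : w 1 = v 1 + -(v 1 - w 1) := by ring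
          rw [this]
          exact (Padic.nonarchimedean _ _).trans (max_le d1 (by rwa [norm_neg]))
      rw [hy, hy]
      congr 1
      exact propext ⟨key v w c0 c1, key w v (by rwa [norm_sub_rev]) (by rwa [norm_sub_rev])⟩)
  have hball : ∀ x ∈ T, y.1 x = 1 ∧ μ (chBall x N) = μ (chBall ![(ℓ : ℚ_[ℓ]) ^ j, 0] N) := by
    intro x hx
    have hx' := hT x hx
    rw [hy] at hx' ⊢
    by_cases hc : ‖x 0‖ = (ℓ : ℝ) ^ (-j) ∧ ‖x 1‖ ≤ (ℓ : ℝ) ^ (-N)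
    · refine ⟨if_pos hc, ?_⟩
      set u := x 0 / (ℓ : ℚ_[ℓ]) ^ j with hu
      have hz := ell_zpow_ne_zero (ℓ := ℓ) j
      have hu1 : ‖u‖ = 1 := by
        rw [hu, norm_div, hc.1, norm_ell_zpow, div_self]
        exact (zpow_pos (by linarith [one_lt_ell (ℓ := ℓ)]) _).ne'
      have hu0 : u ≠ 0 := by intro h; rw [h] at hu1; simp at hu1
      have hxu : ‖x - ![(ℓ : ℚ_[ℓ]) ^ j, 0] ᵥ* (scalarGL u hu0).1‖ ≤ (ℓ : ℝ) ^ (-N) := by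
        rw [vecMul_scalarGL, pi_norm_le_iff_of_nonneg (by positivity), Fin.forall_fin_two]
        constructor
        · have : x 0 - u * (ℓ : ℚ_[ℓ]) ^ j = 0 := by rw [hu]; field_simp; ring
          simp only [Pi.sub_apply, Pi.smul_apply, cons_val_zero, smul_eq_mul, this, norm_zero]
          positivity
        · simpa using hc.2
      rw [chBall_congr hxu, ← h₂ u hu0 hu1, glAct_chBall (scalarGL_mem hu1 hu0)]
    · rw [if_neg hc] at hx'
      exact absurd rfl hx'
  have hsum' : y = ∑ x ∈ T, y.1 x • chBall x N := by
    apply Subtype.ext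
    refine hsum.trans ?_
    simp [chBall_eq_indicator]
  rw [hsum', map_sum] at hμy
  have hcard : ∑ x ∈ T, μ (y.1 x • chBall x N) =
      (T.card : ℂ) * μ (chBall ![(ℓ : ℚ_[ℓ]) ^ j, 0] N) := by
    rw [← nsmul_eq_mul, ← Finset.sum_const]
    refine Finset.sum_congr rfl fun x hx => ?_
    rw [(hball x hx).1, one_smul, (hball x hx).2]
  rw [hcard] at hμy
  rcases mul_eq_zero.1 hμy with h | h
  · exfalso
    have hTe : T = ∅ := Finset.card_eq_zero.1 (by exact_mod_cast h)
    have h1 : y.1 ![(ℓ : ℚ_[ℓ]) ^ j, 0] = 1 := by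
      rw [hy, if_pos]
      refine ⟨by simp only [cons_val_zero]; rw [norm_ell_zpow], ?_⟩
      simp only [cons_val_one, cons_val_fin_one, norm_zero]
      positivity
    rw [hTe] at hsum
    rw [hsum] at h1
    simp at h1
  · exact h

/-- A functional on Schwartz functions which is invariant under scaling by units and vanishes on
characteristic functions of lattices vanishes. -/
theorem eq_zero_of_lattices {μ : Schwartz ℓ →ₗ[ℂ] ℂ} (h₁ : ∀ h, μ (glAct h (chLattice ℓ)) = 0)
    (h₂ : ∀ u (hu0 : u ≠ 0), ‖u‖ = 1 → ∀ φ, μ (glAct (scalarGL u hu0) φ) = μ φ) : μ = 0 := by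
  have hball : ∀ v N, μ (chBall v N) = 0 := by
    intro v N
    by_cases hv : ‖v‖ ≤ (ℓ : ℝ) ^ (-N)
    · rw [chBall_congr (w := 0) (by rwa [sub_zero]), chBall_zero_eq, h₁]
    · have hv0 : v ≠ 0 := by
        rintro rfl
        exact hv (by rw [norm_zero]; positivity)
      obtain ⟨j, κ, hκ, rfl⟩ := exists_eq_vecMul hv0
      rw [norm_vecMul_eq hκ, norm_std, zpow_le_iff] at hv
      have e : chBall (![(ℓ : ℚ_[ℓ]) ^ j, 0] ᵥ* κ.1) N =
          glAct κ⁻¹ (chBall ![(ℓ : ℚ_[ℓ]) ^ j, 0] N) := by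
        rw [← glAct_chBall hκ ![(ℓ : ℚ_[ℓ]) ^ j, 0], ← glAct_mul, inv_mul_cancel]
        ext w
        simp [glAct_apply]
      rw [e]
      -- Translating by GL₂(ℤ_ℓ) preserves both hypotheses: lattices go to lattices, and scalars are
      -- central.
      refine map_chBall_std (μ := μ ∘ₗ glAct κ⁻¹) (fun h => ?_) (fun u hu0 hu φ => ?_)
        (by omega : j < N)
      · rw [LinearMap.comp_apply, ← glAct_mul, h₁]
      · rw [LinearMap.comp_apply, LinearMap.comp_apply, ← glAct_mul, ← scalarGL_mul, glAct_mul,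
          h₂ u hu0 hu]
  ext φ
  obtain ⟨N, hN⟩ := exists_uniform φ
  exact map_eq_zero_of_classes μ (ballSetoid ℓ N)
    (fun v => ⟨chBall v N, chBall_eq_indicator v N, hball v N⟩) φ hN

end Schwartz

end

section

open Matrix

variable {ℓ : ℕ} [Fact ℓ.Prime]

/-! ### From H(ℤ_ℓ)-invariance to invariance in each variable. -/

section Invariance

/-- The obstruction is the determinant condition in H. For diagonal a, the matrix diag(det κ, 1)
repairs it, since it commutes with a and is absorbed on the right; the Cartan decomposition reduces
general a to this case. -/
theorem left_invariant_of_diag {Ψ : GL (Fin 2) ℚ_[ℓ] → GL (Fin 2) ℚ_[ℓ] → ℂ}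
    (hl : ∀ η ∈ HInt ℓ, ∀ a b, Ψ (η.1.1 * a) (η.1.2 * b) = Ψ a b)
    (hr : ∀ κ ∈ GLInt ℓ 2, ∀ a b, Ψ (a * κ) b = Ψ a b) {κ : GL (Fin 2) ℚ_[ℓ]}
    (hκ : κ ∈ GLInt ℓ 2) (a b : GL (Fin 2) ℚ_[ℓ]) : Ψ a (κ * b) = Ψ a b ∧ Ψ (κ * a) b = Ψ a b := by
  have hD : ∀ κ ∈ GLInt ℓ 2, ∃ e ∈ GLInt ℓ 2, e.1.det = κ.1.det ∧
      ∀ x n, e * diagPow x n = diagPow x n * e := by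
    intro κ hκ
    have h1 := norm_det_of_mem_GLInt hκ
    refine ⟨gl2 κ.1.det 0 0 1 (by simpa using gl2_det_ne_zero κ),
      gl2_mem_GLInt h1.le (by simp) (by simp) (by simp) (by simpa using h1), ?_, fun x n => ?_⟩
    · rw [gl2_val, det_fin_two_of]; ring
    · apply gl2_ext <;> simp [diagPow, Matrix.mul_apply, Fin.sum_univ_two, mul_comm]
  have hdiag : ∀ κ ∈ GLInt ℓ 2, ∀ x n b, Ψ (diagPow x n) (κ * b) = Ψ (diagPow x n) b := by
    intro κ hκ x n b
    obtain ⟨e, he, hdet, hcomm⟩ := hD κ hκ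
    have := hl (mkH e κ hdet) (mem_HInt.2 ⟨he, hκ⟩) (diagPow x n) b
    simp only [mkH] at this
    rw [← this, hcomm, hr e he]
  have hsnd : ∀ κ ∈ GLInt ℓ 2, ∀ a b, Ψ a (κ * b) = Ψ a b := by
    intro κ hκ a
    obtain ⟨κ₁, h₁, κ₂, h₂, x, n, rfl⟩ := cartan a
    obtain ⟨e, he, hdet, -⟩ := hD κ₁ h₁
    have hred : ∀ b, Ψ (κ₁ * diagPow x n * κ₂) b = Ψ (diagPow x n) b := by
      intro b
      have := hl (mkH κ₁ e hdet.symm) (mem_HInt.2 ⟨h₁, he⟩) (diagPow x n) (e⁻¹ * b)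
      simp only [mkH, mul_inv_cancel_left] at this
      rw [hr κ₂ h₂, this, hdiag _ (inv_mem he)]
    intro b
    rw [hred, hred, hdiag κ hκ]
  refine ⟨hsnd κ hκ a b, ?_⟩
  obtain ⟨e, he, hdet, -⟩ := hD κ hκ
  have := hl (mkH κ e hdet.symm) (mem_HInt.2 ⟨hκ, he⟩) a (e⁻¹ * b)
  simp only [mkH, mul_inv_cancel_left] at this
  rw [this, hsnd _ (inv_mem he)]

end Invariance

/-! ### Cyclicity of the module of coinvariants. -/

section Pairing

/-- The bilinear form attached to a functional on the coinvariants. -/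
def pairing (μ : IModule ℓ →ₗ[ℂ] ℂ) : Schwartz ℓ →ₗ[ℂ] CcBi ⊥ (GInt ℓ) →ₗ[ℂ] ℂ :=
  TensorProduct.curry (μ ∘ₗ Representation.Coinvariants.mk _)

variable {μ : IModule ℓ →ₗ[ℂ] ℂ}

theorem pairing_apply (φ : Schwartz ℓ) (ξ : CcBi ⊥ (GInt ℓ)) :
    pairing μ φ ξ = μ (CoinvModule.tmul _ _ _ φ ξ) := rfl

theorem pairing_invariant (η : H ℚ_[ℓ]) (φ : Schwartz ℓ) (ξ : CcBi ⊥ (GInt ℓ)) :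
    pairing μ (glAct η.1.1 φ) (leftTranslation (iota ℓ) (GInt ℓ) η ξ) = pairing μ φ ξ := by
  have h := Representation.Coinvariants.mk_self_apply
    ((schwartzRep ℓ).tprod (leftTranslation (iota ℓ) (GInt ℓ))) η (φ ⊗ₜ[ℂ] ξ)
  rw [Representation.tprod_apply, TensorProduct.map_tmul, schwartzRep_eq] at h
  rw [pairing_apply, pairing_apply, CoinvModule.tmul, CoinvModule.tmul, h]

/-- Scalars in `H(ℚ_ℓ)`. -/
def scalarH (c : ℚ_[ℓ]) (hc : c ≠ 0) : H ℚ_[ℓ] := mkH (scalarGL c hc) (scalarGL c hc) rfl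

theorem iota_eq (η : H ℚ_[ℓ]) : iota ℓ η = (iotaGSp4 ℓ η, η.1.2) := rfl

theorem iota_scalarH_mul (c : ℚ_[ℓ]) (hc : c ≠ 0) (x : GSp4 ℚ_[ℓ] × GL (Fin 2) ℚ_[ℓ]) :
    iota ℓ (scalarH c hc) * x = x * iota ℓ (scalarH c hc) := by
  rw [iota_eq]
  refine Prod.ext (gsp_ext ?_) (scalarGL_mul c hc x.2)
  have h : (iotaGSp4 ℓ (scalarH c hc)).1.1 = c • (1 : Matrix (Fin 4) (Fin 4) ℚ_[ℓ]) := by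
    rw [iotaGSp4_val]
    ext i j
    fin_cases i <;> fin_cases j <;> simp [blockMat, scalarH, mkH, scalarGL]
  change (iotaGSp4 ℓ (scalarH c hc)).1.1 * x.1.1.1 = x.1.1.1 * (iotaGSp4 ℓ (scalarH c hc)).1.1
  rw [h]
  simp

/-- The lattice ℓ^n ℤ_ℓ² is a scalar translate of ℤ_ℓ². Coinvariance moves the inverse scalar to B,
and since it is central in G the result is still left G(ℤ_ℓ)-invariant, hence in the Hecke orbit of
ch(G(ℤ_ℓ)). -/
theorem pairing_chBall
    (h : ∀ θ : CcBi (GInt ℓ) (GInt ℓ),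
      pairing μ (chLattice ℓ) (rightAct θ (ch ⊥ (GInt ℓ) bot_le)) = 0)
    {B : CcBi ⊥ (GInt ℓ)} (hB : ∀ k ∈ GInt ℓ, ∀ x, B.1 (k * x) = B.1 x) (n : ℤ) :
    pairing μ (chBall 0 n) B = 0 := by
  set z := scalarH ((ℓ : ℚ_[ℓ]) ^ (-n)) (ell_zpow_ne_zero _)
  have e : leftTranslation (iota ℓ) (GInt ℓ) z (leftTranslation (iota ℓ) (GInt ℓ) z⁻¹ B) = B := by
    rw [← Module.End.mul_apply, ← map_mul, mul_inv_cancel, map_one, Module.End.one_apply]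
  rw [chBall_zero_eq, ← e]
  refine (pairing_invariant z (chLattice ℓ) _).trans ?_
  obtain ⟨θ, hθ⟩ := exists_rightAct_ch_eq bot_le (leftTranslation (iota ℓ) (GInt ℓ) z⁻¹ B)
    fun k hk x => by
      change B.1 ((iota ℓ z⁻¹)⁻¹ * (k * x)) = B.1 ((iota ℓ z⁻¹)⁻¹ * x)
      rw [map_inv, inv_inv, ← mul_assoc, iota_scalarH_mul, mul_assoc, hB k hk]
  rw [← hθ]
  exact h θ

/-- The function on triples attached to a functional on the coinvariants. -/
def coinvTriple (μ : IModule ℓ →ₗ[ℂ] ℂ)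
    (t : GL (Fin 2) ℚ_[ℓ] × GL (Fin 2) ℚ_[ℓ] × GSp4 ℚ_[ℓ]) : ℂ :=
  pairing μ (glAct t.1 (chLattice ℓ)) (chCoset (GInt ℓ) (t.2.2, t.2.1))

theorem coinvTriple_rel (t t' : GL (Fin 2) ℚ_[ℓ] × GL (Fin 2) ℚ_[ℓ] × GSp4 ℚ_[ℓ])
    (h : Rel t t') : coinvTriple μ t = coinvTriple μ t' := by
  obtain ⟨a, b, g⟩ := t
  obtain ⟨a', b', g'⟩ := t'
  obtain ⟨η, κ₁, h₁, κ₂, h₂, k, hk, e₁, e₂, e₃⟩ := h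
  simp only at e₁ e₂ e₃
  subst e₁ e₂ e₃
  simp only [coinvTriple]
  have e : ((iotaGSp4 ℓ η * g * k, η.1.2 * b * κ₂) : GSp4 ℚ_[ℓ] × GL (Fin 2) ℚ_[ℓ]) =
      iota ℓ η * (g, b) * (k, κ₂) := rfl
  rw [e, chCoset_mul_mem _ (show (k, κ₂) ∈ GInt ℓ from ⟨hk, h₂⟩), ← leftTranslation_chCoset,
    glAct_mul, glAct_chLattice h₁, glAct_mul, pairing_invariant]

/-- The average over k absorbs the image of η in GSp₄(ℤ_ℓ), and Φ is invariant under H. -/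
theorem mean_coinvTriple_mul_left {η : H ℚ_[ℓ]} (hη : η ∈ HInt ℓ) (a b : GL (Fin 2) ℚ_[ℓ])
    (g : GSp4 ℚ_[ℓ]) :
    mean (fun k : GSp4Int ℓ => coinvTriple μ (η.1.1 * a, η.1.2 * b, k * g)) =
      mean (fun k : GSp4Int ℓ => coinvTriple μ (a, b, k * g)) := by
  rw [← mean_mul_left (⟨iotaGSp4 ℓ η, iotaGSp4_mem_GSp4Int hη⟩ : GSp4Int ℓ)]
  congr 1
  funext k
  refine (coinvTriple_rel _ _ ⟨η, 1, one_mem _, 1, one_mem _, 1, one_mem _, by simp, by simp, ?_⟩).symm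
  simp [mul_assoc]

theorem mean_coinvTriple_invariant {κ : GL (Fin 2) ℚ_[ℓ]} (hκ : κ ∈ GLInt ℓ 2)
    (a b : GL (Fin 2) ℚ_[ℓ]) (g : GSp4 ℚ_[ℓ]) :
    mean (fun k : GSp4Int ℓ => coinvTriple μ (a, κ * b, k * g)) =
        mean (fun k : GSp4Int ℓ => coinvTriple μ (a, b, k * g)) ∧
      mean (fun k : GSp4Int ℓ => coinvTriple μ (κ * a, b, k * g)) =
        mean (fun k : GSp4Int ℓ => coinvTriple μ (a, b, k * g)) := by
  refine left_invariant_of_diag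
    (Ψ := fun a b => mean (fun k : GSp4Int ℓ => coinvTriple μ (a, b, k * g)))
    (fun η hη a b => mean_coinvTriple_mul_left hη a b g) (fun κ hκ a b => ?_) hκ a b
  congr 1
  funext k
  exact (coinvTriple_rel _ _ ⟨1, κ, hκ, 1, one_mem _, 1, one_mem _, by simp, by simp,
    by simp⟩).symm

/-- The GSp₄(ℤ_ℓ)-average does not change when b is moved by GL₂(ℤ_ℓ), so averaging over that
variable too costs nothing. -/
theorem mean_GInt_coinvTriple (a b : GL (Fin 2) ℚ_[ℓ]) (g : GSp4 ℚ_[ℓ]) :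
    mean (fun k : GInt ℓ => coinvTriple μ (a, k.1.2 * b, k.1.1 * g)) =
      mean (fun k : GSp4Int ℓ => coinvTriple μ (a, b, k * g)) := by
  have hc : Continuous (coinvTriple μ) := continuous_of_rel coinvTriple_rel
  have hmem : ∀ k₀ : GSp4Int ℓ, ((k₀ : GSp4 ℚ_[ℓ]), (1 : GL (Fin 2) ℚ_[ℓ])) ∈ GInt ℓ :=
    fun k₀ => ⟨k₀.2, one_mem _⟩
  have h1 : ∀ k₀ : GSp4Int ℓ,
      mean (fun k : GInt ℓ => coinvTriple μ (a, k.1.2 * b, k₀ * (k.1.1 * g))) =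
        mean (fun k : GInt ℓ => coinvTriple μ (a, k.1.2 * b, k.1.1 * g)) := by
    intro k₀
    rw [← mean_mul_left (⟨_, hmem k₀⟩ : GInt ℓ)
      (fun k : GInt ℓ => coinvTriple μ (a, k.1.2 * b, k.1.1 * g))]
    congr 1
    funext k
    simp [mul_assoc]
  have h2 : ∀ k : GInt ℓ,
      mean (fun k₀ : GSp4Int ℓ => coinvTriple μ (a, k.1.2 * b, k₀ * (k.1.1 * g))) =
        mean (fun k : GSp4Int ℓ => coinvTriple μ (a, b, k * g)) := by
    intro k
    rw [← (mean_coinvTriple_invariant (μ := μ) k.2.2 a b g).1, ← mean_mul_right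
      (F := fun k₀ : GSp4Int ℓ => coinvTriple μ (a, k.1.2 * b, k₀ * g))
      (hc.comp (continuous_const.prodMk (continuous_const.prodMk
        (continuous_subtype_val.mul continuous_const)))) (⟨k.1.1, k.2.1⟩ : GSp4Int ℓ)]
    congr 1
    funext k₀
    simp [mul_assoc]
  have h3 := mean_swap (F := fun (k₀ : GSp4Int ℓ) (k : GInt ℓ) =>
    coinvTriple μ (a, k.1.2 * b, k₀ * (k.1.1 * g))) (hc.comp (continuous_const.prodMk
      (((continuous_snd.comp (continuous_subtype_val.comp continuous_snd)).mul
        continuous_const).prodMk ((continuous_subtype_val.comp continuous_fst).mul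
        ((continuous_fst.comp (continuous_subtype_val.comp continuous_snd)).mul
          continuous_const)))))
  simp only [h1, h2, mean_const] at h3
  exact h3

/-- Averaging in all variables pairs a GL₂(ℤ_ℓ)-invariant Schwartz function with a left
G(ℤ_ℓ)-invariant function; `map_eq_zero_of_invariant` and `pairing_chBall` then give zero. -/
theorem mean_coinvTriple_eq_zero
    (h : ∀ θ : CcBi (GInt ℓ) (GInt ℓ),
      pairing μ (chLattice ℓ) (rightAct θ (ch ⊥ (GInt ℓ) bot_le)) = 0)
    (a b : GL (Fin 2) ℚ_[ℓ]) (g : GSp4 ℚ_[ℓ]) :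
    mean (fun k : GSp4Int ℓ => coinvTriple μ (a, b, k * g)) = 0 := by
  let G := GSp4 ℚ_[ℓ] × GL (Fin 2) ℚ_[ℓ]
  let B : CcBi ⊥ (GInt ℓ) := vmean (fun k : GInt ℓ =>
    chCoset (GInt ℓ) (ContinuousMonoidHom.id G (k : G) * (g, b)))
  have hB : ∀ k ∈ GInt ℓ, ∀ x, B.1 (k * x) = B.1 x := fun k hk x =>
    CcBi.left (orbitMean (K := GInt ℓ) (ContinuousMonoidHom.id G) (eq_map_id (GInt ℓ)) (g, b)) hk x
  let F : GLInt ℓ 2 → Schwartz ℓ := fun κ => glAct (κ.1 * a) (chLattice ℓ)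
  have hF : IsLocallyConstant F :=
    isLocallyConstant_glAct_chLattice.comp_continuous
      (f := fun κ : GLInt ℓ 2 => κ.1 * a) (by fun_prop)
  have e : ∀ κ : GLInt ℓ 2, mean (fun k : GSp4Int ℓ => coinvTriple μ (a, b, k * g)) =
      (pairing μ).flip B (F κ) := by
    intro κ
    rw [← (mean_coinvTriple_invariant (μ := μ) κ.2 a b g).2, ← mean_GInt_coinvTriple]
    exact (map_vmean (isLocallyConstant_chCoset_comp (ContinuousMonoidHom.id G) (g, b))
      (pairing μ (F κ))).symm
  have e' := map_vmean hF ((pairing μ).flip B)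
  simp only [← e, mean_const] at e'
  rw [← e']
  refine map_eq_zero_of_invariant _ (fun n => pairing_chBall h hB n) _ fun κ hκ => ?_
  let ev : (Fin 2 → ℚ_[ℓ]) → Schwartz ℓ →ₗ[ℂ] ℂ := fun v =>
    (LinearMap.proj v).comp (Schwartz ℓ).subtype
  ext v
  have h1 : (glAct κ (vmean F)).1 v = ev (v ᵥ* κ.1) (vmean F) := rfl
  have h2 : (vmean F).1 v = ev v (vmean F) := rfl
  rw [h1, h2, map_vmean hF, map_vmean hF,
    ← mean_mul_left (⟨κ, hκ⟩ : GLInt ℓ 2) (fun κ' => ev v (F κ'))]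
  congr 1
  funext κ'
  change (glAct κ (F κ')).1 v = (F (⟨κ, hκ⟩ * κ')).1 v
  simp only [F]
  rw [← glAct_mul, ← mul_assoc]
  rfl

theorem eq_zero_of_pairing
    (h : ∀ θ : CcBi (GInt ℓ) (GInt ℓ),
      pairing μ (chLattice ℓ) (rightAct θ (ch ⊥ (GInt ℓ) bot_le)) = 0) : μ = 0 := by
  have hadm : Admissible (coinvTriple μ) := ⟨coinvTriple_rel, mean_coinvTriple_eq_zero h⟩
  have hcoset : ∀ x, (pairing μ).flip (chCoset (GInt ℓ) x) = 0 := by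
    intro x
    -- Unit scalars are central in G and lie in G(ℤ_ℓ), so they fix the coset function; coinvariance
    -- then gives invariance in the Schwartz variable.
    refine eq_zero_of_lattices (fun a => hadm.eq_zero (a, x.2, x.1)) fun u hu0 hu φ => ?_
    have hmem : iota ℓ (scalarH u hu0) ∈ GInt ℓ :=
      ⟨iotaGSp4_mem_GSp4Int (mem_HInt.2 ⟨scalarGL_mem hu hu0, scalarGL_mem hu hu0⟩),
        scalarGL_mem hu hu0⟩
    have e : chCoset (GInt ℓ) x =
        leftTranslation (iota ℓ) (GInt ℓ) (scalarH u hu0) (chCoset (GInt ℓ) x) := by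
      rw [leftTranslation_chCoset, iota_scalarH_mul, chCoset_mul_mem _ hmem]
    rw [LinearMap.flip_apply, LinearMap.flip_apply]
    conv_lhs => rw [e]
    exact pairing_invariant (scalarH u hu0) φ _
  have hp : pairing μ = 0 := by
    ext φ ξ
    obtain ⟨T, hT⟩ := exists_eq_sum_chCoset (CcBi.compact ξ) (K := GInt ℓ)
      fun k hk x => CcBi.right ξ hk x
    have e : ξ = ∑ x ∈ T, ξ.1 x • chCoset (GInt ℓ) x := by
      apply Subtype.ext
      refine hT.trans ?_
      simp
    rw [e, map_sum]
    refine Finset.sum_eq_zero fun x _ => ?_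
    rw [map_smul, ← LinearMap.flip_apply, hcoset]
    simp
  refine Representation.Coinvariants.hom_ext (TensorProduct.ext' fun φ ξ => ?_)
  exact LinearMap.congr_fun (LinearMap.congr_fun hp φ) ξ

/-- The Hecke orbit map of the class of `ch(ℤ_ℓ²) ⊗ ch(G(ℤ_ℓ))`. -/
def orbitMap : HeckeAlg (GInt ℓ) →ₗ[ℂ] IModule ℓ where
  toFun θ := θ • chI ℓ
  map_add' θ θ' := add_smul θ θ' _
  map_smul' c θ := by
    simp only [chI, CoinvModule.smul_tmul, smul_assoc, RingHom.id_apply]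
    simp only [CoinvModule.tmul, TensorProduct.tmul_smul, map_smul]

theorem span_chI : Submodule.span (HeckeAlg (GInt ℓ)) {chI ℓ} = ⊤ := by
  have htop : LinearMap.range (orbitMap (ℓ := ℓ)) = ⊤ := by
    by_contra hne
    obtain ⟨μ, hμ, hle⟩ := Submodule.exists_le_ker_of_lt_top _ (lt_top_iff_ne_top.2 hne)
    exact hμ (eq_zero_of_pairing fun θ => hle ⟨θ, rfl⟩)
  rw [eq_top_iff]
  rintro x -
  obtain ⟨θ, rfl⟩ := LinearMap.range_eq_top.1 htop x
  exact Submodule.smul_mem _ _ (Submodule.mem_span_singleton_self _)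

end Pairing

end

end GSp4Hecke

end

theorem mainTheorem7 (ℓ : ℕ) [Fact ℓ.Prime] :
    Submodule.span (GSp4Hecke.HeckeAlg (GSp4Hecke.HInt ℓ) ⊗[ℂ]
        GSp4Hecke.HeckeAlg (GSp4Hecke.GSp4Int ℓ)) {GSp4Hecke.chGSp4 ℓ} = ⊤ ∧
      Submodule.span (GSp4Hecke.HeckeAlg (GSp4Hecke.GInt ℓ)) {GSp4Hecke.chI ℓ} = ⊤ := by
  exact ⟨GSp4Hecke.span_chGSp4, GSp4Hecke.span_chI⟩
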